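/- Let $n\in\mathbb N$, let $m=(m_1,\dots,m_n)$ be positive integers, and let $E_m=\{z\in\mathbb C^n : \sum_{j=1}^n |z_j|^{2m_j}<1\}$, with defining function $r(z)=1-\sum_{j=1}^n|z_j|^{2m_j}$. The Bergman kernel (on the diagonal) of $E_m$ is $K^B(z)=\sum_j|\phi_j(z)|^2$, where $\{\phi_j\}$ is a complete orthonormal basis of the Hilbert space $B(E_m)$ of square-integrable holomorphic functions on $E_m$ (with respect to Lebesgue measure); the basis exists, the series converges on $E_m$, and its sum does not depend on the basis. Let $z^0\in\partial E_m$ and put $P=\{j : z^0_j=0,\ m_j\ne 1\}$, $Q=\{1,\dots,n\}\setminus P=\{j : z^0_j\ne0 \text{ or } m_j=1\}$, and $|\tfrac1m|_P=\sum_{j\in P}\tfrac1{m_j}$. For $z\in E_m$ define $t(z)=(t_j(z))_{j\in P}$ by $$t_j(z)\ge 0,\qquad t_j(z)^{2m_j}=\frac{|z_j|^{2m_j}}{1-\sum_{i\in Q}|z_i|^{2m_i}}\qquad(j\in P),$$ and let $\Delta=\{t\in\mathbb R^{P} : t_j\ge0,\ \sum_{j\in P}t_j^{2m_j}<1\}$,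 with closure $\overline\Delta$. Call $z^0$ strongly (resp. weakly) pseudoconvex if the degenerate rank of the Levi form at $z^0$, i.e. the complex dimension of the null space of the Levi form of $r$ restricted to the complex tangent space of $\partial E_m$ at $z^0$, is zero (resp. positive). Then $z^0$ is strongly pseudoconvex if and only if $P=\emptyset$, and there is a function $\Phi^B$ that is real analytic on an open neighbourhood of $\Delta$ in $\mathbb R^P$, and a function $g$ that is real analytic on a neighbourhood of $z^0$ in $\mathbb C^n$, such that for all $z\in E_m$ sufficiently close to $z^0$ $$K^B(z)=\frac{n!}{\pi^n}\ \prod_{j\in Q}m_j^2|z_j|^{2m_j-2}\ \cdot \frac{\Phi^B(t(z))}{r(z)^{|Q|+|\frac1m|_P+1}}+g(z).$$ Moreover: (i) if $z^0$ is strongly pseudoconvex, then $\Phi^B=1$ identically on $\Delta$; (ii) if $z^0$ is weakly pseudoconvex, then $\Phi^B>0$ on $\Delta$, and $\Phi^B$ is unbounded as $t\in\Delta$ approaches $\overline\Delta\setminus\Delta$, in the sense that $\Phi^B(t)\to+\infty$ as $\Delta\ni t\to t^0$, for every $t^0\in\overline\Delta\setminus\Delta$. -/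

import Mathlib

open MeasureTheory Filter Topology

/-- The Bergman space `B(Ω)`: the square-integrable functions on `Ω` (classes modulo null sets,
for Lebesgue measure on `ℂⁿ`) that are represented by a holomorphic function on `Ω`. -/
def bergmanSpace {n : ℕ} (Ω : Set (Fin n → ℂ)) :
    Submodule ℂ (Lp ℂ 2 (volume.restrict Ω)) where
  carrier := {f | ∃ g : (Fin n → ℂ) → ℂ, DifferentiableOn ℂ g Ω ∧ f =ᵐ[volume.restrict Ω] g}
  add_mem' := by
    rintro f₁ f₂ ⟨g₁, hg₁, h₁⟩ ⟨g₂, hg₂, h₂⟩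
    exact ⟨g₁ + g₂, hg₁.add hg₂, (Lp.coeFn_add f₁ f₂).trans (h₁.add h₂)⟩
  zero_mem' := ⟨0, differentiableOn_const 0, Lp.coeFn_zero _ _ _⟩
  smul_mem' := by
    rintro c f ⟨g, hg, h⟩
    exact ⟨c • g, hg.const_smul c, (Lp.coeFn_smul c f).trans (h.const_smul c)⟩

/-- The holomorphic function on `Ω` representing an element of the Bergman space
(for open `Ω` its values on `Ω` are uniquely determined). -/
noncomputable def holomorphicRep {n : ℕ} {Ω : Set (Fin n → ℂ)} (f : bergmanSpace Ω) :
    (Fin n → ℂ) → ℂ :=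
  f.2.choose

/-- `K` is the Bergman kernel of `Ω` on the diagonal: `B(Ω)` has a complete orthonormal basis,
and `K(z) = ∑ⱼ |φⱼ(z)|²` on `Ω`, the series being convergent, for each complete orthonormal basis
`(φⱼ)` of `B(Ω)`. This determines `K` on `Ω`. -/
def IsBergmanKernel {n : ℕ} (Ω : Set (Fin n → ℂ)) (K : (Fin n → ℂ) → ℝ) : Prop :=
  (∃ ι : Type, Nonempty (HilbertBasis ι ℂ (bergmanSpace Ω))) ∧
    ∀ (ι : Type) (φ : HilbertBasis ι ℂ (bergmanSpace Ω)), ∀ z ∈ Ω,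
      HasSum (fun i => ‖holomorphicRep (φ i) z‖ ^ 2) (K z)

/-- The Levi form (complex Hessian) `∑ ∂²ρ/∂zⱼ∂z̄ₖ(z) vⱼ w̄ₖ` of a real function `ρ` on `ℂⁿ`,
written through the real second derivative `H` of `ρ` at `z`. -/
noncomputable def leviForm {n : ℕ} (ρ : (Fin n → ℂ) → ℝ) (z v w : Fin n → ℂ) : ℂ :=
  let H := fderiv ℝ (fderiv ℝ ρ) z
  (1 / 4 : ℂ) * (((H v w + H (Complex.I • v) (Complex.I • w) : ℝ) : ℂ)
    + Complex.I * ((H v (Complex.I • w) - H (Complex.I • v) w : ℝ) : ℂ))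

/-- Multiplication by a complex number, in terms of its real and imaginary part. -/
theorem complex_smul_eq {n : ℕ} (c : ℂ) (v : Fin n → ℂ) :
    c • v = c.re • v + c.im • (Complex.I • v) := by
  ext j
  simp only [Pi.smul_apply, Pi.add_apply, smul_eq_mul, Complex.real_smul]
  conv_lhs => rw [← Complex.re_add_im c]
  ring

theorem leviForm_smul {n : ℕ} (ρ : (Fin n → ℂ) → ℝ) (z : Fin n → ℂ) (c : ℂ)
    (v w : Fin n → ℂ) : leviForm ρ z (c • v) w = c * leviForm ρ z v w := by
  have h1 : Complex.I • (c • v) = c.re • (Complex.I • v) + (-c.im) • v := by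
    rw [complex_smul_eq c v]
    ext j
    simp only [Pi.smul_apply, Pi.add_apply, smul_eq_mul, Complex.real_smul, Complex.ofReal_neg]
    linear_combination (c.im : ℂ) * v j * Complex.I_mul_I
  unfold leviForm
  simp only [h1]
  rw [complex_smul_eq c v]
  simp only [map_add, map_smul, add_apply, smul_apply,
    smul_eq_mul]
  push_cast
  conv_rhs => rw [← Complex.re_add_im c]
  linear_combination (-(1 / 4 : ℂ) * c.im * (fderiv ℝ (fderiv ℝ ρ) z v (Complex.I • w)
    - fderiv ℝ (fderiv ℝ ρ) z (Complex.I • v) w)) * Complex.I_mul_I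

theorem leviForm_add {n : ℕ} (ρ : (Fin n → ℂ) → ℝ) (z v₁ v₂ w : Fin n → ℂ) :
    leviForm ρ z (v₁ + v₂) w = leviForm ρ z v₁ w + leviForm ρ z v₂ w := by
  unfold leviForm
  simp only [smul_add, map_add, add_apply]
  push_cast
  ring

/-- The complex tangent space at `z` of the level set of `ρ` through `z`: the vectors `v` with
`∑ ∂ρ/∂zⱼ(z) vⱼ = 0`, that is, `dρ(v) = dρ(iv) = 0`. -/
def complexTangent {n : ℕ} (ρ : (Fin n → ℂ) → ℝ) (z : Fin n → ℂ) :
    Submodule ℂ (Fin n → ℂ) where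
  carrier := {v | fderiv ℝ ρ z v = 0 ∧ fderiv ℝ ρ z (Complex.I • v) = 0}
  add_mem' := by
    rintro v w ⟨h₁, h₂⟩ ⟨h₃, h₄⟩
    simp [smul_add, h₁, h₂, h₃, h₄]
  zero_mem' := by simp
  smul_mem' := by
    rintro c v ⟨h₁, h₂⟩
    refine ⟨?_, ?_⟩
    · rw [complex_smul_eq c v, map_add, map_smul, map_smul, h₁, h₂]
      simp
    · rw [smul_smul, complex_smul_eq (Complex.I * c) v, map_add, map_smul, map_smul, h₁, h₂]
      simp

/-- The null space of the Levi form of `ρ` at `z`, restricted to the complex tangent space. -/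
noncomputable def leviKernel {n : ℕ} (ρ : (Fin n → ℂ) → ℝ) (z : Fin n → ℂ) :
    Submodule ℂ (Fin n → ℂ) where
  carrier := {v | v ∈ complexTangent ρ z ∧ ∀ w ∈ complexTangent ρ z, leviForm ρ z v w = 0}
  add_mem' := by
    rintro v₁ v₂ ⟨h₁, h₂⟩ ⟨h₃, h₄⟩
    exact ⟨add_mem h₁ h₃, fun w hw => by rw [leviForm_add, h₂ w hw, h₄ w hw, add_zero]⟩
  zero_mem' := ⟨zero_mem _, fun w _ => by simp [leviForm]⟩
  smul_mem' := by
    rintro c v ⟨h₁, h₂⟩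
    exact ⟨Submodule.smul_mem _ c h₁, fun w hw => by rw [leviForm_smul, h₂ w hw, mul_zero]⟩

/-- The degenerate rank of the Levi form: the complex dimension of its null space. -/
noncomputable def leviDegenerateRank {n : ℕ} (ρ : (Fin n → ℂ) → ℝ) (z : Fin n → ℂ) : ℕ :=
  Module.finrank ℂ (leviKernel ρ z)

namespace Ellipsoid

/-- The defining function `r(z) = 1 - ∑ |zⱼ|^{2mⱼ}` (the radial variable). -/
noncomputable def r {n : ℕ} (m : Fin n → ℕ) (z : Fin n → ℂ) : ℝ :=
  1 - ∑ j, ‖z j‖ ^ (2 * m j)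

/-- The domain `E_m = {z ∈ ℂⁿ : ∑ |zⱼ|^{2mⱼ} < 1}`. -/
def E {n : ℕ} (m : Fin n → ℕ) : Set (Fin n → ℂ) :=
  {z | ∑ j, ‖z j‖ ^ (2 * m j) < 1}

open Classical in
/-- The indices `j` with `z⁰ⱼ = 0` and `mⱼ ≠ 1`. -/
noncomputable def P {n : ℕ} (m : Fin n → ℕ) (z₀ : Fin n → ℂ) : Finset (Fin n) :=
  Finset.univ.filter fun j => z₀ j = 0 ∧ m j ≠ 1

open Classical in
/-- The indices `j` with `z⁰ⱼ ≠ 0` or `mⱼ = 1`. -/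
noncomputable def Q {n : ℕ} (m : Fin n → ℕ) (z₀ : Fin n → ℂ) : Finset (Fin n) :=
  Finset.univ.filter fun j => z₀ j ≠ 0 ∨ m j = 1

/-- The angular variables around `z⁰`: `tⱼ(z) ≥ 0` and
`tⱼ(z)^{2mⱼ} = |zⱼ|^{2mⱼ} / (1 - ∑_{i ∈ Q} |zᵢ|^{2mᵢ})` for `j ∈ P`. -/
noncomputable def t {n : ℕ} (m : Fin n → ℕ) (z₀ z : Fin n → ℂ) : P m z₀ → ℝ := fun j =>
  (‖z j‖ ^ (2 * m j) / (1 - ∑ i ∈ Q m z₀, ‖z i‖ ^ (2 * m i))) ^ (1 / (2 * (m j : ℝ)))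

/-- The locally closed simplex `Δ = {t ∈ ℝ^P : tⱼ ≥ 0, ∑ tⱼ^{2mⱼ} < 1}`. -/
def Δ {n : ℕ} (m : Fin n → ℕ) (z₀ : Fin n → ℂ) : Set (P m z₀ → ℝ) :=
  {t | (∀ j, 0 ≤ t j) ∧ ∑ j, t j ^ (2 * m j) < 1}

/-- The exponent `|Q| + ∑_{j ∈ P} 1/mⱼ + 1`. -/
noncomputable def exponent {n : ℕ} (m : Fin n → ℕ) (z₀ : Fin n → ℂ) : ℝ :=
  ((Q m z₀).card : ℝ) + ∑ j ∈ P m z₀, 1 / (m j : ℝ) + 1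

end Ellipsoid

/-! The domain is a complete Reinhardt domain, so the normalised monomials are a complete
orthonormal system of the Bergman space (`eq_zero_of_inner_bergmanMonomial`). Integrating
$|z^\alpha|^2 e^{-\sum|z_j|^{2m_j}}$ over $\mathbb C^n$ both as a product and along the sublevel
sets of the exponent gives $\|z^\alpha\|^2 = \prod_j \frac{\pi}{m_j}\Gamma(\frac{\alpha_j+1}{m_j}) /
\Gamma(\sum_j\frac{\alpha_j+1}{m_j}+1)$ (`setIntegral_monomial`). Writing the last Gamma value as an
integral in $\tau$ and summing over $\alpha$ yields $$K(z)=\frac{\prod m_j}{\pi^n}\int_0^\infty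
e^{-\tau}\prod_j \tau^{1/m_j} f_{m_j}(\tau^{1/m_j}|z_j|^2)\,d\tau,\qquad f_m(x)=\sum_a
\frac{x^a}{\Gamma((a+1)/m)}$$ (`kernel_eq_integral`).

Near the positive axis $f_m(x)=m x^{m-1}e^{x^m}$ up to an error of arbitrarily small exponential
type in $|x|^m$ (`norm_mittagRoot_sub_main_le`), and for $m=1$ this is exact. Replacing $f_{m_j}$ by
its main part for $j\in Q$ therefore changes the integrand by something that still decays
exponentially in $\tau$ when $x_j=|z_j|^2$ is complex and close to $|z^0_j|^2$. The difference is
holomorphic in $x$ there, hence real analytic in $z$ (`analyticAt_integral_mittag_sub`): this is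
$g$.

In the remaining integral the factors from $Q$ are $m_jx_j^{m_j-1}\tau e^{\tau x_j^{m_j}}$, so
$e^{-\tau}$ becomes $e^{-A\tau}$ with $A=1-\sum_Q|z_i|^{2m_i}$. Rescaling $\tau$ by $A$ leaves a
power of $A$ times a function of $t$ alone (`integral_mittagPartial`), and $r=A(1-\sum t_j^{2m_j})$
turns that power into one of $r$; the compensating factor goes into $\Phi$ (`angularFactor`).

If $P=\emptyset$ the integral is $\Gamma(n+1)$ and $\Phi=1$. Otherwise all the $f_m$ are positive,
and termwise lower bounds for them give $\Phi\ge c\,t_i^{2(m_i-1)}(1-\sum t_j^{2m_j})^{-(1-1/m_i)}$,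
which blows up because $m_i\ge2$ on $P$ (`exists_le_angularFactor`). The Levi form of $r$ is
diagonal with entries $-m_j^2|z_j|^{2m_j-2}$, and these vanish exactly for $j\in P$ (`leviForm_r`).
-/

/-! ### Cauchy's formula on polydiscs and Osgood's lemma. -/

theorem torusMap_mem_closedBall {n : ℕ} (c : Fin n → ℂ) {R : ℝ} (hR : 0 < R) (θ : Fin n → ℝ) :
    torusMap c (fun _ => R) θ ∈ Metric.closedBall c R := by
  rw [closedBall_pi _ hR.le, Set.mem_univ_pi]
  intro i
  simp [torusMap, dist_eq_norm, Complex.norm_exp_ofReal_mul_I, abs_of_pos hR]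

theorem norm_torusMap_sub {n : ℕ} (c : Fin n → ℂ) {R : ℝ} (hR : 0 < R) (θ : Fin n → ℝ)
    (i : Fin n) : ‖torusMap c (fun _ => R) θ i - c i‖ = R := by
  simp [torusMap, Complex.norm_exp_ofReal_mul_I, abs_of_pos hR]

theorem torusMap_ne {n : ℕ} {c w : Fin n → ℂ} {R : ℝ} (hR : 0 < R) (hw : w ∈ Metric.ball c R)
    (θ : Fin n → ℝ) (i : Fin n) : torusMap c (fun _ => R) θ i - w i ≠ 0 := by
  intro h
  have h1 := norm_torusMap_sub c hR θ i
  rw [sub_eq_zero.1 h, ← dist_eq_norm] at h1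
  exact absurd h1 (((dist_le_pi_dist w c i).trans_lt hw).ne)

theorem continuous_torusMap {n : ℕ} (c : Fin n → ℂ) (R : Fin n → ℝ) :
    Continuous (torusMap c R) := by
  unfold torusMap; fun_prop

theorem torusIntegrable_cauchy {n : ℕ} {f : (Fin n → ℂ) → ℂ} {c w : Fin n → ℂ} {R : ℝ} (hR : 0 < R)
    (hc : ContinuousOn f (Metric.closedBall c R)) (hw : w ∈ Metric.ball c R) :
    TorusIntegrable (fun x => (∏ j, (x j - w j))⁻¹ * f x) c (fun _ => R) := by
  refine Continuous.integrableOn_Icc (Continuous.mul (Continuous.inv₀ ?_ ?_) ?_)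
  · have := continuous_torusMap c (fun _ => R)
    fun_prop
  · exact fun θ => Finset.prod_ne_zero_iff.2 fun i _ => torusMap_ne hR hw θ i
  · exact hc.comp_continuous (continuous_torusMap _ _) (torusMap_mem_closedBall c hR)

/-- The one-variable Cauchy formula is applied in each coordinate, peeling off one circle per
induction step. Only separate holomorphy is needed; the base points range over the closed polydisc
because the other coordinates lie on the circles. -/
theorem torusIntegral_cauchy {n : ℕ} (f : (Fin n → ℂ) → ℂ) (c w : Fin n → ℂ) {R : ℝ} (hR : 0 < R)
    (hc : ContinuousOn f (Metric.closedBall c R))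
    (hd : ∀ z ∈ Metric.closedBall c R, ∀ j, ∀ a ∈ Metric.ball (c j) R,
      DifferentiableAt ℂ (fun b => f (Function.update z j b)) a)
    (hw : w ∈ Metric.ball c R) :
    torusIntegral (fun x => (∏ j, (x j - w j))⁻¹ * f x) c (fun _ => R)
      = (2 * Real.pi * Complex.I) ^ n * f w := by
  induction n with
  | zero => simp [Subsingleton.elim w c]
  | succ n ih =>
    rw [torusIntegral_succ (torusIntegrable_cauchy hR hc hw)]
    have hw' := hw
    rw [ball_pi _ hR, Set.mem_univ_pi] at hw'
    have hmem : ∀ x ∈ Metric.closedBall (c 0) R, ∀ y ∈ Metric.closedBall (c ∘ Fin.succ) R,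
        (Fin.cons x y : Fin (n + 1) → ℂ) ∈ Metric.closedBall c R := by
      intro x hx y hy
      rw [closedBall_pi _ hR.le, Set.mem_univ_pi] at hy ⊢
      intro i
      refine Fin.cases ?_ (fun i => ?_) i
      · simpa using hx
      · simpa using hy i
    have hws : (w ∘ Fin.succ) ∈ Metric.ball (c ∘ Fin.succ) R := by
      rw [ball_pi _ hR, Set.mem_univ_pi]
      exact fun i => hw' i.succ
    have key : ∀ x ∈ Metric.sphere (c 0) R,
        torusIntegral (fun y => (∏ j, ((Fin.cons x y : Fin (n + 1) → ℂ) j - w j))⁻¹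
            * f (Fin.cons x y)) (c ∘ Fin.succ) ((fun _ => R) ∘ Fin.succ)
          = (x - w 0)⁻¹ • ((2 * Real.pi * Complex.I) ^ n * f (Fin.cons x (w ∘ Fin.succ))) := by
      intro x hx
      have hx' := Metric.sphere_subset_closedBall hx
      have h := ih (fun y => f (Fin.cons x y)) (c ∘ Fin.succ) (w ∘ Fin.succ) ?_ ?_ hws
      · rw [smul_eq_mul, ← h, ← torusIntegral_const_mul]
        congr 1
        ext y
        simp only [Fin.prod_univ_succ, Fin.cons_zero, Fin.cons_succ, Function.comp, mul_inv]
        ring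
      · refine hc.comp ?_ (hmem x hx')
        have : Continuous fun y : Fin n → ℂ => (Fin.cons x y : Fin (n + 1) → ℂ) := by fun_prop
        exact this.continuousOn
      · intro z hz j a ha
        have := hd (Fin.cons x z) (hmem x hx' z hz) j.succ a ha
        simpa only [← Fin.cons_update] using this
    rw [circleIntegral.integral_congr hR.le key]
    have hup : ∀ x, (Fin.cons x (w ∘ Fin.succ) : Fin (n + 1) → ℂ)
        = Function.update (Fin.cons (c 0) (w ∘ Fin.succ) : Fin (n + 1) → ℂ) 0 x := by
      intro x; rw [Fin.update_cons_zero]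
    have hws' := Metric.ball_subset_closedBall hws
    rw [Complex.circleIntegral_sub_inv_smul_of_differentiable_on_off_countable
      (Set.countable_empty) (hw' 0)
      (f := fun x => (2 * Real.pi * Complex.I) ^ n * f (Fin.cons x (w ∘ Fin.succ)))]
    · rw [show (Fin.cons (w 0) (w ∘ Fin.succ) : Fin (n + 1) → ℂ) = w from Fin.cons_self_tail w]
      simp only [smul_eq_mul]; ring
    · refine ContinuousOn.mul continuousOn_const (hc.comp ?_ fun x hx => hmem x hx _ hws')
      have : Continuous fun x : ℂ => (Fin.cons x (w ∘ Fin.succ) : Fin (n + 1) → ℂ) := by fun_prop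
      exact this.continuousOn
    · intro x hx
      refine DifferentiableAt.const_mul ?_ _
      rw [funext fun x => congrArg f (hup x)]
      exact hd _ (hmem _ (Metric.mem_closedBall_self hR.le) _ hws') 0 x hx.1

/-- Osgood's lemma: a continuous function that is holomorphic in each variable is analytic. -/
theorem analyticOnNhd_of_separately {n : ℕ} {f : (Fin n → ℂ) → ℂ} {U : Set (Fin n → ℂ)}
    (hU : IsOpen U) (hc : ContinuousOn f U)
    (hd : ∀ z ∈ U, ∀ j, DifferentiableAt ℂ (fun b => f (Function.update z j b)) (z j)) :
    AnalyticOnNhd ℂ f U := by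
  intro c hcU
  obtain ⟨R, hR, hRU⟩ := Metric.nhds_basis_closedBall.mem_iff.1 (hU.mem_nhds hcU)
  -- Analyticity in `w` comes from the Cauchy kernel, seen as a map into the Banach algebra `C(K,
  -- ℂ)` of functions of the angles: inversion is analytic at units, and integration against `F` is
  -- a continuous linear functional `S`.
  let K := Set.Icc (0 : Fin n → ℝ) (fun _ => 2 * Real.pi)
  have : CompactSpace K := isCompact_iff_compactSpace.1 isCompact_Icc
  let μ : Measure K := (volume : Measure (Fin n → ℝ)).comap Subtype.val
  let ζ : Fin n → C(K, ℂ) := fun j =>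
    ⟨fun θ => torusMap c (fun _ => R) θ j,
      ((continuous_apply j).comp
        ((continuous_torusMap c (fun _ => R)).comp continuous_subtype_val) :)⟩
  let F : C(K, ℂ) :=
    ⟨fun θ => (∏ i, (R : ℂ) * Complex.exp ((θ : Fin n → ℝ) i * Complex.I) * Complex.I)
      * f (torusMap c (fun _ => R) θ), by
      refine Continuous.mul (continuous_finsetProd _ fun i _ => ?_) ?_
      · have : Continuous fun θ : K => (θ : Fin n → ℝ) i :=
          (continuous_apply i).comp continuous_subtype_val
        exact (continuous_const.mul (Complex.continuous_exp.comp
          ((Complex.continuous_ofReal.comp this).mul continuous_const))).mul continuous_const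
      exact (hc.mono hRU).comp_continuous ((continuous_torusMap _ _).comp continuous_subtype_val)
        fun θ => torusMap_mem_closedBall c hR _⟩
  let M : (Fin n → ℂ) → C(K, ℂ) := fun w => ∏ j, Ring.inverse (ζ j - algebraMap ℂ C(K, ℂ) (w j))
  have : IsFiniteMeasure μ := by
    refine ⟨?_⟩
    rw [MeasurableEmbedding.comap_apply (MeasurableEmbedding.subtype_coe measurableSet_Icc)]
    rw [Set.image_univ, Subtype.range_coe]
    exact measure_Icc_lt_top
  let S : C(K, ℂ) →L[ℂ] ℂ :=
    LinearMap.mkContinuous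
      { toFun := fun g => ∫ θ, (g * F) θ ∂μ
        map_add' := by
          intro g h
          simp only [add_mul, ContinuousMap.add_apply]
          exact integral_add ((g * F).continuous.integrable_of_hasCompactSupport
            (HasCompactSupport.of_compactSpace _)) ((h * F).continuous.integrable_of_hasCompactSupport
            (HasCompactSupport.of_compactSpace _))
        map_smul' := by
          intro a g
          simp only [smul_mul_assoc, ContinuousMap.smul_apply, RingHom.id_apply]
          exact integral_smul a _ }
      (‖F‖ * μ.real Set.univ) (by
        intro g
        refine (norm_integral_le_of_norm_le_const (C := ‖g * F‖) ?_).trans ?_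
        · exact ae_of_all _ fun θ => (g * F).norm_coe_le_norm θ
        · have := norm_mul_le g F
          nlinarith [measureReal_nonneg (μ := μ) (s := Set.univ)])
  have hunit : ∀ w ∈ Metric.ball c R, ∀ j, IsUnit (ζ j - algebraMap ℂ C(K, ℂ) (w j)) := by
    intro w hw j
    rw [ContinuousMap.isUnit_iff_forall_ne_zero]
    exact fun θ => torusMap_ne hR hw θ j
  have hM : AnalyticAt ℂ M c := by
    refine Finset.analyticAt_fun_prod _ fun j _ => ?_
    obtain ⟨u, hu⟩ := hunit c (Metric.mem_ball_self hR) j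
    have h1 : AnalyticAt ℂ (Ring.inverse : C(K, ℂ) → C(K, ℂ))
        (ζ j - algebraMap ℂ C(K, ℂ) (c j)) := by
      rw [← hu]; exact analyticAt_inverse u
    refine h1.fun_comp (f := fun w : Fin n → ℂ => ζ j - algebraMap ℂ C(K, ℂ) (w j)) ?_
    refine analyticAt_const.sub ?_
    exact ((Algebra.linearMap ℂ C(K, ℂ)).toContinuousLinearMap.comp
      (ContinuousLinearMap.proj (R := ℂ) (φ := fun _ : Fin n => ℂ) j)).analyticAt c
  have hS : AnalyticAt ℂ (fun w => ((2 * Real.pi * Complex.I) ^ n)⁻¹ * S (M w)) c :=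
    analyticAt_const.mul ((S.analyticAt _).comp hM)
  refine hS.congr ?_
  filter_upwards [Metric.ball_mem_nhds c hR] with w hw
  have hpi : ((2 * Real.pi * Complex.I) ^ n : ℂ) ≠ 0 := by
    apply pow_ne_zero; simp [Real.pi_ne_zero]
  rw [inv_mul_eq_iff_eq_mul₀ hpi, ← torusIntegral_cauchy f c w hR (hc.mono hRU) ?_ hw]
  · unfold torusIntegral
    change ∫ θ, (M w * F) θ ∂μ = _
    rw [← integral_subtype_comap measurableSet_Icc]
    refine integral_congr_ae (ae_of_all _ fun θ => ?_)
    have h2 : ∀ j, (Ring.inverse (ζ j - algebraMap ℂ C(K, ℂ) (w j))) θ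
        = (torusMap c (fun _ => R) θ j - w j)⁻¹ := by
      intro j
      have h3 := Ring.mul_inverse_cancel _ (hunit w hw j)
      have h4 := congrArg (fun g : C(K, ℂ) => g θ) h3
      simp only [ContinuousMap.mul_apply] at h4
      exact eq_inv_of_mul_eq_one_right h4
    have h5 : M w θ = ∏ j, (torusMap c (fun _ => R) θ j - w j)⁻¹ := by
      simp only [M, ContinuousMap.prod_apply, h2]
    simp only [ContinuousMap.mul_apply, h5, smul_eq_mul, F, ContinuousMap.coe_mk, Finset.prod_inv_distrib]
    ring
  · intro z hz j a ha
    have hz' : Function.update z j a ∈ Metric.closedBall c R := by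
      rw [closedBall_pi _ hR.le, Set.mem_univ_pi] at hz ⊢
      intro i
      by_cases h : i = j
      · subst h; simpa using (Metric.ball_subset_closedBall ha)
      · simpa [h] using hz i
    simpa using hd _ (hRU hz') j

/-! ### Holomorphy of parameter integrals. -/

/-- Only the functions themselves are dominated: Cauchy's estimate on discs of radius `R / 2` bounds
the derivatives by `B x / (R / 2)`. -/
theorem differentiableOn_integral_of_dominated {X : Type*} [MeasurableSpace X] {μ : Measure X}
    {U : Set ℂ} (hU : IsOpen U) {F : X → ℂ → ℂ} {B : X → ℝ}
    (hm : ∀ z ∈ U, AEStronglyMeasurable (fun x => F x z) μ)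
    (hd : ∀ᵐ x ∂μ, DifferentiableOn ℂ (F x) U)
    (hB : ∀ᵐ x ∂μ, ∀ z ∈ U, ‖F x z‖ ≤ B x) (hBi : Integrable B μ) :
    DifferentiableOn ℂ (fun z => ∫ x, F x z ∂μ) U := by
  intro z₀ hz₀
  obtain ⟨R, hR, hRU⟩ := Metric.nhds_basis_closedBall.mem_iff.1 (hU.mem_nhds hz₀)
  have hr : 0 < R / 2 := by positivity
  have hsub : ∀ z ∈ Metric.ball z₀ (R / 2), Metric.closedBall z (R / 2) ⊆ U := by
    intro z hz
    refine subset_trans (Metric.closedBall_subset_closedBall' ?_) hRU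
    have := Metric.mem_ball.1 hz
    linarith
  have hda : ∀ᵐ x ∂μ, ∀ z ∈ Metric.ball z₀ (R / 2), HasDerivAt (F x) (deriv (F x) z) z := by
    filter_upwards [hd] with x hx z hz
    exact (hx.differentiableAt (hU.mem_nhds
      (hsub z hz (Metric.mem_closedBall_self hr.le)))).hasDerivAt
  refine (hasDerivAt_integral_of_dominated_loc_of_deriv_le (μ := μ) (F := fun z x => F x z)
    (F' := fun z x => deriv (F x) z) (x₀ := z₀) (s := Metric.ball z₀ (R / 2))
    (bound := fun x => B x / (R / 2)) (Metric.ball_mem_nhds _ hr) ?_ ?_ ?_ ?_ ?_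
    ?_).2.differentiableAt.differentiableWithinAt
  · filter_upwards [hU.mem_nhds hz₀] with z hz using hm z hz
  · refine hBi.mono' (hm z₀ hz₀) ?_
    filter_upwards [hB] with x hx using hx z₀ hz₀
  · have hpos : ∀ k : ℕ, 0 < R / 2 / ((k : ℝ) + 1) := fun k => by positivity
    have hlt : ∀ k : ℕ, R / 2 / ((k : ℝ) + 1) ≤ R / 2 := fun k =>
      div_le_self hr.le (by linarith [(Nat.cast_nonneg k : (0 : ℝ) ≤ k)])
    have hlim : Tendsto (fun k : ℕ => ((R / 2 / ((k : ℝ) + 1) : ℝ) : ℂ)) atTop (𝓝[≠] 0) := by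
      refine tendsto_nhdsWithin_iff.2 ⟨?_, Eventually.of_forall fun k => ?_⟩
      · rw [← Complex.ofReal_zero]
        refine (Complex.continuous_ofReal.tendsto 0).comp ?_
        have := (tendsto_one_div_add_atTop_nhds_zero_nat (𝕜 := ℝ)).const_mul (R / 2)
        simpa [div_eq_mul_inv] using this
      · exact Complex.ofReal_ne_zero.2 (hpos k).ne'
    -- The derivative is measurable in `x` as an almost everywhere limit of difference quotients
    -- along a sequence of real increments.
    refine aestronglyMeasurable_of_tendsto_ae atTop (f := fun (k : ℕ) x =>
      ((R / 2 / ((k : ℝ) + 1) : ℝ) : ℂ)⁻¹ *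
        (F x (z₀ + ((R / 2 / ((k : ℝ) + 1) : ℝ) : ℂ)) - F x z₀)) (fun k => ?_) ?_
    · refine ((hm _ ?_).sub (hm _ hz₀)).const_mul _
      refine hsub z₀ (Metric.mem_ball_self hr) ?_
      rw [mem_closedBall_iff_norm, add_sub_cancel_left, Complex.norm_real, Real.norm_eq_abs,
        abs_of_pos (hpos k)]
      exact hlt k
    · filter_upwards [hda] with x hx
      exact (hx z₀ (Metric.mem_ball_self hr)).tendsto_slope_zero.comp hlim
  · filter_upwards [hB, hd] with x hx hdx z hz
    refine Complex.norm_deriv_le_of_forall_mem_sphere_norm_le hr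
      ((hdx.mono (hsub z hz)).diffContOnCl_ball subset_rfl) fun w hw => hx w ?_
    exact hsub z hz (Metric.sphere_subset_closedBall hw)
  · exact hBi.div_const _
  · exact hda

theorem analyticOnNhd_integral_of_dominated {X : Type*} [MeasurableSpace X] {μ : Measure X} {n : ℕ}
    {U : Set (Fin n → ℂ)} (hU : IsOpen U) {F : X → (Fin n → ℂ) → ℂ} {B : X → ℝ}
    (hm : ∀ z ∈ U, AEStronglyMeasurable (fun x => F x z) μ)
    (hd : ∀ᵐ x ∂μ, DifferentiableOn ℂ (F x) U)
    (hB : ∀ᵐ x ∂μ, ∀ z ∈ U, ‖F x z‖ ≤ B x) (hBi : Integrable B μ) :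
    AnalyticOnNhd ℂ (fun z => ∫ x, F x z ∂μ) U := by
  refine analyticOnNhd_of_separately hU ?_ ?_
  · refine continuousOn_of_dominated hm (fun z hz => ?_) hBi ?_
    · filter_upwards [hB] with x hx using hx z hz
    · filter_upwards [hd] with x hx using hx.continuousOn
  · intro z hz j
    have hcont : Continuous fun b : ℂ => Function.update z j b :=
      continuous_const.update j continuous_id
    have hV : IsOpen {b : ℂ | Function.update z j b ∈ U} := hU.preimage hcont
    have hzV : z j ∈ {b : ℂ | Function.update z j b ∈ U} := by simpa using hz
    refine (differentiableOn_integral_of_dominated hV (μ := μ) (B := B)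
      (F := fun x b => F x (Function.update z j b)) (fun b hb => hm _ hb) ?_ ?_
      hBi).differentiableAt (hV.mem_nhds hzV)
    · filter_upwards [hd] with x hx
      refine hx.comp ?_ fun b hb => hb
      exact fun b _ => (hasFDerivAt_update z b).differentiableAt.differentiableWithinAt
    · filter_upwards [hB] with x hx b hb using hx _ hb

/-! ### Mittag-Leffler functions of index one and their asymptotics. -/

/-- This compares the series `mittagOne` with the exponential series. In the induction the left side
gains the factor `k + 1`, the right side `k + 1 + β`. -/
theorem Gamma_add_one_mul_factorial_le {β : ℝ} (hβ : 0 < β) (k : ℕ) :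
    Real.Gamma (β + 1) * (k.factorial : ℝ) ≤ Real.Gamma (((k + 1 : ℕ) : ℝ) + β) := by
  induction k with
  | zero => simp [add_comm]
  | succ k ih =>
    have h : (((k + 1 + 1 : ℕ) : ℝ) + β) = (((k + 1 : ℕ) : ℝ) + β) + 1 := by push_cast; ring
    have h' : Real.Gamma ((((k + 1 : ℕ) : ℝ) + β) + 1)
        = (((k + 1 : ℕ) : ℝ) + β) * Real.Gamma (((k + 1 : ℕ) : ℝ) + β) :=
      Real.Gamma_add_one (by positivity)
    rw [h, h', Nat.factorial_succ]
    push_cast at ih ⊢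
    have h1 : 0 < Real.Gamma (β + 1) * (k.factorial : ℝ) :=
      mul_pos (Real.Gamma_pos_of_pos (by positivity)) (by positivity)
    have h2 : (0 : ℝ) ≤ k := Nat.cast_nonneg k
    nlinarith [mul_le_mul_of_nonneg_left ih (by positivity : (0 : ℝ) ≤ k + 1 + β)]

/-- The two-parameter Mittag-Leffler function `∑ yᵏ / Γ(k + β)` of index one. -/
noncomputable def mittagOne (β : ℝ) (y : ℂ) : ℂ := ∑' k : ℕ, y ^ k / (Real.Gamma (k + β) : ℂ)

theorem norm_mittagOne_term_le {β : ℝ} (hβ : 0 < β) (y : ℂ) (k : ℕ) :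
    ‖y ^ (k + 1) / (Real.Gamma ((k + 1 : ℕ) + β) : ℂ)‖
      ≤ ‖y‖ / Real.Gamma (β + 1) * (‖y‖ ^ k / k.factorial) := by
  have h0 : 0 < Real.Gamma (β + 1) := Real.Gamma_pos_of_pos (by positivity)
  have h1 : 0 < Real.Gamma (((k + 1 : ℕ) : ℝ) + β) := Real.Gamma_pos_of_pos (by positivity)
  rw [norm_div, norm_pow, Complex.norm_real, Real.norm_of_nonneg h1.le, div_mul_div_comm,
    ← pow_succ']
  exact div_le_div_of_nonneg_left (by positivity) (by positivity)
    (Gamma_add_one_mul_factorial_le hβ k)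

theorem summable_norm_mittagOne {β : ℝ} (hβ : 0 < β) (y : ℂ) :
    Summable fun k : ℕ => ‖y ^ k / (Real.Gamma (k + β) : ℂ)‖ := by
  rw [← summable_nat_add_iff 1]
  exact Summable.of_nonneg_of_le (fun _ => norm_nonneg _) (norm_mittagOne_term_le hβ y)
    ((Real.summable_pow_div_factorial ‖y‖).mul_left _)

theorem mittagOne_eq {β : ℝ} (hβ : 0 < β) (y : ℂ) :
    mittagOne β y = 1 / (Real.Gamma β : ℂ) + y * mittagOne (β + 1) y := by
  unfold mittagOne
  rw [(summable_norm_mittagOne hβ y).of_norm.tsum_eq_zero_add, ← tsum_mul_left]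
  simp only [pow_zero, Nat.cast_zero, zero_add, Nat.cast_add, Nat.cast_one, pow_succ']
  congr 1
  refine tsum_congr fun k => ?_
  rw [mul_div_assoc, add_assoc, add_comm 1 β]

theorem norm_mittagOne_le {β : ℝ} (hβ : 0 < β) (y : ℂ) :
    ‖mittagOne β y‖ ≤ 1 / Real.Gamma β + ‖y‖ / Real.Gamma (β + 1) * Real.exp ‖y‖ := by
  unfold mittagOne
  have hs := summable_norm_mittagOne hβ y
  refine (norm_tsum_le_tsum_norm hs).trans ?_
  rw [hs.tsum_eq_zero_add, Real.exp_eq_exp_ℝ, NormedSpace.exp_eq_tsum_div, ← tsum_mul_left]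
  refine add_le_add (le_of_eq ?_) ?_
  · simp [abs_of_pos (Real.Gamma_pos_of_pos hβ)]
  · exact Summable.tsum_le_tsum (norm_mittagOne_term_le hβ y) ((summable_nat_add_iff 1).2 hs)
      ((Real.summable_pow_div_factorial ‖y‖).mul_left _)

theorem mittagOne_one (y : ℂ) : mittagOne 1 y = Complex.exp y := by
  unfold mittagOne
  rw [Complex.exp_eq_exp_ℂ, NormedSpace.exp_eq_tsum_div]
  refine tsum_congr fun k => ?_
  rw [Real.Gamma_nat_eq_factorial]
  simp

theorem integrableOn_rpow_mul_exp {β ε : ℝ} (hβ : 0 < β) (hε : 0 < ε) :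
    IntegrableOn (fun u : ℝ => u ^ (β - 1) * Real.exp (-(ε * u))) (Set.Ioi 0) := by
  have := integrableOn_rpow_mul_exp_neg_mul_rpow (p := 1) (s := β - 1) (b := ε) (by linarith)
    one_pos hε
  simpa [neg_mul] using this

theorem norm_cpow_mul_cexp {β u : ℝ} (hu : 0 < u) (y : ℂ) :
    ‖(u : ℂ) ^ ((β : ℂ) - 1) * Complex.exp (-(y * u))‖ = u ^ (β - 1) * Real.exp (-(y.re * u)) := by
  rw [norm_mul, Complex.norm_exp, Complex.norm_cpow_eq_rpow_re_of_pos hu]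
  simp

theorem continuousOn_cpow_mul_cexp (β : ℝ) (y : ℂ) :
    ContinuousOn (fun u : ℝ => (u : ℂ) ^ ((β : ℂ) - 1) * Complex.exp (-(y * u))) (Set.Ioi 0) := by
  refine ContinuousOn.mul ?_ (by fun_prop)
  intro u hu
  exact ((Complex.continuousAt_ofReal_cpow_const u _
    (Or.inr (ne_of_gt hu)))).continuousWithinAt

theorem integrableOn_cpow_mul_cexp {β : ℝ} (hβ : 0 < β) {y : ℂ} (hy : 0 < y.re) :
    IntegrableOn (fun u : ℝ => (u : ℂ) ^ ((β : ℂ) - 1) * Complex.exp (-(y * u))) (Set.Ioi 0) := by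
  refine (integrableOn_rpow_mul_exp hβ hy).mono'
    ((continuousOn_cpow_mul_cexp β y).aestronglyMeasurable measurableSet_Ioi) ?_
  filter_upwards [ae_restrict_mem measurableSet_Ioi] with u hu
  exact (norm_cpow_mul_cexp hu y).le

/-- Both sides are holomorphic in the right half-plane and agree at the real points `1 + 1 / (k +
1)`, which accumulate at `1`. -/
theorem integral_cpow_mul_cexp {β : ℝ} (hβ : 0 < β) {y : ℂ} (hy : 0 < y.re) :
    ∫ u : ℝ in Set.Ioi 0, (u : ℂ) ^ ((β : ℂ) - 1) * Complex.exp (-(y * u))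
      = (1 / y) ^ (β : ℂ) * (Real.Gamma β : ℂ) := by
  have hopen : ∀ ε : ℝ, IsOpen {y : ℂ | ε < y.re} := fun ε =>
    isOpen_lt continuous_const Complex.continuous_re
  have h1 : AnalyticOnNhd ℂ (fun y : ℂ => ∫ u : ℝ in Set.Ioi 0,
      (u : ℂ) ^ ((β : ℂ) - 1) * Complex.exp (-(y * u))) {y : ℂ | 0 < y.re} := by
    intro y hy
    have hy2 : y.re / 2 < y.re := half_lt_self hy
    refine ((differentiableOn_integral_of_dominated (hopen (y.re / 2))
      (B := fun u : ℝ => u ^ (β - 1) * Real.exp (-(y.re / 2 * u)))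
      (fun z _ => (continuousOn_cpow_mul_cexp β z).aestronglyMeasurable measurableSet_Ioi)
      (ae_of_all _ fun u => ?_) ?_
      (integrableOn_rpow_mul_exp hβ (half_pos hy))).analyticOnNhd (hopen _)) y hy2
    · exact Differentiable.differentiableOn (by fun_prop)
    · filter_upwards [ae_restrict_mem measurableSet_Ioi] with u hu z hz
      rw [norm_cpow_mul_cexp hu]
      have hu' : (0 : ℝ) < u := hu
      have hz' : y.re / 2 < z.re := hz
      gcongr
  have h2 : AnalyticOnNhd ℂ (fun y : ℂ => (1 / y) ^ (β : ℂ) * (Real.Gamma β : ℂ))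
      {y : ℂ | 0 < y.re} := by
    refine DifferentiableOn.analyticOnNhd (fun y hy => ?_) (hopen 0)
    have hy' : 0 < y.re := hy
    have hy0 : y ≠ 0 := by rintro rfl; simp at hy'
    refine (DifferentiableAt.mul_const (DifferentiableAt.cpow_const (by fun_prop (disch := exact hy0)) ?_)
      _).differentiableWithinAt
    left
    rw [one_div, Complex.inv_re]
    exact div_pos hy' (Complex.normSq_pos.2 hy0)
  refine h1.eqOn_of_preconnected_of_frequently_eq h2
    ((convex_halfSpace_re_gt 0).isPreconnected) (z₀ := 1) (by simp) ?_ hy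
  have hlim : Tendsto (fun k : ℕ => ((1 + 1 / ((k : ℝ) + 1) : ℝ) : ℂ)) atTop (𝓝[≠] 1) := by
    refine tendsto_nhdsWithin_iff.2 ⟨?_, Eventually.of_forall fun k => ?_⟩
    · rw [← Complex.ofReal_one]
      refine (Complex.continuous_ofReal.tendsto 1).comp ?_
      simpa using (tendsto_one_div_add_atTop_nhds_zero_nat (𝕜 := ℝ)).const_add 1
    · have : (0 : ℝ) < 1 / ((k : ℝ) + 1) := by positivity
      simp only [Set.mem_compl_iff, Set.mem_singleton_iff]
      rw [← Complex.ofReal_one, Complex.ofReal_inj]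
      linarith
  refine hlim.frequently (Frequently.of_forall fun k => ?_)
  rw [← Complex.Gamma_ofReal]
  exact Complex.integral_cpow_mul_exp_neg_mul_Ioi (by simpa using hβ) (by positivity)

/-- Expand the exponential and integrate term by term: the beta integral
$B(\beta,k+1)=\Gamma(\beta)k!/\Gamma(k+1+\beta)$ produces the coefficients. -/
theorem mittagOne_add_one_eq_integral {β : ℝ} (hβ : 0 < β) (y : ℂ) :
    (Real.Gamma β : ℂ) * mittagOne (β + 1) y
      = ∫ u : ℝ in Set.Ioc 0 1, (u : ℂ) ^ ((β : ℂ) - 1) * Complex.exp (y * (1 - u)) := by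
  have hβ' : (0 : ℝ) < (β : ℂ).re := by simpa using hβ
  have hbeta : ∀ k : ℕ, ∫ u : ℝ in Set.Ioc 0 1, (u : ℂ) ^ ((β : ℂ) - 1) * (1 - (u : ℂ)) ^ k
      = (Real.Gamma β : ℂ) * k.factorial / (Real.Gamma (k + (β + 1)) : ℂ) := by
    intro k
    have h := Complex.Gamma_mul_Gamma_eq_betaIntegral hβ' (t := (k : ℂ) + 1)
      (by simp; positivity)
    rw [Complex.Gamma_nat_eq_factorial, Complex.betaIntegral, intervalIntegral.integral_of_le
      zero_le_one] at h
    have hG : (Real.Gamma (k + (β + 1)) : ℂ) = Complex.Gamma (β + (k + 1)) := by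
      rw [← Complex.Gamma_ofReal]; push_cast; ring_nf
    have hne : Complex.Gamma (β + (k + 1)) ≠ 0 := by
      rw [← hG]
      exact Complex.ofReal_ne_zero.2 (Real.Gamma_pos_of_pos (by positivity)).ne'
    rw [hG, eq_div_iff hne, ← Complex.Gamma_ofReal, h, mul_comm]
    congr 1
    refine integral_congr_ae (ae_of_all _ fun u => ?_)
    simp [Complex.cpow_natCast]
  have hint : IntegrableOn (fun u : ℝ => u ^ (β - 1)) (Set.Ioc 0 1) := by
    rw [← intervalIntegrable_iff_integrableOn_Ioc_of_le zero_le_one]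
    exact intervalIntegral.intervalIntegrable_rpow' (by linarith)
  have hmeas : ∀ k : ℕ, AEStronglyMeasurable (fun u : ℝ =>
      (u : ℂ) ^ ((β : ℂ) - 1) * (y ^ k * (1 - (u : ℂ)) ^ k / k.factorial))
      (volume.restrict (Set.Ioc 0 1)) := by
    intro k
    refine ContinuousOn.aestronglyMeasurable (ContinuousOn.mul (fun u hu => ?_) (by fun_prop))
      measurableSet_Ioc
    exact ((Complex.continuousAt_ofReal_cpow_const u _
      (Or.inr (ne_of_gt hu.1)))).continuousWithinAt
  have hle : ∀ k : ℕ, ∀ u ∈ Set.Ioc (0 : ℝ) 1,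
      ‖(u : ℂ) ^ ((β : ℂ) - 1) * (y ^ k * (1 - (u : ℂ)) ^ k / k.factorial)‖
        ≤ u ^ (β - 1) * (‖y‖ ^ k / k.factorial) := by
    intro k u hu
    rw [norm_mul, Complex.norm_cpow_eq_rpow_re_of_pos hu.1]
    have h1 : ‖(1 - (u : ℂ))‖ ≤ 1 := by
      rw [← Complex.ofReal_one, ← Complex.ofReal_sub, Complex.norm_real,
        Real.norm_of_nonneg (by linarith [hu.2])]
      linarith [hu.1]
    have h2 : ‖(1 - (u : ℂ))‖ ^ k ≤ 1 := pow_le_one₀ (norm_nonneg _) h1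
    simp only [Complex.sub_re, Complex.ofReal_re, Complex.one_re, norm_div, norm_mul, norm_pow,
      Complex.norm_natCast]
    have h3 : 0 ≤ u ^ (β - 1) := Real.rpow_nonneg hu.1.le _
    have h4 : ‖y‖ ^ k * ‖(1 - (u : ℂ))‖ ^ k ≤ ‖y‖ ^ k := mul_le_of_le_one_right (by positivity) h2
    gcongr
  have hI : ∀ k : ℕ, Integrable (fun u : ℝ =>
      (u : ℂ) ^ ((β : ℂ) - 1) * (y ^ k * (1 - (u : ℂ)) ^ k / k.factorial))
      (volume.restrict (Set.Ioc 0 1)) := by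
    intro k
    refine (hint.mul_const (‖y‖ ^ k / k.factorial)).mono' (hmeas k) ?_
    filter_upwards [ae_restrict_mem measurableSet_Ioc] with u hu using hle k u hu
  have hsum := hasSum_integral_of_summable_integral_norm hI (by
    refine Summable.of_nonneg_of_le (fun k => integral_nonneg fun u => norm_nonneg _) (fun k => ?_)
      ((Real.summable_pow_div_factorial ‖y‖).mul_left (∫ u : ℝ in Set.Ioc 0 1, u ^ (β - 1)))
    rw [← integral_mul_const]
    refine integral_mono_ae (hI k).norm (hint.mul_const _) ?_
    filter_upwards [ae_restrict_mem measurableSet_Ioc] with u hu using hle k u hu)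
  have h5 : ∀ u : ℝ, (u : ℂ) ^ ((β : ℂ) - 1) * Complex.exp (y * (1 - u))
      = ∑' k : ℕ, (u : ℂ) ^ ((β : ℂ) - 1) * (y ^ k * (1 - (u : ℂ)) ^ k / k.factorial) := by
    intro u
    rw [tsum_mul_left, Complex.exp_eq_exp_ℂ, NormedSpace.exp_eq_tsum_div]
    simp only [mul_pow]
  simp only [h5]
  rw [← hsum.tsum_eq, mittagOne, ← tsum_mul_left]
  refine tsum_congr fun k => ?_
  have h6 : ∀ u : ℝ, (u : ℂ) ^ ((β : ℂ) - 1) * (y ^ k * (1 - (u : ℂ)) ^ k / k.factorial)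
      = ((u : ℂ) ^ ((β : ℂ) - 1) * (1 - (u : ℂ)) ^ k) * (y ^ k / k.factorial) := fun u => by ring
  simp only [h6]
  rw [integral_mul_const, hbeta]
  have hk : (k.factorial : ℂ) ≠ 0 := by exact_mod_cast k.factorial_ne_zero
  field_simp

/-- After the shift `mittagOne_eq`, the function is $e^y$ times an integral over $(0,1]$. Extending
that integral to $(0,\infty)$ gives the main term exactly; the error is the tail over $(1,\infty)$,
where $u^{\beta-1}\le1$ because $\beta\le1$. -/
theorem norm_mittagOne_sub_le {β : ℝ} (hβ : 0 < β) (hβ1 : β ≤ 1) {y : ℂ} (hy : 0 < y.re) :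
    ‖mittagOne β y - y * (1 / y) ^ (β : ℂ) * Complex.exp y‖
      ≤ 1 / Real.Gamma β * (1 + ‖y‖ / y.re) := by
  have hG : 0 < Real.Gamma β := Real.Gamma_pos_of_pos hβ
  have hG' : (Real.Gamma β : ℂ) ≠ 0 := Complex.ofReal_ne_zero.2 hG.ne'
  have hsplit : (∫ u : ℝ in Set.Ioc 0 1, (u : ℂ) ^ ((β : ℂ) - 1) * Complex.exp (-(y * u)))
      + ∫ u : ℝ in Set.Ioi 1, (u : ℂ) ^ ((β : ℂ) - 1) * Complex.exp (-(y * u))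
      = (1 / y) ^ (β : ℂ) * (Real.Gamma β : ℂ) := by
    rw [← integral_cpow_mul_cexp hβ hy, ← Set.Ioc_union_Ioi_eq_Ioi (zero_le_one (α := ℝ)),
      setIntegral_union (Set.Ioc_disjoint_Ioi le_rfl) measurableSet_Ioi]
    · exact (integrableOn_cpow_mul_cexp hβ hy).mono_set Set.Ioc_subset_Ioi_self
    · exact (integrableOn_cpow_mul_cexp hβ hy).mono_set (Set.Ioi_subset_Ioi zero_le_one)
  have hfirst : (Real.Gamma β : ℂ) * mittagOne (β + 1) y = Complex.exp y *
      ∫ u : ℝ in Set.Ioc 0 1, (u : ℂ) ^ ((β : ℂ) - 1) * Complex.exp (-(y * u)) := by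
    rw [mittagOne_add_one_eq_integral hβ, ← integral_const_mul]
    refine integral_congr_ae (ae_of_all _ fun u => ?_)
    have : y * (1 - (u : ℂ)) = y + -(y * u) := by ring
    simp only
    rw [this, Complex.exp_add]
    ring
  have htail : ‖∫ u : ℝ in Set.Ioi 1, (u : ℂ) ^ ((β : ℂ) - 1) * Complex.exp (-(y * u))‖
      ≤ Real.exp (-y.re) / y.re := by
    have h1 := integral_exp_mul_Ioi (a := -y.re) (by linarith) 1
    rw [mul_one, neg_div_neg_eq] at h1
    rw [← h1]
    refine norm_integral_le_of_norm_le (integrableOn_exp_mul_Ioi (by linarith) 1) ?_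
    filter_upwards [ae_restrict_mem measurableSet_Ioi] with u hu
    have hu1 : (1 : ℝ) < u := hu
    rw [norm_cpow_mul_cexp (by linarith), neg_mul]
    exact mul_le_of_le_one_left (Real.exp_pos _).le
      (Real.rpow_le_one_of_one_le_of_nonpos hu1.le (by linarith))
  have hkey : mittagOne β y - y * (1 / y) ^ (β : ℂ) * Complex.exp y
      = 1 / (Real.Gamma β : ℂ) * (1 - y * Complex.exp y *
        ∫ u : ℝ in Set.Ioi 1, (u : ℂ) ^ ((β : ℂ) - 1) * Complex.exp (-(y * u))) := by
    rw [mittagOne_eq hβ]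
    field_simp
    linear_combination y * hfirst + y * Complex.exp y * hsplit
  rw [hkey, norm_mul, norm_div, norm_one, Complex.norm_real, Real.norm_of_nonneg hG.le]
  refine mul_le_mul_of_nonneg_left ?_ (by positivity)
  refine (norm_sub_le _ _).trans ?_
  rw [norm_one, norm_mul, norm_mul, Complex.norm_exp]
  gcongr
  calc _ ≤ ‖y‖ * Real.exp y.re * (Real.exp (-y.re) / y.re) := by gcongr
    _ = ‖y‖ / y.re * (Real.exp y.re * Real.exp (-y.re)) := by ring
    _ = _ := by rw [← Real.exp_add]; simp

/-! ### Mittag-Leffler functions of index 1/m: growth, main part, lower bounds. -/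

/-- The Mittag-Leffler function `∑ xᵃ / Γ((a + 1) / m)` of index `1 / m`. -/
noncomputable def mittagRoot (m : ℕ) (x : ℂ) : ℂ :=
  ∑' a : ℕ, x ^ a / (Real.Gamma ((a + 1) / m) : ℂ)

/-- The restriction of `mittagRoot` to the real line. -/
noncomputable def mittagRootReal (m : ℕ) (x : ℝ) : ℝ :=
  ∑' a : ℕ, x ^ a / Real.Gamma ((a + 1) / m)

/-- The exponentially growing part of `mittagRoot`. -/
noncomputable def mittagMain (m : ℕ) (x : ℂ) : ℂ := m * x ^ (m - 1) * Complex.exp (x ^ m)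

theorem mittagRoot_ofReal (m : ℕ) (x : ℝ) : mittagRoot m x = (mittagRootReal m x : ℂ) := by
  unfold mittagRoot mittagRootReal
  push_cast
  rfl

theorem mittagRoot_term_eq {m : ℕ} (hm : 1 ≤ m) (x : ℂ) (k i : ℕ) :
    x ^ (k * m + i) / (Real.Gamma (((k * m + i : ℕ) + 1) / m) : ℂ)
      = x ^ i * ((x ^ m) ^ k / (Real.Gamma (k + ((i + 1 : ℕ) : ℝ) / m) : ℂ)) := by
  have hm0 : (m : ℝ) ≠ 0 := by positivity
  have : ((((k * m + i : ℕ) : ℝ)) + 1) / m = k + ((i + 1 : ℕ) : ℝ) / m := by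
    push_cast; field_simp; ring
  rw [this, pow_add, pow_mul']
  ring

theorem summable_norm_mittagRoot {m : ℕ} (hm : 1 ≤ m) (x : ℂ) :
    Summable fun a : ℕ => ‖x ^ a / (Real.Gamma ((a + 1) / m) : ℂ)‖ := by
  have : NeZero m := ⟨by omega⟩
  rw [← (Nat.divModEquiv m).symm.summable_iff]
  refine (summable_prod_of_nonneg (fun _ => norm_nonneg _)).2 ⟨fun k => (hasSum_fintype _).summable, ?_⟩
  simp only [Nat.divModEquiv_symm_apply, tsum_fintype]
  refine summable_sum fun i _ => ?_
  simp only [mittagRoot_term_eq hm, norm_mul (x ^ (i : ℕ))]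
  exact (summable_norm_mittagOne (by positivity) _).mul_left _

/-- Sorting the exponents `a = k * m + i` by their residue `i` modulo `m` reduces everything to
index one. The parameters `(i + 1) / m` lie in `(0, 1]`, as `norm_mittagOne_sub_le` requires. -/
theorem mittagRoot_eq_sum {m : ℕ} (hm : 1 ≤ m) (x : ℂ) :
    mittagRoot m x
      = ∑ i ∈ Finset.range m, x ^ i * mittagOne (((i + 1 : ℕ) : ℝ) / m) (x ^ m) := by
  have : NeZero m := ⟨by omega⟩
  have hs := (summable_norm_mittagRoot hm x).of_norm
  rw [mittagRoot, ← (Nat.divModEquiv m).symm.tsum_eq]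
  rw [Summable.tsum_prod (f := fun c : ℕ × Fin m => x ^ ((Nat.divModEquiv m).symm c) /
    (Real.Gamma ((((Nat.divModEquiv m).symm c : ℕ) + 1) / m) : ℂ))
    ((Nat.divModEquiv m).symm.summable_iff.2 hs)]
  simp only [Nat.divModEquiv_symm_apply, tsum_fintype, mittagRoot_term_eq hm]
  rw [Summable.tsum_finsetSum, ← Fin.sum_univ_eq_sum_range
    (fun i => x ^ i * mittagOne (((i + 1 : ℕ) : ℝ) / m) (x ^ m))]
  · exact Finset.sum_congr rfl fun i _ => tsum_mul_left
  · exact fun i _ => ((summable_norm_mittagOne (by positivity) _).of_norm).mul_left _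

theorem mittagRoot_one (x : ℂ) : mittagRoot 1 x = mittagMain 1 x := by
  simp [mittagRoot_eq_sum le_rfl, mittagMain, mittagOne_one]

theorem differentiable_mittagRoot {m : ℕ} (hm : 1 ≤ m) : Differentiable ℂ (mittagRoot m) := by
  intro x
  have h := summable_norm_mittagRoot hm ((‖x‖ + 1 : ℝ) : ℂ)
  refine (Complex.differentiableOn_tsum_of_summable_norm h (U := Metric.ball 0 (‖x‖ + 1))
    (F := fun (a : ℕ) (x : ℂ) => x ^ a / (Real.Gamma ((a + 1) / m) : ℂ)) (fun a => ?_) Metric.isOpen_ball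
    fun a w hw => ?_).differentiableAt (Metric.isOpen_ball.mem_nhds (by simp))
  · exact Differentiable.differentiableOn (by fun_prop)
  · rw [norm_div, norm_div, norm_pow, norm_pow, Complex.norm_real (‖x‖ + 1),
      Real.norm_of_nonneg (by positivity)]
    have : ‖w‖ ≤ ‖x‖ + 1 := (mem_ball_zero_iff.1 hw).le
    gcongr

theorem differentiable_mittagMain (m : ℕ) : Differentiable ℂ (mittagMain m) := by
  unfold mittagMain; fun_prop

/-- Used to absorb polynomial factors into an arbitrarily small exponential rate. -/
theorem one_add_le_mul_exp {ε : ℝ} (hε : 0 < ε) {y : ℝ} (hy : 0 ≤ y) :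
    1 + y ≤ (1 + 1 / ε) * Real.exp (ε * y) := by
  have h1 := Real.add_one_le_exp (ε * y)
  have h2 : 0 < 1 / ε := by positivity
  have h3 : (1 + 1 / ε) * (ε * y + 1) = 1 + y + ε * y + 1 / ε := by field_simp; ring
  have h4 : 0 ≤ ε * y := by positivity
  nlinarith [mul_le_mul_of_nonneg_left h1 (by positivity : 0 ≤ 1 + 1 / ε)]

theorem pow_le_one_add_pow {x : ℝ} (hx : 0 ≤ x) {i m : ℕ} (him : i ≤ m) : x ^ i ≤ 1 + x ^ m := by
  rcases le_total x 1 with h | h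
  · linarith [pow_le_one₀ hx h (n := i), pow_nonneg hx m]
  · linarith [pow_le_pow_right₀ h him]

theorem norm_mittagRoot_le {m : ℕ} (hm : 1 ≤ m) {η : ℝ} (hη : 0 < η) :
    ∃ C : ℝ, 0 < C ∧ ∀ x : ℂ, ‖mittagRoot m x‖ ≤ C * Real.exp ((1 + η) * ‖x‖ ^ m) := by
  let D : ℕ → ℝ := fun i => 1 / Real.Gamma (((i + 1 : ℕ) : ℝ) / m)
    + 1 / Real.Gamma (((i + 1 : ℕ) : ℝ) / m + 1)
  have hD : ∀ i, 0 < D i := fun i => by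
    have h1 : 0 < Real.Gamma (((i + 1 : ℕ) : ℝ) / m) := Real.Gamma_pos_of_pos (by positivity)
    have h2 : 0 < Real.Gamma (((i + 1 : ℕ) : ℝ) / m + 1) := Real.Gamma_pos_of_pos (by positivity)
    positivity
  refine ⟨(∑ i ∈ Finset.range m, D i) * ((1 + 1 / (η / 2)) * (1 + 1 / (η / 2))), ?_, fun x => ?_⟩
  · have : 0 < ∑ i ∈ Finset.range m, D i :=
      Finset.sum_pos (fun i _ => hD i) (by simp; omega)
    positivity
  set y := ‖x‖ ^ m with hy
  have hy0 : 0 ≤ y := by positivity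
  have hE : 1 ≤ Real.exp y := Real.one_le_exp hy0
  -- One factor `1 + y` will bound `‖x‖ ^ i`, the other comes from the bound on `mittagOne`; each
  -- costs half of `η`.
  have hsq : (1 + y) * (1 + y) * Real.exp y
      ≤ ((1 + 1 / (η / 2)) * (1 + 1 / (η / 2))) * Real.exp ((1 + η) * y) := by
    have h1 := one_add_le_mul_exp (half_pos hη) hy0
    have h2 : Real.exp ((1 + η) * y)
        = Real.exp (η / 2 * y) * Real.exp (η / 2 * y) * Real.exp y := by
      rw [← Real.exp_add, ← Real.exp_add]; ring_nf
    rw [h2]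
    calc (1 + y) * (1 + y) * Real.exp y
        ≤ ((1 + 1 / (η / 2)) * Real.exp (η / 2 * y)) * ((1 + 1 / (η / 2)) * Real.exp (η / 2 * y))
          * Real.exp y := by gcongr
      _ = _ := by ring
  rw [mittagRoot_eq_sum hm, mul_assoc, Finset.sum_mul]
  refine (norm_sum_le _ _).trans (Finset.sum_le_sum fun i hi => ?_)
  refine le_trans ?_ (mul_le_mul_of_nonneg_left hsq (hD i).le)
  rw [norm_mul, norm_pow]
  have h1 : ‖x‖ ^ i ≤ 1 + y := pow_le_one_add_pow (norm_nonneg x) (Finset.mem_range.1 hi).le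
  have h2 := norm_mittagOne_le (β := ((i + 1 : ℕ) : ℝ) / m) (by positivity) (x ^ m)
  rw [norm_pow, ← hy] at h2
  have hG1 : 0 < Real.Gamma (((i + 1 : ℕ) : ℝ) / m) := Real.Gamma_pos_of_pos (by positivity)
  have hG2 : 0 < Real.Gamma (((i + 1 : ℕ) : ℝ) / m + 1) := Real.Gamma_pos_of_pos (by positivity)
  have h3 : 1 / Real.Gamma (((i + 1 : ℕ) : ℝ) / m)
      + y / Real.Gamma (((i + 1 : ℕ) : ℝ) / m + 1) * Real.exp y ≤ D i * ((1 + y) * Real.exp y) := by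
    have e1 : 1 ≤ (1 + y) * Real.exp y := by nlinarith
    have e2 : y * Real.exp y ≤ (1 + y) * Real.exp y := by nlinarith
    calc _ = 1 / Real.Gamma (((i + 1 : ℕ) : ℝ) / m) * 1
      + 1 / Real.Gamma (((i + 1 : ℕ) : ℝ) / m + 1) * (y * Real.exp y) := by ring
      _ ≤ 1 / Real.Gamma (((i + 1 : ℕ) : ℝ) / m) * ((1 + y) * Real.exp y)
        + 1 / Real.Gamma (((i + 1 : ℕ) : ℝ) / m + 1) * ((1 + y) * Real.exp y) := by gcongr
      _ = _ := by simp only [D]; ring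
  calc ‖x‖ ^ i * ‖mittagOne (((i + 1 : ℕ) : ℝ) / m) (x ^ m)‖
      ≤ (1 + y) * (D i * ((1 + y) * Real.exp y)) := by
        gcongr; exact h2.trans h3
    _ = _ := by ring

theorem norm_mittagMain_le (m : ℕ) {η : ℝ} (hη : 0 < η) :
    ∃ C : ℝ, 0 < C ∧ ∀ x : ℂ, ‖mittagMain m x‖ ≤ C * Real.exp ((1 + η) * ‖x‖ ^ m) := by
  refine ⟨(m + 1) * (1 + 1 / η), by positivity, fun x => ?_⟩
  have h1 : ‖x‖ ^ (m - 1) ≤ 1 + ‖x‖ ^ m := pow_le_one_add_pow (norm_nonneg x) (Nat.sub_le _ _)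
  have h2 := one_add_le_mul_exp hη (y := ‖x‖ ^ m) (by positivity)
  have h3 : ‖Complex.exp (x ^ m)‖ ≤ Real.exp (‖x‖ ^ m) := by
    rw [← norm_pow]; exact Complex.norm_exp_le_exp_norm _
  rw [mittagMain, norm_mul, norm_mul, norm_pow, Complex.norm_natCast]
  calc (m : ℝ) * ‖x‖ ^ (m - 1) * ‖Complex.exp (x ^ m)‖
      ≤ (m + 1) * ((1 + 1 / η) * Real.exp (η * ‖x‖ ^ m)) * Real.exp (‖x‖ ^ m) := by
        gcongr
        · linarith
        · exact h1.trans h2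
    _ = (m + 1) * (1 + 1 / η) * (Real.exp (η * ‖x‖ ^ m) * Real.exp (‖x‖ ^ m)) := by ring
    _ = _ := by rw [← Real.exp_add]; ring_nf

/-- The condition on the argument lets the principal power undo the `m`-th power of `x⁻¹`, so that
the left side is $x^m x^{-(i+1)}$. -/
theorem mul_one_div_pow_cpow {m i : ℕ} (hi : i < m) {x : ℂ} (hx : x ≠ 0)
    (h1 : -Real.pi < m * (x⁻¹).arg) (h2 : m * (x⁻¹).arg ≤ Real.pi) :
    x ^ m * (1 / x ^ m) ^ ((((i + 1 : ℕ) : ℝ) / m : ℝ) : ℂ) = x ^ (m - 1 - i) := by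
  have hm0 : (m : ℂ) ≠ 0 := by exact_mod_cast (by omega : m ≠ 0)
  rw [one_div, ← inv_pow, ← Complex.cpow_nat_mul' h1 h2]
  have : (m : ℂ) * ((((i + 1 : ℕ) : ℝ) / m : ℝ) : ℂ) = ((i + 1 : ℕ) : ℂ) := by
    push_cast; field_simp
  rw [this, Complex.cpow_natCast, inv_pow, mul_inv_eq_iff_eq_mul₀ (pow_ne_zero _ hx), ← pow_add]
  congr 1
  omega

/-- In a narrow sector around the positive axis each residue class `i` contributes $x^i\cdot
x^{m-1-i}e^{x^m}$, the same for all `i`; the `m` equal terms form `mittagMain`. The opening `κ` does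
not depend on `η`. -/
theorem norm_mittagRoot_sub_main_le {m : ℕ} (hm : 1 ≤ m) :
    ∃ κ : ℝ, 0 < κ ∧ ∀ η : ℝ, 0 < η → ∃ C : ℝ, 0 < C ∧ ∀ (ρ : ℝ) (x : ℂ), 0 < ρ →
      ‖x - ρ‖ ≤ κ * ρ → ‖mittagRoot m x - mittagMain m x‖ ≤ C * Real.exp (η * ‖x‖ ^ m) := by
  have hm0 : (0 : ℝ) < m := by exact_mod_cast hm
  have hcont : ∀ᶠ u : ℂ in 𝓝 1, u ≠ 0 ∧ ‖u ^ m‖ / 2 < (u ^ m).re ∧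
      -Real.pi < m * (u⁻¹).arg ∧ m * (u⁻¹).arg < Real.pi := by
    have hinv : ContinuousAt (fun u : ℂ => (m : ℝ) * (u⁻¹).arg) 1 := by
      refine continuousAt_const.mul (ContinuousAt.comp' (f := fun u : ℂ => u⁻¹) ?_
        (continuousAt_inv₀ one_ne_zero))
      exact Complex.continuousAt_arg (by simp)
    have hpow : ContinuousAt (fun u : ℂ => (u ^ m).re - ‖u ^ m‖ / 2) 1 := by
      fun_prop
    refine (eventually_ne_nhds one_ne_zero).and (Eventually.and ?_ (Eventually.and ?_ ?_))
    · filter_upwards [hpow.eventually (lt_mem_nhds (a := 0) (by norm_num))] with u hu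
      linarith
    · exact hinv.eventually (lt_mem_nhds (by simp [Real.pi_pos]))
    · exact hinv.eventually (gt_mem_nhds (by simp [Real.pi_pos]))
  obtain ⟨κ, hκ, hball⟩ := Metric.nhds_basis_closedBall.eventually_iff.1 hcont
  -- The `2` bounds `‖x ^ m‖ / (x ^ m).re`, which holds in the chosen sector.
  let D : ℕ → ℝ := fun i => 1 / Real.Gamma (((i + 1 : ℕ) : ℝ) / m) * (1 + 2)
  have hD : ∀ i, 0 < D i := fun i => by
    have h1 : 0 < Real.Gamma (((i + 1 : ℕ) : ℝ) / m) := Real.Gamma_pos_of_pos (by positivity)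
    positivity
  refine ⟨κ, hκ, fun η hη => ⟨(∑ i ∈ Finset.range m, D i) * (1 + 1 / η), ?_, fun ρ x hρ hx => ?_⟩⟩
  · have : 0 < ∑ i ∈ Finset.range m, D i :=
      Finset.sum_pos (fun i _ => hD i) (by simp; omega)
    positivity
  have hρ0 : (ρ : ℂ) ≠ 0 := Complex.ofReal_ne_zero.2 hρ.ne'
  have hu := hball (x := x / ρ) (by
    rw [mem_closedBall_iff_norm, div_sub_one hρ0, norm_div, Complex.norm_real,
      Real.norm_of_nonneg hρ.le, div_le_iff₀ hρ]
    exact hx)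
  obtain ⟨u, rfl⟩ : ∃ u : ℂ, x = ρ * u := ⟨x / ρ, by field_simp⟩
  rw [mul_div_cancel_left₀ _ hρ0] at hu
  obtain ⟨hu0, hure, harg1, harg2⟩ := hu
  -- The sector conditions are invariant under positive scaling, so they pass from `u` near `1` to
  -- `ρ * u`.
  have harg : ((ρ * u : ℂ)⁻¹).arg = (u⁻¹).arg := by
    rw [mul_inv, ← Complex.ofReal_inv, Complex.arg_real_mul _ (inv_pos.2 hρ)]
  have hre : ‖(ρ * u : ℂ) ^ m‖ / 2 < ((ρ * u : ℂ) ^ m).re := by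
    rw [mul_pow, ← Complex.ofReal_pow, Complex.re_ofReal_mul, norm_mul, Complex.norm_real,
      Real.norm_of_nonneg (by positivity)]
    nlinarith [pow_pos hρ m]
  set x : ℂ := ρ * u with hxdef
  have hx0 : x ≠ 0 := mul_ne_zero hρ0 hu0
  have hpos : 0 < ‖x ^ m‖ := norm_pos_iff.2 (pow_ne_zero _ hx0)
  have hrepos : 0 < (x ^ m).re := by linarith
  have hmain : mittagMain m x = ∑ i ∈ Finset.range m, x ^ i *
      (x ^ m * (1 / x ^ m) ^ ((((i + 1 : ℕ) : ℝ) / m : ℝ) : ℂ) * Complex.exp (x ^ m)) := by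
    have : ∀ i ∈ Finset.range m, x ^ i *
      (x ^ m * (1 / x ^ m) ^ ((((i + 1 : ℕ) : ℝ) / m : ℝ) : ℂ) * Complex.exp (x ^ m))
        = x ^ (m - 1) * Complex.exp (x ^ m) := by
      intro i hi
      have hi' := Finset.mem_range.1 hi
      rw [mul_one_div_pow_cpow hi' hx0 (by rwa [harg]) (by rw [harg]; exact harg2.le),
        ← mul_assoc, ← pow_add]
      congr 2
      omega
    rw [Finset.sum_congr rfl this, Finset.sum_const, Finset.card_range, nsmul_eq_mul, mittagMain,
      mul_assoc]
  rw [mittagRoot_eq_sum hm, hmain, ← Finset.sum_sub_distrib, mul_assoc, Finset.sum_mul]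
  refine (norm_sum_le _ _).trans (Finset.sum_le_sum fun i hi => ?_)
  have hi' := Finset.mem_range.1 hi
  rw [← mul_sub, norm_mul, norm_pow]
  have h1 : ‖x‖ ^ i ≤ 1 + ‖x‖ ^ m := pow_le_one_add_pow (norm_nonneg x) hi'.le
  have h2 := norm_mittagOne_sub_le (β := ((i + 1 : ℕ) : ℝ) / m) (by positivity)
    (by rw [div_le_one hm0]; exact_mod_cast hi') hrepos
  have h3 : ‖x ^ m‖ / (x ^ m).re ≤ 2 := by rw [div_le_iff₀ hrepos]; linarith
  have h4 := one_add_le_mul_exp hη (y := ‖x‖ ^ m) (by positivity)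
  have hG1 : 0 < Real.Gamma (((i + 1 : ℕ) : ℝ) / m) := Real.Gamma_pos_of_pos (by positivity)
  rw [mul_comm]
  refine mul_le_mul (h2.trans ?_) (h1.trans h4) (by positivity) (hD i).le
  simp only [D]
  gcongr

theorem summable_mittagRootReal {m : ℕ} (hm : 1 ≤ m) {x : ℝ} (hx : 0 ≤ x) :
    Summable fun a : ℕ => x ^ a / Real.Gamma ((a + 1) / m) := by
  refine (summable_norm_mittagRoot hm x).congr fun a => ?_
  have h1 : 0 < Real.Gamma (((a : ℝ) + 1) / m) := Real.Gamma_pos_of_pos (by positivity)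
  rw [norm_div, norm_pow, Complex.norm_real, Complex.norm_real, Real.norm_of_nonneg hx,
    Real.norm_of_nonneg h1.le]

theorem mittagRootReal_term_nonneg {m : ℕ} (hm : 1 ≤ m) {x : ℝ} (hx : 0 ≤ x) (a : ℕ) :
    0 ≤ x ^ a / Real.Gamma ((a + 1) / m) := by
  have h1 : 0 < Real.Gamma (((a : ℝ) + 1) / m) := Real.Gamma_pos_of_pos (by positivity)
  positivity

theorem one_div_Gamma_le_mittagRootReal {m : ℕ} (hm : 1 ≤ m) {x : ℝ} (hx : 0 ≤ x) :
    1 / Real.Gamma (1 / m) ≤ mittagRootReal m x := by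
  have := (summable_mittagRootReal hm hx).le_tsum 0 fun a _ => mittagRootReal_term_nonneg hm hx a
  simpa [mittagRootReal] using this

theorem mittagRootReal_pos {m : ℕ} (hm : 1 ≤ m) {x : ℝ} (hx : 0 ≤ x) : 0 < mittagRootReal m x := by
  refine lt_of_lt_of_le ?_ (one_div_Gamma_le_mittagRootReal hm hx)
  have h1 : 0 < Real.Gamma (1 / (m : ℝ)) := Real.Gamma_pos_of_pos (by positivity)
  positivity

/-- Keep only the exponents `k * m + (m - 1)`: their Gamma values are `k!`, and they sum to an
exponential series. -/
theorem pow_mul_exp_le_mittagRootReal {m : ℕ} (hm : 1 ≤ m) {x : ℝ} (hx : 0 ≤ x) :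
    x ^ (m - 1) * Real.exp (x ^ m) ≤ mittagRootReal m x := by
  have hinj : Function.Injective fun k : ℕ => k * m + (m - 1) := by
    intro a b h
    simp only [Nat.add_right_cancel_iff] at h
    exact Nat.eq_of_mul_eq_mul_right (by omega) h
  refine le_trans (le_of_eq ?_) (tsum_comp_le_tsum_of_inj (summable_mittagRootReal hm hx)
    (mittagRootReal_term_nonneg hm hx) hinj)
  rw [Real.exp_eq_exp_ℝ, NormedSpace.exp_eq_tsum_div, ← tsum_mul_left]
  refine tsum_congr fun k => ?_
  have hm0 : (m : ℝ) ≠ 0 := by positivity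
  have : (((k * m + (m - 1) : ℕ) : ℝ) + 1) / m = k + 1 := by
    rw [div_eq_iff hm0]
    have : k * m + (m - 1) + 1 = (k + 1) * m := by rw [add_mul]; omega
    exact_mod_cast this
  simp only [Function.comp_apply]
  rw [this, Real.Gamma_nat_eq_factorial, pow_add, pow_mul']
  ring

/-- For `x ≥ 1` the preceding bound suffices since `x ^ (m - 1) ≥ 1`. For `x ≤ 1` the constant term
is compared with `e`, an upper bound for the exponential there. -/
theorem exists_exp_le_mittagRootReal {m : ℕ} (hm : 1 ≤ m) :
    ∃ c : ℝ, 0 < c ∧ ∀ x : ℝ, 0 ≤ x → c * Real.exp (x ^ m) ≤ mittagRootReal m x := by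
  have h1 : 0 < Real.Gamma (1 / (m : ℝ)) := Real.Gamma_pos_of_pos (by positivity)
  refine ⟨min 1 (1 / Real.Gamma (1 / m) * Real.exp (-1)), by positivity, fun x hx => ?_⟩
  rcases le_total 1 x with h | h
  · refine le_trans ?_ (pow_mul_exp_le_mittagRootReal hm hx)
    gcongr
    exact (min_le_left _ _).trans (one_le_pow₀ h)
  · refine le_trans ?_ (one_div_Gamma_le_mittagRootReal hm hx)
    calc _ ≤ (1 / Real.Gamma (1 / m) * Real.exp (-1)) * Real.exp 1 := by
          gcongr
          · exact min_le_right _ _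
          · exact pow_le_one₀ hx h
      _ = _ := by rw [mul_assoc, ← Real.exp_add]; simp

/-! ### The Bergman space of an open set and its kernel. -/

theorem measurePreserving_mul_of_norm_eq_one {u : ℂ} (hu : ‖u‖ = 1) :
    MeasurePreserving (fun z : ℂ => u * z) := by
  have h := (rotation ⟨u, mem_sphere_zero_iff_norm.2 hu⟩).measurePreserving
  exact h

theorem measurePreserving_pi_mul {n : ℕ} {u : Fin n → ℂ} (hu : ∀ j, ‖u j‖ = 1) :
    MeasurePreserving (fun (z : Fin n → ℂ) j => u j * z j) :=
  volume_preserving_pi fun j => measurePreserving_mul_of_norm_eq_one (hu j)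

theorem measurePreserving_smul_of_norm_eq_one {n : ℕ} {u : ℂ} (hu : ‖u‖ = 1) :
    MeasurePreserving (fun z : Fin n → ℂ => u • z) :=
  measurePreserving_pi_mul (u := fun _ => u) fun _ => hu

/-- This is the one-variable mean value property of `a ↦ f (c + a • w)` on the unit circle. -/
theorem circle_mean_value {n : ℕ} {f : (Fin n → ℂ) → ℂ} {c w : Fin n → ℂ} {ρ : ℝ}
    (hf : DifferentiableOn ℂ f (Metric.ball c ρ)) (hw : w ∈ Metric.ball 0 ρ) :
    ∫ θ : ℝ in Set.Ioc 0 (2 * Real.pi), f (c + Complex.exp (θ * Complex.I) • w)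
      = (2 * Real.pi : ℝ) • f c := by
  have hw' : ‖w‖ < ρ := mem_ball_zero_iff.1 hw
  have hd : DifferentiableOn ℂ (fun a : ℂ => f (c + a • w)) (Metric.closedBall 0 1) := by
    refine hf.comp (by fun_prop) fun a ha => ?_
    rw [mem_ball_iff_norm, add_sub_cancel_left, norm_smul]
    have : ‖a‖ ≤ 1 := by simpa using ha
    nlinarith [norm_nonneg w]
  have h := (hd.diffContOnCl_ball (c := 0) (R := |1|) (by simp)).circleAverage
  rw [Real.circleAverage, intervalIntegral.integral_of_le Real.two_pi_pos.le] at h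
  simp only [zero_smul, add_zero, circleMap, zero_add, Complex.ofReal_one, one_mul] at h
  rw [← h, smul_smul, mul_inv_cancel₀ Real.two_pi_pos.ne', one_smul]

/-- Bound `‖f c‖` by the circle means, integrate over `w` in the ball and exchange the integrals.
Multiplication by a unimodular scalar preserves both the ball and its volume, so each rotation
contributes the same integral. -/
theorem enorm_mul_volume_le_lintegral {n : ℕ} {f : (Fin n → ℂ) → ℂ} {c : Fin n → ℂ} {ρ : ℝ}
    (hf : DifferentiableOn ℂ f (Metric.ball c ρ)) :
    ‖f c‖ₑ * volume (Metric.ball c ρ) ≤ ∫⁻ z in Metric.ball c ρ, ‖f z‖ₑ := by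
  let h : (Fin n → ℂ) → ENNReal := (Metric.ball 0 ρ).indicator fun w => ‖f (c + w)‖ₑ
  have hmeas : Measurable h := by
    classical
    have hcont : ContinuousOn (fun w => ‖f (c + w)‖ₑ) (Metric.ball 0 ρ) := by
      refine (continuous_enorm.comp_continuousOn hf.continuousOn).comp (by fun_prop) fun w hw => ?_
      simpa using hw
    rw [show h = (Metric.ball 0 ρ).piecewise (fun w => ‖f (c + w)‖ₑ) 0 from
      (Set.piecewise_eq_indicator).symm]
    exact hcont.measurable_piecewise continuousOn_const Metric.isOpen_ball.measurableSet
  have hnorm : ∀ θ : ℝ, ‖Complex.exp (θ * Complex.I)‖ = 1 := Complex.norm_exp_ofReal_mul_I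
  have hpt : ∀ w ∈ Metric.ball (0 : Fin n → ℂ) ρ, ENNReal.ofReal (2 * Real.pi) * ‖f c‖ₑ
      ≤ ∫⁻ θ : ℝ in Set.Ioc 0 (2 * Real.pi), h (Complex.exp (θ * Complex.I) • w) := by
    intro w hw
    have h1 := congrArg enorm (circle_mean_value hf hw)
    rw [enorm_smul, Real.enorm_eq_ofReal Real.two_pi_pos.le] at h1
    rw [← h1]
    refine (enorm_integral_le_lintegral_enorm _).trans (le_of_eq (lintegral_congr fun θ => ?_))
    refine (Set.indicator_of_mem (f := fun w => ‖f (c + w)‖ₑ) ?_).symm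
    simpa [norm_smul, hnorm] using hw
  have hshift : ∫⁻ w, h w = ∫⁻ z in Metric.ball c ρ, ‖f z‖ₑ := by
    rw [lintegral_indicator Metric.isOpen_ball.measurableSet]
    have := (measurePreserving_add_left volume c).setLIntegral_comp_preimage_emb
      (measurableEmbedding_addLeft c) (fun z => ‖f z‖ₑ) (Metric.ball c ρ)
    rw [← this]
    congr 2
    ext w
    simp
  have hvol : volume (Metric.ball c ρ) = volume (Metric.ball (0 : Fin n → ℂ) ρ) :=
    Measure.addHaar_ball_center _ _ _
  have hpi0 : ENNReal.ofReal (2 * Real.pi) ≠ 0 := by simp [Real.pi_pos]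
  rw [← ENNReal.mul_le_mul_iff_right hpi0 ENNReal.ofReal_ne_top, ← mul_assoc, hvol,
    ← setLIntegral_const]
  calc _ ≤ ∫⁻ w in Metric.ball (0 : Fin n → ℂ) ρ, ∫⁻ θ : ℝ in Set.Ioc 0 (2 * Real.pi),
        h (Complex.exp (θ * Complex.I) • w) := setLIntegral_mono' Metric.isOpen_ball.measurableSet hpt
    _ ≤ ∫⁻ w, ∫⁻ θ : ℝ in Set.Ioc 0 (2 * Real.pi), h (Complex.exp (θ * Complex.I) • w) :=
        setLIntegral_le_lintegral _ _
    _ = ∫⁻ θ : ℝ in Set.Ioc 0 (2 * Real.pi), ∫⁻ w, h (Complex.exp (θ * Complex.I) • w) := by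
        refine lintegral_lintegral_swap (Measurable.aemeasurable ?_)
        refine hmeas.comp ?_
        fun_prop
    _ = ∫⁻ θ : ℝ in Set.Ioc 0 (2 * Real.pi), ∫⁻ w, h w :=
        lintegral_congr fun θ =>
          (measurePreserving_smul_of_norm_eq_one (hnorm θ)).lintegral_comp hmeas
    _ = _ := by
        rw [setLIntegral_const, Real.volume_Ioc, sub_zero, mul_comm, hshift]

/-- The sub-mean-value inequality combined with Cauchy–Schwarz. The constant depends only on the
radius, so point evaluations are bounded locally uniformly. -/
theorem exists_norm_le_mul_norm (n : ℕ) {ρ : ℝ} (hρ : 0 < ρ) :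
    ∃ C : ℝ, 0 ≤ C ∧ ∀ (Ω : Set (Fin n → ℂ)) (c : Fin n → ℂ), Metric.ball c ρ ⊆ Ω →
      ∀ (F : Lp ℂ 2 (volume.restrict Ω)) (f : (Fin n → ℂ) → ℂ), DifferentiableOn ℂ f Ω →
        F =ᵐ[volume.restrict Ω] f → ‖f c‖ ≤ C * ‖F‖ := by
  set V := volume (Metric.ball (0 : Fin n → ℂ) ρ) with hV
  have hV0 : V ≠ 0 := (Metric.isOpen_ball.measure_pos _ ⟨0, by simpa using hρ⟩).ne'
  have hVt : V ≠ ⊤ := measure_ball_lt_top.ne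
  refine ⟨(V ^ (1 / 2 : ℝ) / V).toReal, ENNReal.toReal_nonneg, fun Ω c hc F f hf hFf => ?_⟩
  have h1 := enorm_mul_volume_le_lintegral (hf.mono hc)
  rw [Measure.addHaar_ball_center, ← hV] at h1
  have hsub : volume.restrict (Metric.ball c ρ) ≤ volume.restrict Ω :=
    Measure.restrict_mono hc le_rfl
  have h2 : ∫⁻ z in Metric.ball c ρ, ‖f z‖ₑ ≤ eLpNorm F 2 (volume.restrict Ω) * V ^ (1 / 2 : ℝ) := by
    rw [← eLpNorm_one_eq_lintegral_enorm]
    have hm : AEStronglyMeasurable f (volume.restrict (Metric.ball c ρ)) :=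
      (hf.continuousOn.mono hc).aestronglyMeasurable Metric.isOpen_ball.measurableSet
    refine (eLpNorm_le_eLpNorm_mul_rpow_measure_univ (q := 2) (by norm_num) hm).trans ?_
    rw [Measure.restrict_apply_univ, Measure.addHaar_ball_center, ← hV]
    refine mul_le_mul' ?_ (le_of_eq ?_)
    · rw [eLpNorm_congr_ae hFf]
      exact eLpNorm_mono_measure _ hsub
    · congr 1; norm_num
  have h3 : ‖f c‖ₑ ≤ V ^ (1 / 2 : ℝ) / V * eLpNorm F 2 (volume.restrict Ω) := by
    rw [← ENNReal.mul_le_mul_iff_left hV0 hVt]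
    refine (h1.trans h2).trans (le_of_eq ?_)
    rw [mul_right_comm, ENNReal.div_mul_cancel hV0 hVt, mul_comm]
  have hfin : V ^ (1 / 2 : ℝ) / V ≠ ⊤ :=
    ENNReal.div_ne_top (ENNReal.rpow_ne_top_of_nonneg (by norm_num) hVt) hV0
  rw [Lp.norm_def, ← ENNReal.toReal_mul, ← toReal_enorm]
  exact ENNReal.toReal_mono (ENNReal.mul_ne_top hfin (Lp.eLpNorm_ne_top F)) h3

section Bergman

variable {n : ℕ} {Ω : Set (Fin n → ℂ)}

theorem differentiableOn_holomorphicRep (f : bergmanSpace Ω) :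
    DifferentiableOn ℂ (holomorphicRep f) Ω := f.2.choose_spec.1

theorem ae_eq_holomorphicRep (f : bergmanSpace Ω) :
    (f : Lp ℂ 2 (volume.restrict Ω)) =ᵐ[volume.restrict Ω] holomorphicRep f := f.2.choose_spec.2

theorem eqOn_holomorphicRep (hΩ : IsOpen Ω) (f : bergmanSpace Ω) {g : (Fin n → ℂ) → ℂ}
    (hg : DifferentiableOn ℂ g Ω)
    (h : (f : Lp ℂ 2 (volume.restrict Ω)) =ᵐ[volume.restrict Ω] g) :
    Set.EqOn (holomorphicRep f) g Ω :=
  Measure.eqOn_open_of_ae_eq ((ae_eq_holomorphicRep f).symm.trans h) hΩ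
    (differentiableOn_holomorphicRep f).continuousOn hg.continuousOn

theorem tendstoLocallyUniformlyOn_holomorphicRep (hΩ : IsOpen Ω) {F : ℕ → bergmanSpace Ω}
    (hF : CauchySeq F) : ∃ G : (Fin n → ℂ) → ℂ,
      TendstoLocallyUniformlyOn (fun k => holomorphicRep (F k)) G atTop Ω := by
  have hbd : ∀ z ∈ Ω, ∃ t ∈ 𝓝[Ω] z, UniformCauchySeqOn (fun k => holomorphicRep (F k)) atTop t := by
    intro z hz
    obtain ⟨R, hR, hball⟩ := Metric.isOpen_iff.1 hΩ z hz
    obtain ⟨C, hC0, hC⟩ := exists_norm_le_mul_norm n (half_pos hR)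
    refine ⟨Metric.ball z (R / 2), mem_nhdsWithin_of_mem_nhds (Metric.ball_mem_nhds _ (half_pos hR)),
      ?_⟩
    rw [Metric.uniformCauchySeqOn_iff]
    intro ε hε
    obtain ⟨N, hN⟩ := Metric.cauchySeq_iff.1 hF (ε / (C + 1)) (by positivity)
    refine ⟨N, fun k hk l hl w hw => ?_⟩
    have hw' : Metric.ball w (R / 2) ⊆ Ω := by
      refine subset_trans (Metric.ball_subset_ball' ?_) hball
      have := Metric.mem_ball.1 hw
      linarith
    have h1 := hC Ω w hw' ((F k - F l : bergmanSpace Ω) : Lp ℂ 2 (volume.restrict Ω))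
      (holomorphicRep (F k) - holomorphicRep (F l))
      ((differentiableOn_holomorphicRep _).sub (differentiableOn_holomorphicRep _))
      ((Lp.coeFn_sub _ _).trans ((ae_eq_holomorphicRep _).sub (ae_eq_holomorphicRep _)))
    have h2 : ‖F k - F l‖ < ε / (C + 1) := by rw [← dist_eq_norm]; exact hN k hk l hl
    rw [dist_eq_norm]
    refine lt_of_le_of_lt h1 ?_
    change C * ‖F k - F l‖ < ε
    rw [lt_div_iff₀ (by positivity)] at h2
    nlinarith [norm_nonneg (F k - F l)]
  have hlim : ∀ z, ∃ a, z ∈ Ω → Tendsto (fun k => holomorphicRep (F k) z) atTop (𝓝 a) := by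
    intro z
    by_cases hz : z ∈ Ω
    · obtain ⟨t, ht, hu⟩ := hbd z hz
      obtain ⟨a, ha⟩ := cauchySeq_tendsto_of_complete (hu.cauchySeq (mem_of_mem_nhdsWithin hz ht))
      exact ⟨a, fun _ => ha⟩
    · exact ⟨0, fun h => absurd h hz⟩
  choose G hG using hlim
  refine ⟨G, tendstoLocallyUniformlyOn_of_forall_exists_nhds fun z hz => ?_⟩
  obtain ⟨t, ht, hu⟩ := hbd z hz
  refine ⟨t ∩ Ω, inter_mem ht self_mem_nhdsWithin, ?_⟩
  exact (hu.mono Set.inter_subset_left).tendstoUniformlyOn_of_tendsto fun w hw => hG w hw.2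

theorem differentiableOn_of_tendstoLocallyUniformlyOn (hΩ : IsOpen Ω)
    {g : ℕ → (Fin n → ℂ) → ℂ} {G : (Fin n → ℂ) → ℂ} (hg : ∀ k, DifferentiableOn ℂ (g k) Ω)
    (h : TendstoLocallyUniformlyOn g G atTop Ω) : DifferentiableOn ℂ G Ω := by
  refine (analyticOnNhd_of_separately hΩ
    (h.continuousOn (Frequently.of_forall fun k => (hg k).continuousOn)) ?_).differentiableOn
  intro z hz j
  have hcont : Continuous fun b : ℂ => Function.update z j b :=
    continuous_const.update j continuous_id
  have hV : IsOpen {b : ℂ | Function.update z j b ∈ Ω} := hΩ.preimage hcont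
  have hzV : z j ∈ {b : ℂ | Function.update z j b ∈ Ω} := by simpa using hz
  refine ((h.comp (fun b => Function.update z j b) (fun b hb => hb)
    hcont.continuousOn).differentiableOn (Eventually.of_forall fun k => ?_)
    hV).differentiableAt (hV.mem_nhds hzV)
  refine (hg k).comp ?_ fun b hb => hb
  exact fun b _ => (hasFDerivAt_update z b).differentiableAt.differentiableWithinAt

/-- An `L²`-convergent sequence converges locally uniformly to a holomorphic function; an almost
everywhere convergent subsequence identifies it with the `L²` limit. -/
theorem isClosed_bergmanSpace (hΩ : IsOpen Ω) :
    IsClosed (bergmanSpace Ω : Set (Lp ℂ 2 (volume.restrict Ω))) := by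
  refine isClosed_of_closure_subset fun f hf => ?_
  obtain ⟨x, hx, hlim⟩ := mem_closure_iff_seq_limit.1 hf
  let F : ℕ → bergmanSpace Ω := fun k => ⟨x k, hx k⟩
  have hF : CauchySeq F := by
    have h1 := Metric.cauchySeq_iff.1 hlim.cauchySeq
    exact Metric.cauchySeq_iff.2 h1
  obtain ⟨G, hG⟩ := tendstoLocallyUniformlyOn_holomorphicRep hΩ hF
  refine ⟨G, differentiableOn_of_tendstoLocallyUniformlyOn hΩ
    (fun k => differentiableOn_holomorphicRep _) hG, ?_⟩
  obtain ⟨ns, hns, hae⟩ := (tendstoInMeasure_of_tendsto_Lp hlim).exists_seq_tendsto_ae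
  have hall : ∀ᵐ z ∂volume.restrict Ω, ∀ k, x k z = holomorphicRep (F k) z :=
    ae_all_iff.2 fun k => ae_eq_holomorphicRep (F k)
  filter_upwards [hae, hall, ae_restrict_mem hΩ.measurableSet] with z hz hz' hzΩ
  refine tendsto_nhds_unique hz ?_
  simp only [hz']
  exact ((hG.tendsto_at hzΩ).comp hns.tendsto_atTop :)

/-- Evaluation at a point of an open set, as a functional on the Bergman space. -/
noncomputable def bergmanEval (hΩ : IsOpen Ω) (z : Ω) : bergmanSpace Ω →L[ℂ] ℂ :=
  LinearMap.mkContinuousOfExistsBound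
    { toFun := fun f => holomorphicRep f z
      map_add' := fun f g => eqOn_holomorphicRep hΩ (f + g)
        ((differentiableOn_holomorphicRep f).add (differentiableOn_holomorphicRep g))
        ((Lp.coeFn_add _ _).trans ((ae_eq_holomorphicRep f).add (ae_eq_holomorphicRep g))) z.2
      map_smul' := fun c f => eqOn_holomorphicRep hΩ (c • f)
        ((differentiableOn_holomorphicRep f).const_smul c)
        ((Lp.coeFn_smul _ _).trans ((ae_eq_holomorphicRep f).const_smul c)) z.2 } (by
    obtain ⟨R, hR, hball⟩ := Metric.isOpen_iff.1 hΩ z z.2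
    obtain ⟨C, -, hC⟩ := exists_norm_le_mul_norm n hR
    exact ⟨C, fun f => hC Ω z hball f _ (differentiableOn_holomorphicRep f)
      (ae_eq_holomorphicRep f)⟩)

/-- Let `k` be the Riesz representative of evaluation at `z`. By Parseval the sum is `‖k‖ ^ 2` for
every basis, which gives convergence and independence at once. -/
theorem exists_hasSum_norm_holomorphicRep_sq (hΩ : IsOpen Ω) {z : Fin n → ℂ} (hz : z ∈ Ω) :
    ∃ K : ℝ, ∀ (ι : Type) (φ : HilbertBasis ι ℂ (bergmanSpace Ω)),
      HasSum (fun i => ‖holomorphicRep (φ i) z‖ ^ 2) K := by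
  have : CompleteSpace (bergmanSpace Ω) := (isClosed_bergmanSpace hΩ).completeSpace_coe
  let k := (InnerProductSpace.toDual ℂ (bergmanSpace Ω)).symm (bergmanEval hΩ ⟨z, hz⟩)
  have hk : ∀ f : bergmanSpace Ω, inner ℂ k f = holomorphicRep f z := fun f =>
    InnerProductSpace.toDual_symm_apply
  refine ⟨‖k‖ ^ 2, fun ι φ => ?_⟩
  have h := Complex.hasSum_re (φ.hasSum_inner_mul_inner k k)
  have h1 : (inner ℂ k k : ℂ).re = ‖k‖ ^ 2 := by
    exact inner_self_eq_norm_sq (𝕜 := ℂ) k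
  rw [h1] at h
  refine h.congr_fun fun i => ?_
  rw [← inner_conj_symm (φ i) k, hk, Complex.mul_conj, Complex.ofReal_re, Complex.normSq_eq_norm_sq]

theorem exists_hilbertBasis_bergmanSpace (hΩ : IsOpen Ω) :
    ∃ ι : Type, Nonempty (HilbertBasis ι ℂ (bergmanSpace Ω)) := by
  have : CompleteSpace (bergmanSpace Ω) := (isClosed_bergmanSpace hΩ).completeSpace_coe
  obtain ⟨w, b, -⟩ := exists_hilbertBasis ℂ (bergmanSpace Ω)
  exact ⟨w, ⟨b⟩⟩

theorem exists_isBergmanKernel (hΩ : IsOpen Ω) : ∃ K, IsBergmanKernel Ω K := by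
  choose! K hK using fun z (hz : z ∈ Ω) => exists_hasSum_norm_holomorphicRep_sq hΩ hz
  exact ⟨K, exists_hilbertBasis_bergmanSpace hΩ, fun ι φ z hz => hK z hz ι φ⟩

end Bergman

/-! ### Monomials as an orthogonal basis on complete Reinhardt domains. -/

theorem analyticOnNhd_of_differentiableOn_pi {n : ℕ} {f : (Fin n → ℂ) → ℂ} {U : Set (Fin n → ℂ)}
    (hU : IsOpen U) (hf : DifferentiableOn ℂ f U) : AnalyticOnNhd ℂ f U := by
  refine analyticOnNhd_of_separately hU hf.continuousOn fun z hz j => ?_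
  have h1 : DifferentiableAt ℂ f (Function.update z j (z j)) := by
    rw [Function.update_eq_self]; exact hf.differentiableAt (hU.mem_nhds hz)
  exact h1.comp (z j) (hasFDerivAt_update z (z j)).differentiableAt

/-- Complete Reinhardt domains contained in the unit polydisc. -/
structure IsUnitReinhardt {n : ℕ} (Ω : Set (Fin n → ℂ)) : Prop where
  isOpen : IsOpen Ω
  zero_mem : 0 ∈ Ω
  norm_le : ∀ z ∈ Ω, ‖z‖ ≤ 1
  mul_mem : ∀ z ∈ Ω, ∀ u : Fin n → ℂ, (∀ j, ‖u j‖ ≤ 1) → (fun j => u j * z j) ∈ Ω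

section Reinhardt

variable {n : ℕ} {Ω : Set (Fin n → ℂ)}

theorem IsUnitReinhardt.smul_mem (h : IsUnitReinhardt Ω) {z : Fin n → ℂ} (hz : z ∈ Ω) {u : ℂ}
    (hu : ‖u‖ ≤ 1) : u • z ∈ Ω := h.mul_mem z hz (fun _ => u) fun _ => hu

theorem IsUnitReinhardt.isPreconnected (h : IsUnitReinhardt Ω) : IsPreconnected Ω := by
  have : StarConvex ℝ 0 Ω := by
    rw [starConvex_zero_iff]
    intro z hz a ha0 ha1
    have := h.smul_mem hz (u := (a : ℂ)) (by simpa [abs_of_nonneg ha0] using ha1)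
    rwa [Complex.coe_smul] at this
  exact (this.isPathConnected h.zero_mem).isConnected.isPreconnected

theorem IsUnitReinhardt.volume_ne_top (h : IsUnitReinhardt Ω) : volume Ω ≠ ⊤ := by
  refine ((measure_mono fun z hz => ?_).trans_lt
    (measure_closedBall_lt_top (x := (0 : Fin n → ℂ)) (r := 1))).ne
  simpa using h.norm_le z hz

theorem IsUnitReinhardt.isFiniteMeasure (h : IsUnitReinhardt Ω) :
    IsFiniteMeasure (volume.restrict Ω) :=
  isFiniteMeasure_restrict.2 h.volume_ne_top

theorem IsUnitReinhardt.mul_mem_iff (h : IsUnitReinhardt Ω) {u : Fin n → ℂ} (hu : ∀ j, ‖u j‖ = 1)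
    (z : Fin n → ℂ) : (fun j => u j * z j) ∈ Ω ↔ z ∈ Ω := by
  refine ⟨fun hz => ?_, fun hz => h.mul_mem z hz u fun j => (hu j).le⟩
  have := h.mul_mem _ hz (fun j => (u j)⁻¹) fun j => by simp [hu]
  convert this using 1
  ext j
  have : u j ≠ 0 := norm_pos_iff.1 (by rw [hu]; exact one_pos)
  field_simp

theorem measurableEmbedding_pi_mul {u : Fin n → ℂ} (hu : ∀ j, u j ≠ 0) :
    MeasurableEmbedding (fun (z : Fin n → ℂ) j => u j * z j) := by
  refine (Homeomorph.measurableEmbedding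
    { toFun := fun (z : Fin n → ℂ) j => u j * z j
      invFun := fun z j => (u j)⁻¹ * z j
      left_inv := fun z => by ext j; simp [hu]
      right_inv := fun z => by ext j; simp [hu]
      continuous_toFun := by fun_prop
      continuous_invFun := by fun_prop })

theorem IsUnitReinhardt.setIntegral_mul (h : IsUnitReinhardt Ω) {u : Fin n → ℂ}
    (hu : ∀ j, ‖u j‖ = 1) {F : Type*} [NormedAddCommGroup F] [NormedSpace ℝ F]
    (f : (Fin n → ℂ) → F) : ∫ z in Ω, f (fun j => u j * z j) = ∫ z in Ω, f z := by
  have hu0 : ∀ j, u j ≠ 0 := fun j => norm_pos_iff.1 (by rw [hu]; exact one_pos)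
  have hpre : (fun (z : Fin n → ℂ) j => u j * z j) ⁻¹' Ω = Ω := Set.ext (h.mul_mem_iff hu)
  have := (measurePreserving_pi_mul hu).setIntegral_preimage_emb (measurableEmbedding_pi_mul hu0) f Ω
  rwa [hpre] at this

theorem IsUnitReinhardt.integrableOn_comp_mul (h : IsUnitReinhardt Ω) {u : Fin n → ℂ}
    (hu : ∀ j, ‖u j‖ = 1) {F : Type*} [NormedAddCommGroup F] {f : (Fin n → ℂ) → F}
    (hf : IntegrableOn f Ω) : IntegrableOn (fun z => f (fun j => u j * z j)) Ω := by
  have hu0 : ∀ j, u j ≠ 0 := fun j => norm_pos_iff.1 (by rw [hu]; exact one_pos)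
  have := ((measurePreserving_pi_mul hu).integrableOn_comp_preimage
    (measurableEmbedding_pi_mul hu0) (f := f) (s := Ω)).2 hf
  have hpre : (fun (z : Fin n → ℂ) j => u j * z j) ⁻¹' Ω = Ω := Set.ext (h.mul_mem_iff hu)
  rwa [hpre] at this

theorem IsUnitReinhardt.memLp_of_continuous (h : IsUnitReinhardt Ω) {f : (Fin n → ℂ) → ℂ}
    (hf : Continuous f) : MemLp f 2 (volume.restrict Ω) := by
  have := h.isFiniteMeasure
  obtain ⟨C, hC⟩ := (isCompact_closedBall (0 : Fin n → ℂ) 1).exists_bound_of_continuousOn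
    hf.continuousOn
  refine MemLp.of_bound hf.aestronglyMeasurable C ?_
  filter_upwards [ae_restrict_mem h.isOpen.measurableSet] with z hz
  exact hC z (by simpa using h.norm_le z hz)

theorem IsUnitReinhardt.memLp_monomial (h : IsUnitReinhardt Ω) (α : Fin n → ℕ) :
    MemLp (fun z : Fin n → ℂ => ∏ j, z j ^ α j) 2 (volume.restrict Ω) :=
  h.memLp_of_continuous (by fun_prop)

/-- Monomials as elements of the Bergman space. -/
noncomputable def bergmanMonomial (h : IsUnitReinhardt Ω) (α : Fin n → ℕ) : bergmanSpace Ω :=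
  ⟨(h.memLp_monomial α).toLp, fun z => ∏ j, z j ^ α j,
    Differentiable.differentiableOn (by fun_prop), (h.memLp_monomial α).coeFn_toLp⟩

theorem bergmanMonomial_ae_eq (h : IsUnitReinhardt Ω) (α : Fin n → ℕ) :
    ((bergmanMonomial h α : bergmanSpace Ω) : Lp ℂ 2 (volume.restrict Ω))
      =ᵐ[volume.restrict Ω] fun z => ∏ j, z j ^ α j :=
  (h.memLp_monomial α).coeFn_toLp

theorem inner_bergmanMonomial_left (h : IsUnitReinhardt Ω) (α : Fin n → ℕ) (f : bergmanSpace Ω) :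
    inner ℂ (bergmanMonomial h α) f
      = ∫ z in Ω, (starRingEnd ℂ) (∏ j, z j ^ α j) * holomorphicRep f z := by
  change inner ℂ ((bergmanMonomial h α : bergmanSpace Ω) : Lp ℂ 2 (volume.restrict Ω))
    (f : Lp ℂ 2 (volume.restrict Ω)) = _
  rw [L2.inner_def]
  refine integral_congr_ae ?_
  filter_upwards [bergmanMonomial_ae_eq h α, ae_eq_holomorphicRep f] with z h1 h2
  rw [h1, h2, RCLike.inner_apply, mul_comm]

/-- The number $u=e^{i}$ serves for all exponents, since $e^{i(b-a)}=1$ with $a\ne b$ would make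
$\pi$ rational. -/
theorem exists_norm_one_pow_ne {a b : ℕ} (hab : a ≠ b) :
    ∃ u : ℂ, ‖u‖ = 1 ∧ (starRingEnd ℂ) u ^ a * u ^ b ≠ 1 := by
  refine ⟨Complex.exp ((1 : ℝ) * Complex.I), Complex.norm_exp_ofReal_mul_I 1, ?_⟩
  rw [← Complex.exp_conj, ← Complex.exp_nat_mul, ← Complex.exp_nat_mul, ← Complex.exp_add]
  intro h
  rw [Complex.exp_eq_one_iff] at h
  obtain ⟨k, hk⟩ := h
  simp only [Complex.ofReal_one, one_mul, Complex.conj_I] at hk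
  have h1 : (b : ℂ) - a = k * (2 * Real.pi) := by
    have : Complex.I * ((b : ℂ) - a) = Complex.I * (k * (2 * Real.pi)) := by
      linear_combination hk
    exact mul_left_cancel₀ Complex.I_ne_zero this
  have h2 : ((b : ℤ) - a : ℝ) = k * (2 * Real.pi) := by exact_mod_cast h1
  by_cases hk0 : k = 0
  · subst hk0
    simp only [Int.cast_zero, zero_mul] at h2
    exact hab (by exact_mod_cast (sub_eq_zero.1 h2).symm)
  · refine irrational_pi ⟨((b : ℤ) - a : ℤ) / (2 * k : ℤ), ?_⟩
    have : (k : ℝ) ≠ 0 := by exact_mod_cast hk0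
    push_cast at h2 ⊢
    rw [h2]
    field_simp

theorem inner_bergmanMonomial_of_ne (h : IsUnitReinhardt Ω) {α β : Fin n → ℕ} (hαβ : α ≠ β) :
    inner ℂ (bergmanMonomial h α) (bergmanMonomial h β) = (0 : ℂ) := by
  obtain ⟨i, hi⟩ := Function.ne_iff.1 hαβ
  obtain ⟨u, hu, hne⟩ := exists_norm_one_pow_ne hi
  rw [inner_bergmanMonomial_left]
  have hrep : ∫ z in Ω, (starRingEnd ℂ) (∏ j, z j ^ α j) * holomorphicRep (bergmanMonomial h β) z
      = ∫ z in Ω, (starRingEnd ℂ) (∏ j, z j ^ α j) * ∏ j, z j ^ β j := by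
    refine setIntegral_congr_fun h.isOpen.measurableSet fun z hz => ?_
    rw [eqOn_holomorphicRep h.isOpen (bergmanMonomial h β)
      (Differentiable.differentiableOn (by fun_prop)) (bergmanMonomial_ae_eq h β) hz]
  rw [hrep]
  -- Rotating only the coordinate in which the exponents differ multiplies the integral by a factor
  -- other than `1`, yet leaves it unchanged.
  have hrot := h.setIntegral_mul (u := Function.update 1 i u) (fun j => by
    by_cases hj : j = i
    · subst hj; simpa using hu
    · simp [hj]) (fun z => (starRingEnd ℂ) (∏ j, z j ^ α j) * ∏ j, z j ^ β j)
  have hpull : ∀ γ : Fin n → ℕ, ∀ z : Fin n → ℂ,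
      ∏ j, (Function.update (1 : Fin n → ℂ) i u j * z j) ^ γ j = u ^ γ i * ∏ j, z j ^ γ j := by
    intro γ z
    simp only [mul_pow, Finset.prod_mul_distrib]
    congr 1
    rw [Finset.prod_eq_single i]
    · simp
    · intro j _ hj; simp [hj]
    · simp
  simp only [hpull, map_mul, map_pow] at hrot
  have hrot2 : ((starRingEnd ℂ) u ^ α i * u ^ β i) *
      ∫ z in Ω, (starRingEnd ℂ) (∏ j, z j ^ α j) * ∏ j, z j ^ β j
      = ∫ z in Ω, (starRingEnd ℂ) (∏ j, z j ^ α j) * ∏ j, z j ^ β j := by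
    rw [← integral_const_mul, ← hrot]
    refine integral_congr_ae (ae_of_all _ fun z => ?_)
    ring
  by_contra h0
  exact hne (mul_right_cancel₀ h0 (by rw [hrot2, one_mul]))

/-- Cauchy's coefficient formula for the slice `a ↦ g (a • w)`, holomorphic near each point of the
closed unit disc. It holds for every `w ∈ Ω`, although `p` need only converge near `0`. -/
theorem circle_coeff (h : IsUnitReinhardt Ω) {g : (Fin n → ℂ) → ℂ} (hg : DifferentiableOn ℂ g Ω)
    {p : FormalMultilinearSeries ℂ (Fin n → ℂ) ℂ} (hp : HasFPowerSeriesAt g p 0) (k : ℕ)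
    {w : Fin n → ℂ} (hw : w ∈ Ω) :
    ∫ θ : ℝ in Set.Ioc 0 (2 * Real.pi), Complex.exp (-(k * θ * Complex.I))
        * g (Complex.exp (θ * Complex.I) • w) = 2 * Real.pi * p k (fun _ => w) := by
  let u : ℂ →L[ℂ] (Fin n → ℂ) := ContinuousLinearMap.toSpanSingleton ℂ w
  have hu : ∀ a, u a = a • w := fun a => rfl
  have h1 : HasFPowerSeriesAt (g ∘ u) (p.compContinuousLinearMap u) 0 :=
    HasFPowerSeriesAt.compContinuousLinearMap (by rwa [map_zero])
  have hd : DifferentiableOn ℂ (g ∘ u) (Metric.closedBall 0 1) := by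
    refine hg.comp u.differentiable.differentiableOn fun a ha => ?_
    exact h.smul_mem hw (by simpa using ha)
  have h2 := (DiffContOnCl.hasFPowerSeriesOnBall (R := 1) (c := 0) (f := g ∘ u)
    (by simpa using hd.diffContOnCl_ball (c := 0) (R := 1) subset_rfl)
    one_pos).hasFPowerSeriesAt
  have h3 := congrArg (fun q : FormalMultilinearSeries ℂ ℂ ℂ => q k fun _ => 1)
    (h2.eq_formalMultilinearSeries h1)
  simp only [cauchyPowerSeries_apply] at h3
  have h4 : (p.compContinuousLinearMap u k fun _ => (1 : ℂ)) = p k fun _ => w := by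
    rw [FormalMultilinearSeries.compContinuousLinearMap_apply]
    congr 1
    ext i
    simp [hu]
  rw [h4, circleIntegral, intervalIntegral.integral_of_le Real.two_pi_pos.le] at h3
  rw [← h3, smul_eq_mul]
  have hpi : (Real.pi : ℂ) ≠ 0 := Complex.ofReal_ne_zero.2 Real.pi_ne_zero
  have hI := Complex.I_ne_zero
  have h5 : ∀ A : ℂ, 2 * (Real.pi : ℂ) * ((2 * Real.pi * Complex.I)⁻¹ * A) = Complex.I⁻¹ * A := by
    intro A; field_simp
  rw [h5, ← integral_const_mul]
  refine integral_congr_ae (ae_of_all _ fun θ => ?_)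
  have hexp : Complex.exp (-(k * θ * Complex.I)) = (Complex.exp (θ * Complex.I))⁻¹ ^ k := by
    rw [← Complex.exp_neg, ← Complex.exp_nat_mul]; ring_nf
  have hne := Complex.exp_ne_zero (θ * Complex.I)
  simp only [deriv_circleMap, circleMap, NNReal.coe_one, Complex.ofReal_one, one_mul, zero_add,
    sub_zero, Function.comp, hu, smul_eq_mul, hexp, one_div]
  field_simp

/-- Expanding multilinearly in the standard basis shows that a homogeneous Taylor term is a
combination of monomials. -/
theorem homogeneous_apply_eq_sum {k : ℕ} (q : ContinuousMultilinearMap ℂ (fun _ : Fin k => Fin n → ℂ) ℂ)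
    (w : Fin n → ℂ) : q (fun _ => w)
      = ∑ s : Fin k → Fin n, q (fun i => Pi.single (s i) 1)
        * ∏ j, w j ^ (Finset.univ.filter fun i => s i = j).card := by
  have hw : (fun _ : Fin k => w) = fun _ => ∑ j, w j • (Pi.single j 1 : Fin n → ℂ) := by
    ext i l
    simp [Finset.sum_apply, Pi.single_apply]
  rw [hw, ContinuousMultilinearMap.map_sum]
  refine Finset.sum_congr rfl fun s _ => ?_
  rw [ContinuousMultilinearMap.map_smul_univ, smul_eq_mul, mul_comm]
  congr 1
  rw [Finset.prod_comp w s]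
  refine Finset.prod_subset (Finset.subset_univ _) fun j _ hj => ?_
  rw [Finset.card_eq_zero.2, pow_zero]
  rw [Finset.filter_eq_empty_iff]
  rintro i - rfl
  exact hj (Finset.mem_image_of_mem _ (Finset.mem_univ i))

theorem integrableOn_holomorphicRep (h : IsUnitReinhardt Ω) (f : bergmanSpace Ω) :
    IntegrableOn (holomorphicRep f) Ω := by
  have := h.isFiniteMeasure
  exact ((Lp.memLp (f : Lp ℂ 2 (volume.restrict Ω))).integrable (by norm_num)).congr
    (ae_eq_holomorphicRep f)

theorem integrableOn_continuous_mul (h : IsUnitReinhardt Ω) {P g : (Fin n → ℂ) → ℂ}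
    (hP : Continuous P) (hg : IntegrableOn g Ω) : IntegrableOn (fun z => P z * g z) Ω := by
  obtain ⟨C, hC⟩ := (isCompact_closedBall (0 : Fin n → ℂ) 1).exists_bound_of_continuousOn
    hP.continuousOn
  refine hg.bdd_mul (c := C) hP.aestronglyMeasurable ?_
  filter_upwards [ae_restrict_mem h.isOpen.measurableSet] with z hz
  exact hC z (by simpa using h.norm_le z hz)

/-- Let `q` be the degree `k` part of the Taylor series. Orthogonality to monomials gives $\int\bar
q\,g=0$, and the same for every rotation of the variable. Averaging over the rotations extracts the
degree `k` part of `g` by `circle_coeff`, leaving $2\pi\int|q|^2=0$. No convergence of the Taylor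
series on all of `Ω` is needed. -/
theorem homogeneous_eq_zero (h : IsUnitReinhardt Ω) (f : bergmanSpace Ω)
    (hf : ∀ α, inner ℂ (bergmanMonomial h α) f = (0 : ℂ))
    {p : FormalMultilinearSeries ℂ (Fin n → ℂ) ℂ} (hp : HasFPowerSeriesAt (holomorphicRep f) p 0)
    (k : ℕ) {w : Fin n → ℂ} (hw : w ∈ Ω) : p k (fun _ => w) = 0 := by
  set g := holomorphicRep f with hgdef
  have hg := differentiableOn_holomorphicRep f
  have hgi := integrableOn_holomorphicRep h f
  have hfin := h.isFiniteMeasure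
  let q : (Fin n → ℂ) → ℂ := fun w => p k fun _ => w
  have hq : Continuous q := (p k).cont.comp (continuous_pi fun _ => continuous_id)
  have hqc : Continuous fun w => (starRingEnd ℂ) (q w) := Complex.continuous_conj.comp hq
  have hzero : ∫ w in Ω, (starRingEnd ℂ) (q w) * g w = 0 := by
    have : ∀ w, (starRingEnd ℂ) (q w) * g w = ∑ s : Fin k → Fin n,
        (starRingEnd ℂ) (p k (fun i => Pi.single (s i) 1)) *
        ((starRingEnd ℂ) (∏ j, w j ^ (Finset.univ.filter fun i => s i = j).card) * g w) := by
      intro w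
      simp only [q]
      rw [homogeneous_apply_eq_sum, map_sum, Finset.sum_mul]
      refine Finset.sum_congr rfl fun s _ => ?_
      rw [map_mul, mul_assoc]
    simp only [this]
    rw [integral_finsetSum]
    · refine Finset.sum_eq_zero fun s _ => ?_
      rw [integral_const_mul, ← inner_bergmanMonomial_left h, hf, mul_zero]
    · intro s _
      refine (integrableOn_continuous_mul h ?_ hgi).const_mul _
      exact Complex.continuous_conj.comp (by fun_prop)
  have hnorm : ∀ θ : ℝ, ‖Complex.exp (θ * Complex.I)‖ = 1 := Complex.norm_exp_ofReal_mul_I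
  -- By homogeneity of `q`, the factor $e^{-ik\theta}$ makes `H θ` the pullback of `conj q * g`
  -- under rotation by `θ`.
  let H : ℝ → (Fin n → ℂ) → ℂ := fun θ w => (starRingEnd ℂ) (q w) *
    (Complex.exp (-(k * θ * Complex.I)) * g (Complex.exp (θ * Complex.I) • w))
  have hHrot : ∀ θ w, H θ w = (fun v => (starRingEnd ℂ) (q v) * g v)
      (fun j => Complex.exp (θ * Complex.I) * w j) := by
    intro θ w
    have h1 : (fun j => Complex.exp (θ * Complex.I) * w j) = Complex.exp (θ * Complex.I) • w := rfl
    have h2 : q (Complex.exp (θ * Complex.I) • w) = Complex.exp (θ * Complex.I) ^ k * q w := by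
      have := (p k).map_smul_univ (fun _ => Complex.exp (θ * Complex.I)) (fun _ => w)
      simpa [q] using this
    simp only [H, h1, h2, map_mul, ← Complex.exp_conj, ← Complex.exp_nat_mul,
      Complex.conj_ofReal, Complex.conj_I, map_natCast]
    rw [show -(k * θ * Complex.I) = (k : ℂ) * (θ * -Complex.I) by ring]
    ring
  have hHi : ∀ θ, IntegrableOn (H θ) Ω := by
    intro θ
    rw [funext (hHrot θ)]
    exact h.integrableOn_comp_mul (fun _ => hnorm θ) (integrableOn_continuous_mul h hqc hgi)
  have hHint : ∀ θ, ∫ w in Ω, H θ w = 0 := by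
    intro θ
    rw [← hzero]
    simp only [hHrot]
    exact h.setIntegral_mul (fun _ => hnorm θ) (fun v => (starRingEnd ℂ) (q v) * g v)
  have hHnorm : ∀ θ, ∫ w in Ω, ‖H θ w‖ = ∫ w in Ω, ‖(starRingEnd ℂ) (q w) * g w‖ := by
    intro θ
    simp only [hHrot]
    exact h.setIntegral_mul (fun _ => hnorm θ) (fun v => ‖(starRingEnd ℂ) (q v) * g v‖)
  have hHmeas : AEStronglyMeasurable (Function.uncurry H)
      ((volume.restrict (Set.Ioc 0 (2 * Real.pi))).prod (volume.restrict Ω)) := by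
    rw [Measure.prod_restrict]
    refine ContinuousOn.aestronglyMeasurable ?_ (measurableSet_Ioc.prod h.isOpen.measurableSet)
    refine ContinuousOn.mul (hqc.comp continuous_snd).continuousOn
      (ContinuousOn.mul (by fun_prop) ?_)
    refine hg.continuousOn.comp (Continuous.continuousOn (by fun_prop)) fun x hx => ?_
    exact h.smul_mem hx.2 (hnorm _).le
  have hswap := integral_integral_swap (f := H) ((integrable_prod_iff hHmeas).2
    ⟨ae_of_all _ fun θ => hHi θ, by
      simp only [Function.uncurry_apply_pair, hHnorm]
      exact integrable_const _⟩)
  simp only [hHint, integral_zero] at hswap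
  have hsq : ∫ w in Ω, ‖q w‖ ^ 2 = 0 := by
    have h1 : ∀ w ∈ Ω, (∫ θ : ℝ in Set.Ioc 0 (2 * Real.pi), H θ w)
        = ((2 * Real.pi : ℝ) : ℂ) * ((‖q w‖ ^ 2 : ℝ) : ℂ) := by
      intro w hw
      simp only [H]
      rw [integral_const_mul, circle_coeff h hg hp k hw]
      have : (starRingEnd ℂ) (q w) * q w = ((‖q w‖ ^ 2 : ℝ) : ℂ) := by
        rw [mul_comm, Complex.mul_conj, Complex.normSq_eq_norm_sq]
      rw [← this]
      push_cast
      simp only [q]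
      ring
    rw [setIntegral_congr_fun h.isOpen.measurableSet h1, integral_const_mul, integral_complex_ofReal,
      ← Complex.ofReal_mul, eq_comm, Complex.ofReal_eq_zero] at hswap
    exact (mul_eq_zero.1 hswap).resolve_left Real.two_pi_pos.ne'
  have hae := (integral_eq_zero_iff_of_nonneg (fun w => by positivity)
    ((h.memLp_of_continuous hq).integrable_norm_pow (by norm_num))).1 hsq
  have hae2 : q =ᵐ[volume.restrict Ω] 0 := by
    filter_upwards [hae] with w hw
    simpa using hw
  exact Measure.eqOn_open_of_ae_eq hae2 h.isOpen hq.continuousOn continuousOn_const hw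

theorem eq_zero_of_inner_bergmanMonomial (h : IsUnitReinhardt Ω) (f : bergmanSpace Ω)
    (hf : ∀ α, inner ℂ (bergmanMonomial h α) f = (0 : ℂ)) : f = 0 := by
  have hg := analyticOnNhd_of_differentiableOn_pi h.isOpen (differentiableOn_holomorphicRep f)
  obtain ⟨p, hp⟩ := hg 0 h.zero_mem
  have hnear : holomorphicRep f =ᶠ[𝓝 0] 0 := by
    filter_upwards [hp.eventually_hasSum, h.isOpen.mem_nhds h.zero_mem] with w hw hwΩ
    simp only [homogeneous_eq_zero h f hf hp _ hwΩ, zero_add] at hw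
    exact hw.unique hasSum_zero
  have hz := hg.eqOn_zero_of_preconnected_of_eventuallyEq_zero h.isPreconnected h.zero_mem hnear
  refine Subtype.ext (Lp.ext ?_)
  filter_upwards [ae_eq_holomorphicRep f, ae_restrict_mem h.isOpen.measurableSet,
    Lp.coeFn_zero ℂ 2 (volume.restrict Ω)] with w h1 h2 h3
  rw [h1, hz h2]
  exact h3.symm

theorem norm_bergmanMonomial_sq (h : IsUnitReinhardt Ω) (α : Fin n → ℕ) :
    ‖bergmanMonomial h α‖ ^ 2 = ∫ z in Ω, ∏ j, ‖z j‖ ^ (2 * α j) := by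
  rw [← inner_self_eq_norm_sq (𝕜 := ℂ), inner_bergmanMonomial_left,
    ← Complex.ofReal_re (∫ z in Ω, ∏ j, ‖z j‖ ^ (2 * α j)), ← integral_complex_ofReal]
  change Complex.re _ = _
  congr 1
  refine setIntegral_congr_fun h.isOpen.measurableSet fun z hz => ?_
  rw [eqOn_holomorphicRep h.isOpen (bergmanMonomial h α)
    (Differentiable.differentiableOn (by fun_prop)) (bergmanMonomial_ae_eq h α) hz, mul_comm,
    Complex.mul_conj, Complex.normSq_eq_norm_sq, norm_prod, ← Finset.prod_pow]
  simp [pow_mul']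

theorem norm_bergmanMonomial_pos (h : IsUnitReinhardt Ω) (α : Fin n → ℕ) :
    0 < ‖bergmanMonomial h α‖ := by
  refine norm_pos_iff.2 fun h0 => ?_
  have h1 : Set.EqOn (fun z : Fin n → ℂ => ∏ j, z j ^ α j) 0 Ω := by
    refine Measure.eqOn_open_of_ae_eq (μ := volume) ?_ h.isOpen (by fun_prop) continuousOn_const
    have h2 := bergmanMonomial_ae_eq h α
    rw [h0] at h2
    exact h2.symm.trans (Lp.coeFn_zero ℂ 2 _)
  obtain ⟨ε, hε, hball⟩ := Metric.isOpen_iff.1 h.isOpen 0 h.zero_mem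
  have h2 := h1 (x := fun _ => ((ε / 2 : ℝ) : ℂ)) (hball (by
    rw [mem_ball_zero_iff, pi_norm_lt_iff hε]
    intro _
    rw [Complex.norm_real, Real.norm_of_nonneg (by positivity)]
    linarith))
  simp only [Pi.zero_apply, Finset.prod_eq_zero_iff] at h2
  obtain ⟨j, -, hj⟩ := h2
  have := eq_zero_of_pow_eq_zero hj
  rw [Complex.ofReal_eq_zero] at this
  linarith

theorem orthonormal_bergmanMonomial (h : IsUnitReinhardt Ω) :
    Orthonormal ℂ fun α => ((‖bergmanMonomial h α‖⁻¹ : ℝ) : ℂ) • bergmanMonomial h α := by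
  refine ⟨fun α => ?_, fun α β hαβ => ?_⟩
  · rw [norm_smul, Complex.norm_real, norm_inv, norm_norm,
      inv_mul_cancel₀ (norm_bergmanMonomial_pos h α).ne']
  · refine (inner_smul_left (𝕜 := ℂ) (E := bergmanSpace Ω) _ _ _).trans ?_
    refine mul_eq_zero_of_right _ ?_
    refine (inner_smul_right (𝕜 := ℂ) (E := bergmanSpace Ω) _ _ _).trans ?_
    refine mul_eq_zero_of_right _ ?_
    exact inner_bergmanMonomial_of_ne h hαβ

/-- The kernel may be computed in any basis, here in the normalised monomials. -/
theorem IsBergmanKernel.hasSum_monomial (h : IsUnitReinhardt Ω) {K : (Fin n → ℂ) → ℝ}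
    (hK : IsBergmanKernel Ω K) {z : Fin n → ℂ} (hz : z ∈ Ω) :
    HasSum (fun α : Fin n → ℕ => (∏ j, ‖z j‖ ^ (2 * α j)) / ∫ w in Ω, ∏ j, ‖w j‖ ^ (2 * α j))
      (K z) := by
  have : CompleteSpace (bergmanSpace Ω) := (isClosed_bergmanSpace h.isOpen).completeSpace_coe
  let φ := HilbertBasis.mkOfOrthogonalEqBot (orthonormal_bergmanMonomial h) (by
    rw [Submodule.eq_bot_iff]
    intro f hf
    refine eq_zero_of_inner_bergmanMonomial h f fun α => ?_
    have h1 := Submodule.inner_right_of_mem_orthogonal (Submodule.subset_span (Set.mem_range_self α)) hf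
    have h2 := (inner_smul_left (𝕜 := ℂ) (E := bergmanSpace Ω) _ _ _).symm.trans h1
    refine (mul_eq_zero.1 h2).resolve_left ?_
    simpa using norm_pos_iff.1 (norm_bergmanMonomial_pos h α))
  refine (hK.2 _ φ z hz).congr_fun fun α => ?_
  have hφ : φ α = ((‖bergmanMonomial h α‖⁻¹ : ℝ) : ℂ) • bergmanMonomial h α := by
    simp [φ, HilbertBasis.coe_mkOfOrthogonalEqBot]
  rw [← norm_bergmanMonomial_sq h, hφ, eqOn_holomorphicRep h.isOpen _
    (g := ((‖bergmanMonomial h α‖⁻¹ : ℝ) : ℂ) • fun z : Fin n → ℂ => ∏ j, z j ^ α j)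
    (Differentiable.differentiableOn (by fun_prop))
    ((Lp.coeFn_smul _ _).trans ((bergmanMonomial_ae_eq h α).const_smul _)) hz]
  rw [Pi.smul_apply, norm_smul, Complex.norm_real, norm_inv, norm_norm, mul_pow, norm_prod,
    ← Finset.prod_pow, inv_pow, inv_mul_eq_div]
  simp [pow_mul']

end Reinhardt

/-! ### Norms of monomials on the ellipsoid. -/

theorem map_pi_smul_volume {n : ℕ} {c : Fin n → ℝ} (hc : ∀ j, 0 < c j) :
    Measure.map (fun (z : Fin n → ℂ) j => c j • z j) volume
      = (∏ j, ENNReal.ofReal ((c j ^ 2)⁻¹)) • (volume : Measure (Fin n → ℂ)) := by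
  set a : ENNReal := ∏ j, ENNReal.ofReal ((c j ^ 2)⁻¹) with ha
  have ha0 : a ≠ 0 := by
    refine Finset.prod_ne_zero_iff.2 fun j _ => ?_
    have := hc j
    simp only [ne_eq, ENNReal.ofReal_eq_zero, not_le]
    positivity
  have hat : a ≠ ⊤ := ENNReal.prod_ne_top fun j _ => ENNReal.ofReal_ne_top
  have hmeas : Measurable fun (z : Fin n → ℂ) j => c j • z j := by fun_prop
  have h : (volume : Measure (Fin n → ℂ))
      = a⁻¹ • Measure.map (fun (z : Fin n → ℂ) j => c j • z j) volume := by
    refine Measure.pi_eq fun s hs => ?_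
    have hpre : (fun (z : Fin n → ℂ) j => c j • z j) ⁻¹' Set.univ.pi s
        = Set.univ.pi fun j => (c j • ·) ⁻¹' s j := by
      ext z; simp
    rw [Measure.smul_apply, Measure.map_apply hmeas (MeasurableSet.univ_pi hs), hpre, volume_pi_pi]
    simp only [Measure.addHaar_preimage_smul volume (hc _).ne', Complex.finrank_real_complex]
    rw [Finset.prod_mul_distrib, smul_eq_mul, ← mul_assoc]
    have : ∏ j, ENNReal.ofReal |(c j ^ 2)⁻¹| = a :=
      Finset.prod_congr rfl fun j _ => by rw [abs_of_pos (by have := hc j; positivity)]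
    rw [this, ENNReal.inv_mul_cancel ha0 hat, one_mul]
  conv_rhs => rw [h]
  rw [smul_smul, ENNReal.mul_inv_cancel ha0 hat, one_smul]

namespace Ellipsoid

variable {n : ℕ} {m : Fin n → ℕ}

/-- The exponent `∑ (αⱼ + 1) / mⱼ`. -/
noncomputable def weight (m α : Fin n → ℕ) : ℝ := ∑ j, ((α j : ℝ) + 1) / m j

theorem weight_nonneg (m α : Fin n → ℕ) : 0 ≤ weight m α :=
  Finset.sum_nonneg fun _ _ => by positivity

/-- Dilating the `j`-th coordinate by $s^{1/(2m_j)}$ maps `E m` onto the sublevel set. Its Jacobian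
contributes $s^{1/m_j}$ and the monomial $s^{\alpha_j/m_j}$. -/
theorem lintegral_sublevel_eq (hm : ∀ j, 1 ≤ m j) (α : Fin n → ℕ) {s : ℝ} (hs : 0 < s) :
    ∫⁻ z : Fin n → ℂ, {z | ∑ j, ‖z j‖ ^ (2 * m j) < s}.indicator
        (fun z => ENNReal.ofReal (∏ j, ‖z j‖ ^ (2 * α j))) z
      = ENNReal.ofReal (s ^ weight m α)
        * ∫⁻ z in E m, ENNReal.ofReal (∏ j, ‖z j‖ ^ (2 * α j)) := by
  let c : Fin n → ℝ := fun j => s ^ (1 / (2 * (m j : ℝ)))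
  have hc : ∀ j, 0 < c j := fun j => Real.rpow_pos_of_pos hs _
  have hm0 : ∀ j, (m j : ℝ) ≠ 0 := fun j => by have := hm j; positivity
  have hcm : ∀ j, c j ^ (2 * m j) = s := fun j => by
    rw [← Real.rpow_natCast, ← Real.rpow_mul hs.le]
    push_cast
    rw [one_div, inv_mul_cancel₀ (by have := hm0 j; positivity), Real.rpow_one]
  have hcα : ∀ j, c j ^ (2 * α j) * c j ^ 2 = s ^ (((α j : ℝ) + 1) / m j) := fun j => by
    rw [← pow_add, ← Real.rpow_natCast, ← Real.rpow_mul hs.le]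
    congr 1
    push_cast
    have := hm0 j
    field_simp
  have hEm : MeasurableSet (E m) := by
    refine measurableSet_lt ?_ measurable_const
    fun_prop
  set F : (Fin n → ℂ) → ENNReal := {z | ∑ j, ‖z j‖ ^ (2 * m j) < s}.indicator
        (fun z => ENNReal.ofReal (∏ j, ‖z j‖ ^ (2 * α j))) with hF
  have hFm : Measurable F := by
    refine Measurable.indicator (by fun_prop) (measurableSet_lt (by fun_prop) measurable_const)
  have h1 : ∫⁻ z : Fin n → ℂ, F (fun j => c j • z j) = (∏ j, ENNReal.ofReal ((c j ^ 2)⁻¹)) * ∫⁻ z, F z := by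
    rw [← lintegral_map (f := F) hFm (by fun_prop), map_pi_smul_volume hc, lintegral_smul_measure,
      smul_eq_mul]
  have h2 : ∫⁻ z : Fin n → ℂ, F (fun j => c j • z j) = (∏ j, ENNReal.ofReal (c j ^ (2 * α j)))
      * ∫⁻ z in E m, ENNReal.ofReal (∏ j, ‖z j‖ ^ (2 * α j)) := by
    rw [← lintegral_indicator hEm, ← lintegral_const_mul _ (Measurable.indicator (by fun_prop) hEm)]
    refine lintegral_congr fun z => ?_
    have hmem : (fun j => c j • z j) ∈ {z : Fin n → ℂ | ∑ j, ‖z j‖ ^ (2 * m j) < s} ↔ z ∈ E m := by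
      simp only [E, Set.mem_ofPred_eq, norm_smul, mul_pow, Real.norm_of_nonneg (hc _).le, hcm]
      rw [← Finset.mul_sum]
      exact mul_lt_iff_lt_one_right hs
    by_cases hz : z ∈ E m
    · rw [hF, Set.indicator_of_mem (hmem.2 hz), Set.indicator_of_mem hz]
      simp only [norm_smul, mul_pow, Real.norm_of_nonneg (hc _).le, Finset.prod_mul_distrib]
      rw [ENNReal.ofReal_mul (Finset.prod_nonneg fun j _ => by have := hc j; positivity),
        ENNReal.ofReal_prod_of_nonneg fun j _ => by have := hc j; positivity]
    · rw [hF, Set.indicator_of_notMem (mt hmem.1 hz), Set.indicator_of_notMem hz, mul_zero]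
  have h3 : (∏ j, ENNReal.ofReal (c j ^ 2)) * (∏ j, ENNReal.ofReal ((c j ^ 2)⁻¹)) = 1 := by
    rw [← Finset.prod_mul_distrib]
    refine Finset.prod_eq_one fun j _ => ?_
    have := hc j
    rw [← ENNReal.ofReal_mul (by positivity), mul_inv_cancel₀ (by positivity), ENNReal.ofReal_one]
  calc ∫⁻ z, F z = (∏ j, ENNReal.ofReal (c j ^ 2)) *
        ((∏ j, ENNReal.ofReal ((c j ^ 2)⁻¹)) * ∫⁻ z, F z) := by rw [← mul_assoc, h3, one_mul]
    _ = (∏ j, ENNReal.ofReal (c j ^ 2)) * ((∏ j, ENNReal.ofReal (c j ^ (2 * α j)))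
      * ∫⁻ z in E m, ENNReal.ofReal (∏ j, ‖z j‖ ^ (2 * α j))) := by rw [← h1, h2]
    _ = _ := by
      rw [← mul_assoc, ← Finset.prod_mul_distrib]
      congr 1
      rw [weight, Real.rpow_sum_of_pos hs, ENNReal.ofReal_prod_of_nonneg
        fun j _ => Real.rpow_nonneg hs.le _]
      refine Finset.prod_congr rfl fun j _ => ?_
      have := hc j
      rw [← ENNReal.ofReal_mul (by positivity), mul_comm, hcα]

theorem integral_monomial_mul_exp (hm : ∀ j, 1 ≤ m j) (α : Fin n → ℕ) :
    ∫ z : Fin n → ℂ, ∏ j, (‖z j‖ ^ (2 * α j) * Real.exp (-‖z j‖ ^ (2 * m j)))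
      = ∏ j, (Real.pi / m j * Real.Gamma (((α j : ℝ) + 1) / m j)) := by
  rw [integral_fintype_prod_volume_eq_prod
    (f := fun j (z : ℂ) => ‖z‖ ^ (2 * α j) * Real.exp (-‖z‖ ^ (2 * m j)))]
  refine Finset.prod_congr rfl fun j _ => ?_
  have hmj : (1 : ℝ) ≤ m j := by exact_mod_cast hm j
  have h := Complex.integral_rpow_mul_exp_neg_rpow (p := ((2 * m j : ℕ) : ℝ))
    (q := ((2 * α j : ℕ) : ℝ)) (by push_cast; linarith)
    (by have : (0 : ℝ) ≤ ((2 * α j : ℕ) : ℝ) := Nat.cast_nonneg _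
        linarith)
  simp only [Real.rpow_natCast] at h
  rw [h]
  push_cast
  congr 1
  · field_simp
  · congr 1; field_simp

theorem integral_exp_neg_indicator {a : ℝ} (ha : 0 ≤ a) :
    ∫⁻ s in Set.Ioi (0 : ℝ), (Set.Ioi a).indicator (fun s => ENNReal.ofReal (Real.exp (-s))) s
      = ENNReal.ofReal (Real.exp (-a)) := by
  rw [lintegral_indicator measurableSet_Ioi, Measure.restrict_restrict measurableSet_Ioi,
    Set.inter_eq_left.2 (Set.Ioi_subset_Ioi ha),
    ← ofReal_integral_eq_lintegral_ofReal (integrableOn_exp_neg_Ioi a)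
      (ae_of_all _ fun s => (Real.exp_pos _).le), integral_exp_neg_Ioi]

theorem ofReal_Gamma_eq_lintegral {σ : ℝ} (hσ : 0 ≤ σ) :
    ENNReal.ofReal (Real.Gamma (σ + 1))
      = ∫⁻ s in Set.Ioi (0 : ℝ), ENNReal.ofReal (Real.exp (-s)) * ENNReal.ofReal (s ^ σ) := by
  have hσ' : 0 < σ + 1 := by linarith
  have hint := Real.GammaIntegral_convergent hσ'
  rw [Real.Gamma_eq_integral hσ', ofReal_integral_eq_lintegral_ofReal hint]
  · refine lintegral_congr fun s => ?_
    rw [add_sub_cancel_right, ENNReal.ofReal_mul (Real.exp_pos _).le]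
  · filter_upwards [ae_restrict_mem measurableSet_Ioi] with s hs
    have : (0 : ℝ) < s := hs
    positivity

/-- The integral of the monomial against $e^{-\sum|z_j|^{2m_j}}$ over the whole space factorises
into Gamma values. Writing $e^{-S}=\int_S^\infty e^{-s}ds$ and scaling the sublevel sets, it is also
the integral over `E m` times $\Gamma(\mathrm{weight}+1)$. -/
theorem setIntegral_monomial (hm : ∀ j, 1 ≤ m j) (α : Fin n → ℕ) :
    ∫ z in E m, ∏ j, ‖z j‖ ^ (2 * α j)
      = (∏ j, (Real.pi / m j * Real.Gamma (((α j : ℝ) + 1) / m j)))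
        / Real.Gamma (weight m α + 1) := by
  set V := ∫⁻ z in E m, ENNReal.ofReal (∏ j, ‖z j‖ ^ (2 * α j)) with hV
  have hpos : 0 < ∏ j, (Real.pi / m j * Real.Gamma (((α j : ℝ) + 1) / m j)) :=
    Finset.prod_pos fun j _ => by
      have := hm j
      have : 0 < Real.Gamma (((α j : ℝ) + 1) / m j) := Real.Gamma_pos_of_pos (by positivity)
      have := Real.pi_pos
      positivity
  have hI := integral_monomial_mul_exp hm α
  -- A nonzero Bochner integral forces integrability, since it is `0` by convention otherwise.
  have hint : Integrable fun z : Fin n → ℂ =>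
      ∏ j, (‖z j‖ ^ (2 * α j) * Real.exp (-‖z j‖ ^ (2 * m j))) :=
    Integrable.of_integral_ne_zero (by rw [hI]; exact hpos.ne')
  have h1 : ENNReal.ofReal (∏ j, (Real.pi / m j * Real.Gamma (((α j : ℝ) + 1) / m j)))
      = V * ENNReal.ofReal (Real.Gamma (weight m α + 1)) := by
    rw [← hI, ofReal_integral_eq_lintegral_ofReal hint
      (ae_of_all _ fun z => Finset.prod_nonneg fun j _ => by positivity)]
    have hpt : ∀ z : Fin n → ℂ, ENNReal.ofReal
        (∏ j, (‖z j‖ ^ (2 * α j) * Real.exp (-‖z j‖ ^ (2 * m j))))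
        = ∫⁻ s in Set.Ioi (0 : ℝ), {z | ∑ j, ‖z j‖ ^ (2 * m j) < s}.indicator
          (fun z => ENNReal.ofReal (∏ j, ‖z j‖ ^ (2 * α j))) z * ENNReal.ofReal (Real.exp (-s)) := by
      intro z
      rw [Finset.prod_mul_distrib, ← Real.exp_sum, Finset.sum_neg_distrib,
        ENNReal.ofReal_mul (Finset.prod_nonneg fun j _ => by positivity),
        ← integral_exp_neg_indicator (Finset.sum_nonneg fun j _ => by positivity),
        ← lintegral_const_mul' _ _ ENNReal.ofReal_ne_top]
      refine lintegral_congr fun s => ?_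
      by_cases hs : ∑ j, ‖z j‖ ^ (2 * m j) < s
      · rw [Set.indicator_of_mem (show s ∈ Set.Ioi _ from hs),
          Set.indicator_of_mem (show z ∈ {z | ∑ j, ‖z j‖ ^ (2 * m j) < s} from hs)]
      · rw [Set.indicator_of_notMem (show s ∉ Set.Ioi _ from hs),
          Set.indicator_of_notMem (show z ∉ {z | ∑ j, ‖z j‖ ^ (2 * m j) < s} from hs), mul_zero,
          zero_mul]
    rw [lintegral_congr hpt, lintegral_lintegral_swap]
    · rw [ofReal_Gamma_eq_lintegral (weight_nonneg m α), ← lintegral_const_mul _ (by fun_prop)]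
      refine setLIntegral_congr_fun measurableSet_Ioi fun s hs => ?_
      rw [lintegral_mul_const' _ _ ENNReal.ofReal_ne_top, lintegral_sublevel_eq hm α hs, ← hV]
      ring
    · refine Measurable.aemeasurable (Measurable.mul ?_ (by fun_prop))
      have : (Function.uncurry fun (z : Fin n → ℂ) (s : ℝ) =>
          {z | ∑ j, ‖z j‖ ^ (2 * m j) < s}.indicator
          (fun z => ENNReal.ofReal (∏ j, ‖z j‖ ^ (2 * α j))) z)
          = {x : (Fin n → ℂ) × ℝ | ∑ j, ‖x.1 j‖ ^ (2 * m j) < x.2}.indicator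
            (fun x => ENNReal.ofReal (∏ j, ‖x.1 j‖ ^ (2 * α j))) := by
        ext ⟨z, s⟩
        simp [Set.indicator]
      refine (this ▸ ?_ : Measurable (Function.uncurry fun (z : Fin n → ℂ) (s : ℝ) =>
          {z | ∑ j, ‖z j‖ ^ (2 * m j) < s}.indicator
          (fun z => ENNReal.ofReal (∏ j, ‖z j‖ ^ (2 * α j))) z))
      exact Measurable.indicator (by fun_prop) (measurableSet_lt (by fun_prop) (by fun_prop))
  have hG : 0 < Real.Gamma (weight m α + 1) :=
    Real.Gamma_pos_of_pos (by linarith [weight_nonneg m α])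
  have h2 := congrArg ENNReal.toReal h1
  rw [ENNReal.toReal_ofReal hpos.le, ENNReal.toReal_mul, ENNReal.toReal_ofReal hG.le] at h2
  rw [h2, mul_div_cancel_right₀ _ hG.ne', hV, integral_eq_lintegral_of_nonneg_ae]
  · exact ae_of_all _ fun z => Finset.prod_nonneg fun j _ => by positivity
  · exact Continuous.aestronglyMeasurable (by fun_prop)

theorem isOpen_E (m : Fin n → ℕ) : IsOpen (E m) :=
  isOpen_lt (by fun_prop) continuous_const

theorem norm_pow_le_one_of_mem_E {z : Fin n → ℂ} (hz : z ∈ E m) (j : Fin n) :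
    ‖z j‖ ^ (2 * m j) < 1 :=
  lt_of_le_of_lt (Finset.single_le_sum (f := fun j => ‖z j‖ ^ (2 * m j))
    (fun _ _ => by positivity) (Finset.mem_univ j)) hz

theorem isUnitReinhardt_E (hm : ∀ j, 1 ≤ m j) : IsUnitReinhardt (E m) where
  isOpen := isOpen_E m
  zero_mem := by
    have : ∀ j, 2 * m j ≠ 0 := fun j => by have := hm j; omega
    simp [E, this]
  norm_le z hz := by
    refine (pi_norm_le_iff_of_nonneg zero_le_one).2 fun j => ?_
    by_contra! h
    exact absurd (norm_pow_le_one_of_mem_E hz j) (not_lt.2 (one_le_pow₀ h.le))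
  mul_mem z hz u hu := by
    change ∑ j, ‖u j * z j‖ ^ (2 * m j) < 1
    refine lt_of_le_of_lt (Finset.sum_le_sum fun j _ => ?_) (show ∑ j, ‖z j‖ ^ (2 * m j) < 1 from hz)
    rw [norm_mul, mul_pow]
    exact mul_le_of_le_one_left (by positivity) (pow_le_one₀ (norm_nonneg _) (hu j))

end Ellipsoid

/-! ### Laplace integrals of products of entire functions. -/

theorem hasSum_mul_of_nonneg {ι κ : Type*} {f : ι → ℝ} {g : κ → ℝ} {a b : ℝ} (hf : HasSum f a)
    (hg : HasSum g b) (hf0 : ∀ i, 0 ≤ f i) (hg0 : ∀ i, 0 ≤ g i) :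
    HasSum (fun x : ι × κ => f x.1 * g x.2) (a * b) :=
  hf.mul hg (hf.summable.mul_of_nonneg hg.summable hf0 hg0)

theorem hasSum_prod_pi_of_nonneg {n : ℕ} {u : Fin n → ℕ → ℝ} {s : Fin n → ℝ}
    (hu : ∀ j a, 0 ≤ u j a) (hs : ∀ j, HasSum (u j) (s j)) :
    HasSum (fun α : Fin n → ℕ => ∏ j, u j (α j)) (∏ j, s j) := by
  induction n with
  | zero => simp
  | succ n ih =>
    have h := ih (fun j a => hu j.succ a) (fun j => hs j.succ)
    have hnn : ∀ α : Fin n → ℕ, 0 ≤ ∏ j, u j.succ (α j) := fun α =>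
      Finset.prod_nonneg fun j _ => hu _ _
    have h2 := hasSum_mul_of_nonneg (hs 0) h (hu 0) hnn
    rw [Fin.prod_univ_succ]
    refine (Fin.consEquiv fun _ : Fin (n + 1) => ℕ).hasSum_iff.1 (h2.congr_fun fun x => ?_)
    simp [Fin.prod_univ_succ, Fin.consEquiv]

theorem norm_rpow_smul_pow {m : ℕ} (hm : 1 ≤ m) {τ : ℝ} (hτ : 0 < τ) (x : ℂ) :
    ‖((τ ^ (1 / (m : ℝ)) : ℝ) : ℂ) * x‖ ^ m = τ * ‖x‖ ^ m := by
  rw [norm_mul, mul_pow, Complex.norm_real, Real.norm_of_nonneg (by positivity),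
    ← Real.rpow_natCast, ← Real.rpow_mul hτ.le, one_div, inv_mul_cancel₀ (by positivity),
    Real.rpow_one]

/-- Entire functions of order `m` and type at most one. -/
def HasUnitType (m : ℕ) (G : ℂ → ℂ) : Prop :=
  Differentiable ℂ G ∧ ∀ η : ℝ, 0 < η → ∃ C : ℝ, 0 < C ∧
    ∀ x : ℂ, ‖G x‖ ≤ C * Real.exp ((1 + η) * ‖x‖ ^ m)

theorem hasUnitType_mittagRoot {m : ℕ} (hm : 1 ≤ m) : HasUnitType m (mittagRoot m) :=
  ⟨differentiable_mittagRoot hm, fun _ hη => norm_mittagRoot_le hm hη⟩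

theorem hasUnitType_mittagMain (m : ℕ) : HasUnitType m (mittagMain m) :=
  ⟨differentiable_mittagMain m, fun _ hη => norm_mittagMain_le m hη⟩

section Laplace

variable {n : ℕ}

/-- The integrand `e^{-τ} τ^a ∏_{j ∈ P} τ^{1/mⱼ} Gⱼ(τ^{1/mⱼ} xⱼ)`. -/
noncomputable def laplaceIntegrand (m : Fin n → ℕ) (a : ℝ) (P : Finset (Fin n))
    (G : Fin n → ℂ → ℂ) (x : Fin n → ℂ) (τ : ℝ) : ℂ :=
  ((Real.exp (-τ) * τ ^ a : ℝ) : ℂ) *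
    ∏ j ∈ P, (((τ ^ (1 / (m j : ℝ)) : ℝ) : ℂ) * G j (((τ ^ (1 / (m j : ℝ)) : ℝ) : ℂ) * x j))

theorem continuousOn_laplaceIntegrand (m : Fin n → ℕ) (a : ℝ) (P : Finset (Fin n))
    {G : Fin n → ℂ → ℂ} (hG : ∀ j, Differentiable ℂ (G j)) (x : Fin n → ℂ) :
    ContinuousOn (laplaceIntegrand m a P G x) (Set.Ioi 0) := by
  have hpow : ∀ b : ℝ, ContinuousOn (fun τ : ℝ => τ ^ b) (Set.Ioi 0) := fun b τ hτ =>
    (Real.continuousAt_rpow_const τ b (Or.inl (ne_of_gt hτ))).continuousWithinAt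
  have hpowc : ∀ b : ℝ, ContinuousOn (fun τ : ℝ => ((τ ^ b : ℝ) : ℂ)) (Set.Ioi 0) := fun b =>
    Complex.continuous_ofReal.comp_continuousOn (hpow b)
  refine ContinuousOn.mul (Complex.continuous_ofReal.comp_continuousOn
    (ContinuousOn.mul (by fun_prop) (hpow a))) (continuousOn_finsetProd _ fun j _ => ?_)
  exact (hpowc _).mul ((hG j).continuous.comp_continuousOn ((hpowc _).mul continuousOn_const))

theorem differentiable_laplaceIntegrand (m : Fin n → ℕ) (a : ℝ) (P : Finset (Fin n))
    {G : Fin n → ℂ → ℂ} (hG : ∀ j, Differentiable ℂ (G j)) (τ : ℝ) :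
    Differentiable ℂ fun x => laplaceIntegrand m a P G x τ := by
  have h : ∀ j, Differentiable ℂ fun x : Fin n → ℂ =>
      ((τ ^ (1 / (m j : ℝ)) : ℝ) : ℂ) * G j (((τ ^ (1 / (m j : ℝ)) : ℝ) : ℂ) * x j) := fun j =>
    (differentiable_const _).mul ((hG j).comp (by fun_prop))
  refine (differentiable_const _).mul fun x => ?_
  exact (HasFDerivAt.finsetProd (u := P) fun j _ => (h j x).hasFDerivAt).differentiableAt

theorem norm_laplaceIntegrand_le {m : Fin n → ℕ} (hm : ∀ j, 1 ≤ m j) (a : ℝ) (P : Finset (Fin n))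
    {G : Fin n → ℂ → ℂ} (hG : ∀ j, HasUnitType (m j) (G j)) {η : ℝ} (hη : 0 < η) :
    ∃ C : ℝ, 0 < C ∧ ∀ τ : ℝ, 0 < τ → ∀ x : Fin n → ℂ, ‖laplaceIntegrand m a P G x τ‖
      ≤ C * (τ ^ (a + ∑ j ∈ P, 1 / (m j : ℝ))
        * Real.exp (-((1 - (1 + η) * ∑ j ∈ P, ‖x j‖ ^ m j) * τ))) := by
  choose C hC0 hC using fun j => (hG j).2 η hη
  refine ⟨∏ j ∈ P, C j, Finset.prod_pos fun j _ => hC0 j, fun τ hτ x => ?_⟩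
  rw [laplaceIntegrand, norm_mul, Complex.norm_real, Real.norm_of_nonneg (by positivity), norm_prod]
  have h1 : ∏ j ∈ P, ‖((τ ^ (1 / (m j : ℝ)) : ℝ) : ℂ) * G j (((τ ^ (1 / (m j : ℝ)) : ℝ) : ℂ) * x j)‖
      ≤ ∏ j ∈ P, (τ ^ (1 / (m j : ℝ)) * (C j * Real.exp ((1 + η) * (τ * ‖x j‖ ^ m j)))) := by
    refine Finset.prod_le_prod (fun _ _ => norm_nonneg _) fun j _ => ?_
    have h2 := hC j (((τ ^ (1 / (m j : ℝ)) : ℝ) : ℂ) * x j)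
    rw [norm_rpow_smul_pow (hm j) hτ] at h2
    rw [norm_mul, Complex.norm_real, Real.norm_of_nonneg (by positivity)]
    gcongr
  refine (mul_le_mul_of_nonneg_left h1 (by positivity)).trans (le_of_eq ?_)
  rw [Finset.prod_mul_distrib, Finset.prod_mul_distrib, ← Real.exp_sum, Real.rpow_add hτ,
    Real.rpow_sum_of_pos hτ]
  have h3 : Real.exp (-((1 - (1 + η) * ∑ j ∈ P, ‖x j‖ ^ m j) * τ))
      = Real.exp (-τ) * Real.exp (∑ j ∈ P, (1 + η) * (τ * ‖x j‖ ^ m j)) := by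
    rw [← Real.exp_add, ← Finset.mul_sum, ← Finset.mul_sum]
    ring_nf
  rw [h3]
  ring

theorem integrableOn_rpow_mul_exp_neg_mul {b c : ℝ} (hb : 0 ≤ b) (hc : 0 < c) :
    IntegrableOn (fun τ : ℝ => τ ^ b * Real.exp (-(c * τ))) (Set.Ioi 0) := by
  have := integrableOn_rpow_mul_exp (β := b + 1) (by linarith) hc
  simpa using this

/-- Type at most one bounds the product by $e^{(1+\eta)\tau\sum|x_j|^{m_j}}$, so $e^{-\tau}$
dominates it locally uniformly where the sum is less than `1`. -/
theorem analyticOnNhd_integral_laplaceIntegrand {m : Fin n → ℕ} (hm : ∀ j, 1 ≤ m j) {a : ℝ}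
    (ha : 0 ≤ a) (P : Finset (Fin n)) {G : Fin n → ℂ → ℂ} (hG : ∀ j, HasUnitType (m j) (G j)) :
    AnalyticOnNhd ℂ (fun x => ∫ τ in Set.Ioi 0, laplaceIntegrand m a P G x τ)
      {x | ∑ j ∈ P, ‖x j‖ ^ m j < 1} := by
  intro x₀ hx₀
  obtain ⟨c, hc1, hc2⟩ := exists_between (show ∑ j ∈ P, ‖x₀ j‖ ^ m j < 1 from hx₀)
  have hc0 : 0 ≤ c := (Finset.sum_nonneg fun j _ => by positivity).trans hc1.le
  -- With this choice $1-(1+\eta)c=(1-c)(2-c)/2>0$.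
  set η := (1 - c) / 2 with hη
  have hη0 : 0 < η := by linarith
  have hpos : 0 < 1 - (1 + η) * c := by nlinarith
  obtain ⟨C, hC0, hC⟩ := norm_laplaceIntegrand_le hm a P hG hη0
  have hb : 0 ≤ a + ∑ j ∈ P, 1 / (m j : ℝ) :=
    add_nonneg ha (Finset.sum_nonneg fun j _ => by positivity)
  refine analyticOnNhd_integral_of_dominated (U := {x | ∑ j ∈ P, ‖x j‖ ^ m j < c})
    (isOpen_lt (by fun_prop) continuous_const)
    (fun x _ => (continuousOn_laplaceIntegrand m a P (fun j => (hG j).1) x).aestronglyMeasurable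
      measurableSet_Ioi)
    (ae_of_all _ fun τ =>
      (differentiable_laplaceIntegrand m a P (fun j => (hG j).1) τ).differentiableOn) ?_
    ((integrableOn_rpow_mul_exp_neg_mul hb hpos).const_mul C) x₀ hc1
  filter_upwards [ae_restrict_mem measurableSet_Ioi] with τ hτ x hx
  have hτ' : (0 : ℝ) < τ := hτ
  have hx' : ∑ j ∈ P, ‖x j‖ ^ m j < c := hx
  refine (hC τ hτ x).trans ?_
  gcongr

theorem integrableOn_laplaceIntegrand {m : Fin n → ℕ} (hm : ∀ j, 1 ≤ m j) {a : ℝ}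
    (ha : 0 ≤ a) (P : Finset (Fin n)) {G : Fin n → ℂ → ℂ} (hG : ∀ j, HasUnitType (m j) (G j))
    {x : Fin n → ℂ} (hx : ∑ j ∈ P, ‖x j‖ ^ m j < 1) :
    IntegrableOn (laplaceIntegrand m a P G x) (Set.Ioi 0) := by
  set c := ∑ j ∈ P, ‖x j‖ ^ m j with hc
  have hc0 : 0 ≤ c := Finset.sum_nonneg fun j _ => by positivity
  set η := (1 - c) / 2 with hη
  have hη0 : 0 < η := by linarith
  have hpos : 0 < 1 - (1 + η) * c := by nlinarith
  obtain ⟨C, hC0, hC⟩ := norm_laplaceIntegrand_le hm a P hG hη0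
  have hb : 0 ≤ a + ∑ j ∈ P, 1 / (m j : ℝ) :=
    add_nonneg ha (Finset.sum_nonneg fun j _ => by positivity)
  refine ((integrableOn_rpow_mul_exp_neg_mul hb hpos).const_mul C).mono'
    ((continuousOn_laplaceIntegrand m a P (fun j => (hG j).1) x).aestronglyMeasurable
      measurableSet_Ioi) ?_
  filter_upwards [ae_restrict_mem measurableSet_Ioi] with τ hτ
  exact hC τ hτ x

/-- The integrand `e^{-τ} τ^a ∏_{j ∈ P} τ^{1/mⱼ} fⱼ(τ^{1/mⱼ} xⱼ)` for real arguments, with the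
Mittag-Leffler functions `fⱼ` of index `1/mⱼ`. -/
noncomputable def mittagIntegrand (m : Fin n → ℕ) (a : ℝ) (P : Finset (Fin n))
    (x : Fin n → ℝ) (τ : ℝ) : ℝ :=
  Real.exp (-τ) * τ ^ a *
    ∏ j ∈ P, (τ ^ (1 / (m j : ℝ)) * mittagRootReal (m j) (τ ^ (1 / (m j : ℝ)) * x j))

theorem laplaceIntegrand_mittagRoot (m : Fin n → ℕ) (a : ℝ) (P : Finset (Fin n))
    (x : Fin n → ℝ) (τ : ℝ) :
    laplaceIntegrand m a P (fun j => mittagRoot (m j)) (fun j => (x j : ℂ)) τ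
      = (mittagIntegrand m a P x τ : ℂ) := by
  unfold laplaceIntegrand mittagIntegrand
  push_cast
  congr 1
  refine Finset.prod_congr rfl fun j _ => ?_
  rw [← Complex.ofReal_mul, mittagRoot_ofReal]

theorem integrableOn_mittagIntegrand {m : Fin n → ℕ} (hm : ∀ j, 1 ≤ m j) {a : ℝ}
    (ha : 0 ≤ a) (P : Finset (Fin n)) {x : Fin n → ℝ} (hx0 : ∀ j, 0 ≤ x j)
    (hx : ∑ j ∈ P, x j ^ m j < 1) : IntegrableOn (mittagIntegrand m a P x) (Set.Ioi 0) := by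
  have h := (integrableOn_laplaceIntegrand hm ha P (fun j => hasUnitType_mittagRoot (hm j))
    (x := fun j => (x j : ℂ)) (by simpa [abs_of_nonneg (hx0 _)] using hx)).re
  refine h.congr (ae_of_all _ fun τ => ?_)
  simp [laplaceIntegrand_mittagRoot]

theorem integral_laplaceIntegrand_mittagRoot (m : Fin n → ℕ) (a : ℝ) (P : Finset (Fin n))
    (x : Fin n → ℝ) :
    ∫ τ in Set.Ioi 0, laplaceIntegrand m a P (fun j => mittagRoot (m j)) (fun j => (x j : ℂ)) τ
      = ((∫ τ in Set.Ioi 0, mittagIntegrand m a P x τ : ℝ) : ℂ) := by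
  simp only [laplaceIntegrand_mittagRoot]
  exact integral_complex_ofReal

theorem mittagIntegrand_pos {m : Fin n → ℕ} (hm : ∀ j, 1 ≤ m j) (a : ℝ) (P : Finset (Fin n))
    {x : Fin n → ℝ} (hx0 : ∀ j, 0 ≤ x j) {τ : ℝ} (hτ : 0 < τ) : 0 < mittagIntegrand m a P x τ := by
  refine mul_pos (by positivity) (Finset.prod_pos fun j _ => mul_pos (by positivity) ?_)
  exact mittagRootReal_pos (hm j) (mul_nonneg (by positivity) (hx0 j))

end Laplace

/-! ### The Bergman kernel as a Laplace integral. -/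

namespace Ellipsoid

variable {n : ℕ} {m : Fin n → ℕ}

/-- The factor $\Gamma(\mathrm{weight}+1)$ from the monomial norm is written as $\int
e^{-\tau}\tau^{\mathrm{weight}}d\tau$, and the power of `τ` is distributed over the coordinates. -/
theorem kernel_term_eq (hm : ∀ j, 1 ≤ m j) (z : Fin n → ℂ) (α : Fin n → ℕ) :
    (∏ j, ‖z j‖ ^ (2 * α j)) / (∫ w in E m, ∏ j, ‖w j‖ ^ (2 * α j))
      = ∫ τ in Set.Ioi (0 : ℝ), (∏ j, (m j : ℝ)) / Real.pi ^ n * (Real.exp (-τ) *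
          ∏ j, (τ ^ (1 / (m j : ℝ)) * ((τ ^ (1 / (m j : ℝ)) * ‖z j‖ ^ 2) ^ α j
            / Real.Gamma (((α j : ℝ) + 1) / m j)))) := by
  have hG : ∀ j, 0 < Real.Gamma (((α j : ℝ) + 1) / m j) := fun j =>
    Real.Gamma_pos_of_pos (by have := hm j; positivity)
  have hw : 0 < weight m α + 1 := by linarith [weight_nonneg m α]
  have h1 : ∀ τ ∈ Set.Ioi (0 : ℝ), (∏ j, (m j : ℝ)) / Real.pi ^ n * (Real.exp (-τ) *
          ∏ j, (τ ^ (1 / (m j : ℝ)) * ((τ ^ (1 / (m j : ℝ)) * ‖z j‖ ^ 2) ^ α j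
            / Real.Gamma (((α j : ℝ) + 1) / m j))))
      = ((∏ j, (m j : ℝ)) / Real.pi ^ n * ∏ j, (‖z j‖ ^ (2 * α j)
          / Real.Gamma (((α j : ℝ) + 1) / m j))) * (Real.exp (-τ) * τ ^ (weight m α + 1 - 1)) := by
    intro τ hτ
    have hτ' : (0 : ℝ) < τ := hτ
    rw [add_sub_cancel_right, weight, Real.rpow_sum_of_pos hτ']
    have : ∀ j, τ ^ (1 / (m j : ℝ)) * ((τ ^ (1 / (m j : ℝ)) * ‖z j‖ ^ 2) ^ α j
            / Real.Gamma (((α j : ℝ) + 1) / m j)) = (‖z j‖ ^ (2 * α j)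
          / Real.Gamma (((α j : ℝ) + 1) / m j)) * τ ^ (((α j : ℝ) + 1) / m j) := by
      intro j
      rw [mul_pow, ← pow_mul, ← Real.rpow_mul_natCast hτ'.le,
        show ((α j : ℝ) + 1) / m j = 1 / (m j : ℝ) + 1 / (m j : ℝ) * α j by ring,
        Real.rpow_add hτ']
      ring
    simp only [this, Finset.prod_mul_distrib]
    ring
  rw [setIntegral_congr_fun measurableSet_Ioi h1, integral_const_mul, ← Real.Gamma_eq_integral hw,
    setIntegral_monomial hm, Finset.prod_mul_distrib, Finset.prod_div_distrib,
    Finset.prod_div_distrib, Finset.prod_const, Finset.card_univ, Fintype.card_fin]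
  have h2 : (∏ j, (m j : ℝ)) ≠ 0 := Finset.prod_ne_zero_iff.2 fun j _ => by
    have := hm j; positivity
  have h3 : (∏ j, Real.Gamma (((α j : ℝ) + 1) / m j)) ≠ 0 :=
    Finset.prod_ne_zero_iff.2 fun j _ => (hG j).ne'
  have h4 := (Real.Gamma_pos_of_pos hw).ne'
  field_simp

/-- All terms are nonnegative and their integrals are the summable kernel series, so sum and
integral may be exchanged. For fixed `τ` the multiple series factorises. -/
theorem kernel_eq_integral (hm : ∀ j, 1 ≤ m j) {K : (Fin n → ℂ) → ℝ}
    (hK : IsBergmanKernel (E m) K) {z : Fin n → ℂ} (hz : z ∈ E m) :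
    K z = (∏ j, (m j : ℝ)) / Real.pi ^ n *
      ∫ τ in Set.Ioi 0, mittagIntegrand m 0 Finset.univ (fun j => ‖z j‖ ^ 2) τ := by
  have hsum := hK.hasSum_monomial (isUnitReinhardt_E hm) hz
  let F : (Fin n → ℕ) → ℝ → ℝ := fun α τ => (∏ j, (m j : ℝ)) / Real.pi ^ n * (Real.exp (-τ) *
          ∏ j, (τ ^ (1 / (m j : ℝ)) * ((τ ^ (1 / (m j : ℝ)) * ‖z j‖ ^ 2) ^ α j
            / Real.Gamma (((α j : ℝ) + 1) / m j))))
  have hterm : ∀ α, (∏ j, ‖z j‖ ^ (2 * α j)) / (∫ w in E m, ∏ j, ‖w j‖ ^ (2 * α j))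
      = ∫ τ in Set.Ioi (0 : ℝ), F α τ := kernel_term_eq hm z
  have hF0 : ∀ α, ∀ τ ∈ Set.Ioi (0 : ℝ), 0 ≤ F α τ := by
    intro α τ hτ
    have hτ' : (0 : ℝ) < τ := hτ
    refine mul_nonneg (by positivity) (mul_nonneg (by positivity)
      (Finset.prod_nonneg fun j _ => mul_nonneg (by positivity) ?_))
    exact mittagRootReal_term_nonneg (hm j) (by positivity) (α j)
  have hhas : ∀ τ ∈ Set.Ioi (0 : ℝ), HasSum (fun α => F α τ) ((∏ j, (m j : ℝ)) / Real.pi ^ n *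
      mittagIntegrand m 0 Finset.univ (fun j => ‖z j‖ ^ 2) τ) := by
    intro τ hτ
    have hτ' : (0 : ℝ) < τ := hτ
    refine HasSum.mul_left _ ?_
    rw [mittagIntegrand, Real.rpow_zero, mul_one]
    refine HasSum.mul_left _ (hasSum_prod_pi_of_nonneg (u := fun j a => τ ^ (1 / (m j : ℝ)) *
      ((τ ^ (1 / (m j : ℝ)) * ‖z j‖ ^ 2) ^ a / Real.Gamma (((a : ℝ) + 1) / m j))) (fun j a => ?_)
      fun j => ?_)
    · exact mul_nonneg (by positivity) (mittagRootReal_term_nonneg (hm j) (by positivity) a)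
    · exact (summable_mittagRootReal (hm j) (by positivity)).hasSum.mul_left _
  have hmain := integrableOn_mittagIntegrand hm le_rfl Finset.univ (x := fun j => ‖z j‖ ^ 2)
    (fun j => by positivity) (by simp only [← pow_mul]; exact hz)
  have hFi : ∀ α, IntegrableOn (F α) (Set.Ioi 0) := by
    intro α
    refine (hmain.const_mul ((∏ j, (m j : ℝ)) / Real.pi ^ n)).mono' ?_ ?_
    · refine ContinuousOn.aestronglyMeasurable ?_ measurableSet_Ioi
      have hpow : ∀ b : ℝ, ContinuousOn (fun τ : ℝ => τ ^ b) (Set.Ioi 0) := fun b τ hτ =>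
        (Real.continuousAt_rpow_const τ b (Or.inl (ne_of_gt hτ))).continuousWithinAt
      refine continuousOn_const.mul (ContinuousOn.mul (by fun_prop)
        (continuousOn_finsetProd _ fun j _ => (hpow _).mul (ContinuousOn.div_const ?_ _)))
      exact ((hpow _).mul continuousOn_const).pow _
    · filter_upwards [ae_restrict_mem measurableSet_Ioi] with τ hτ
      rw [Real.norm_of_nonneg (hF0 α τ hτ)]
      exact le_hasSum (hhas τ hτ) α fun β _ => hF0 β τ hτ
  have hnorm : ∀ α, ∫ τ in Set.Ioi (0 : ℝ), ‖F α τ‖ = ∫ τ in Set.Ioi (0 : ℝ), F α τ := fun α =>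
    setIntegral_congr_fun measurableSet_Ioi fun τ hτ => Real.norm_of_nonneg (hF0 α τ hτ)
  simp only [hterm] at hsum
  have h := hasSum_integral_of_summable_integral_norm hFi (by
    simp only [hnorm]; exact hsum.summable)
  rw [hsum.unique h, ← integral_const_mul]
  exact setIntegral_congr_fun measurableSet_Ioi fun τ hτ => (hhas τ hτ).tsum_eq

end Ellipsoid

/-! ### Replacing factors by their main parts; analyticity of the remainder. -/

theorem norm_prod_sub_prod_le {ι : Type*} (S : Finset ι) {f g : ι → ℂ} {A : ι → ℝ} {ε : ℝ}
    (hε0 : 0 ≤ ε) (hε1 : ε ≤ 1) (hg : ∀ j, ‖g j‖ ≤ A j) (hfg : ∀ j, ‖f j - g j‖ ≤ ε * A j) :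
    ‖∏ j ∈ S, f j - ∏ j ∈ S, g j‖ ≤ ε * (2 ^ S.card * ∏ j ∈ S, A j) := by
  classical
  have hA : ∀ j, 0 ≤ A j := fun j => (norm_nonneg _).trans (hg j)
  have hf : ∀ j, ‖f j‖ ≤ 2 * A j := fun j => by
    have h1 := norm_add_le (f j - g j) (g j)
    rw [sub_add_cancel] at h1
    nlinarith [hfg j, hg j, hA j]
  have hprod : ∀ S : Finset ι, ‖∏ j ∈ S, f j‖ ≤ 2 ^ S.card * ∏ j ∈ S, A j := fun S => by
    rw [norm_prod, ← Finset.prod_const, ← Finset.prod_mul_distrib]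
    exact Finset.prod_le_prod (fun _ _ => norm_nonneg _) fun j _ => hf j
  -- The sharper constant `2 ^ card - 1` is what reproduces itself in the induction.
  suffices h : ‖∏ j ∈ S, f j - ∏ j ∈ S, g j‖ ≤ ε * ((2 ^ S.card - 1) * ∏ j ∈ S, A j) by
    refine h.trans ?_
    have : 0 ≤ ∏ j ∈ S, A j := Finset.prod_nonneg fun j _ => hA j
    gcongr
    linarith
  induction S using Finset.induction_on with
  | empty => simp
  | insert i S hi ih =>
    rw [Finset.prod_insert hi, Finset.prod_insert hi, Finset.prod_insert hi,
      Finset.card_insert_of_notMem hi]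
    have h1 : f i * ∏ j ∈ S, f j - g i * ∏ j ∈ S, g j
        = (f i - g i) * ∏ j ∈ S, f j + g i * (∏ j ∈ S, f j - ∏ j ∈ S, g j) := by ring
    rw [h1]
    refine (norm_add_le _ _).trans ?_
    rw [norm_mul, norm_mul]
    have h2 := mul_le_mul (hfg i) (hprod S) (norm_nonneg _) (mul_nonneg hε0 (hA i))
    have h3 := mul_le_mul (hg i) ih (norm_nonneg _) (hA i)
    refine (add_le_add h2 h3).trans (le_of_eq ?_)
    rw [pow_succ]
    ring

/-- For `y > 0` the error has rate `η`, and `‖x‖ ≥ y / 2` shows that this beats the rate `1 + η` by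
at least $(y/2)^m$. For `m = 1` the error is zero, so `y = 0` is allowed. -/
theorem mittagRoot_sub_main_local {m : ℕ} (hm : 1 ≤ m) {y : ℝ} (hy : 0 < y ∨ m = 1) :
    ∃ d : ℝ, 0 < d ∧ ∃ δ : ℝ, 0 < δ ∧ ∀ η : ℝ, 0 < η → ∃ C : ℝ, 0 < C ∧ ∀ (τ : ℝ) (x : ℂ), 0 < τ →
      ‖x - y‖ ≤ δ → ‖mittagRoot m (((τ ^ (1 / (m : ℝ)) : ℝ) : ℂ) * x)
        - mittagMain m (((τ ^ (1 / (m : ℝ)) : ℝ) : ℂ) * x)‖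
        ≤ C * (Real.exp ((1 + η) * (τ * ‖x‖ ^ m)) * Real.exp (-(d * τ))) := by
  rcases hy with hy | rfl
  · obtain ⟨κ, hκ, h⟩ := norm_mittagRoot_sub_main_le hm
    refine ⟨(y / 2) ^ m, by positivity, min (y / 2) (κ * y), by positivity, fun η hη => ?_⟩
    obtain ⟨C, hC0, hC⟩ := h η hη
    refine ⟨C, hC0, fun τ x hτ hx => ?_⟩
    have hρ : 0 < τ ^ (1 / (m : ℝ)) := by positivity
    have h1 := hC (τ ^ (1 / (m : ℝ)) * y) (((τ ^ (1 / (m : ℝ)) : ℝ) : ℂ) * x) (by positivity) (by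
      rw [Complex.ofReal_mul, ← mul_sub, norm_mul, Complex.norm_real, Real.norm_of_nonneg hρ.le]
      have := hx.trans (min_le_right _ _)
      nlinarith)
    rw [norm_rpow_smul_pow hm hτ] at h1
    refine h1.trans ?_
    rw [← Real.exp_add]
    have h2 : y / 2 ≤ ‖x‖ := by
      have h3 := norm_sub_norm_le (y : ℂ) x
      rw [Complex.norm_real, Real.norm_of_nonneg hy.le, norm_sub_rev] at h3
      linarith [hx.trans (min_le_left _ _)]
    have h4 : (y / 2) ^ m ≤ ‖x‖ ^ m := by gcongr
    gcongr
    nlinarith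
  · refine ⟨1, one_pos, 1, one_pos, fun η hη => ⟨1, one_pos, fun τ x hτ hx => ?_⟩⟩
    rw [mittagRoot_one, sub_self, norm_zero]
    positivity

section Laplace

variable {n : ℕ}

/-- The Mittag-Leffler functions, replaced by their main part outside `P`. -/
noncomputable def mittagPartial (m : Fin n → ℕ) (P : Finset (Fin n)) (j : Fin n) : ℂ → ℂ :=
  if j ∈ P then mittagRoot (m j) else mittagMain (m j)

theorem hasUnitType_mittagPartial {m : Fin n → ℕ} (hm : ∀ j, 1 ≤ m j) (P : Finset (Fin n))
    (j : Fin n) : HasUnitType (m j) (mittagPartial m P j) := by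
  unfold mittagPartial
  split_ifs
  · exact hasUnitType_mittagRoot (hm j)
  · exact hasUnitType_mittagMain (m j)

/-- Either integral alone need not converge beyond the boundary, but the difference has an integrand
smaller by a factor $e^{-d\tau}$, which leaves room on a full complex neighbourhood of the boundary
point. -/
theorem analyticAt_integral_mittag_sub {m : Fin n → ℕ} (hm : ∀ j, 1 ≤ m j) (P : Finset (Fin n))
    {y : Fin n → ℝ} (hy0 : ∀ j, 0 ≤ y j) (hy : ∑ j, y j ^ m j = 1)
    (hQ : ∀ j, j ∉ P → 0 < y j ∨ m j = 1) :
    AnalyticAt ℂ (fun x => ∫ τ in Set.Ioi 0,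
      (laplaceIntegrand m 0 Finset.univ (fun j => mittagRoot (m j)) x τ
        - laplaceIntegrand m 0 Finset.univ (mittagPartial m P) x τ)) (fun j => (y j : ℂ)) := by
  have hloc : ∀ j, ∃ d : ℝ, 0 < d ∧ ∃ δ : ℝ, 0 < δ ∧ ∀ η : ℝ, 0 < η → ∃ C : ℝ, 0 < C ∧
      ∀ (τ : ℝ) (x : ℂ), 0 < τ → ‖x - y j‖ ≤ δ →
        ‖mittagRoot (m j) (((τ ^ (1 / (m j : ℝ)) : ℝ) : ℂ) * x)
        - mittagPartial m P j (((τ ^ (1 / (m j : ℝ)) : ℝ) : ℂ) * x)‖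
        ≤ C * (Real.exp ((1 + η) * (τ * ‖x‖ ^ m j)) * Real.exp (-(d * τ))) := by
    intro j
    by_cases hj : j ∈ P
    · refine ⟨1, one_pos, 1, one_pos, fun η hη => ⟨1, one_pos, fun τ x hτ hx => ?_⟩⟩
      rw [mittagPartial, if_pos hj, sub_self, norm_zero]
      positivity
    · rw [mittagPartial, if_neg hj]
      exact mittagRoot_sub_main_local (hm j) (hQ j hj)
  choose d' hd' δ hδ hloc using hloc
  obtain ⟨d, hd, hd0⟩ : ∃ d : ℝ, (∀ j, d ≤ d' j) ∧ 0 < d := by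
    have : ∀ᶠ d : ℝ in 𝓝[>] 0, (∀ j, d ≤ d' j) ∧ 0 < d := by
      refine (eventually_all.2 fun j => ?_).and self_mem_nhdsWithin
      filter_upwards [Ioo_mem_nhdsGT (hd' j)] with d hd using hd.2.le
    exact this.exists
  -- At the boundary point the growth rate is `1 + d / 4`, hence below `1 + d / 2` nearby. Against
  -- the decay rate `1 + d` this leaves $e^{-d\tau/2}$.
  set η := d / 4 with hη
  have hη0 : 0 < η := by positivity
  choose C hC0 hC using fun j => hloc j η hη0
  choose C' hC'0 hC' using fun j => (hasUnitType_mittagPartial hm P j).2 η hη0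
  let U : Set (Fin n → ℂ) := {x | (∀ j, ‖x j - y j‖ < δ j) ∧ (1 + η) * ∑ j, ‖x j‖ ^ m j < 1 + d / 2}
  have hU : IsOpen U := by
    have h1 : IsOpen {x : Fin n → ℂ | ∀ j, ‖x j - y j‖ < δ j} := by
      simp only [Set.ofPred_forall]
      exact isOpen_iInter_of_finite fun j => isOpen_lt (by fun_prop) continuous_const
    have h2 : IsOpen {x : Fin n → ℂ | (1 + η) * ∑ j, ‖x j‖ ^ m j < 1 + d / 2} :=
      isOpen_lt (by fun_prop) continuous_const
    exact h1.inter h2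
  have hyU : (fun j => (y j : ℂ)) ∈ U := by
    refine ⟨fun j => by simpa using hδ j, ?_⟩
    simp only [Complex.norm_real, Real.norm_of_nonneg (hy0 _), hy]
    linarith
  have hrt : ∀ j, Differentiable ℂ (mittagRoot (m j)) := fun j => differentiable_mittagRoot (hm j)
  have hpt : ∀ j, Differentiable ℂ (mittagPartial m P j) := fun j =>
    (hasUnitType_mittagPartial hm P j).1
  have hb : 0 ≤ ∑ j, 1 / (m j : ℝ) := Finset.sum_nonneg fun j _ => by positivity
  refine analyticOnNhd_integral_of_dominated hU
    (fun x _ => ((continuousOn_laplaceIntegrand m 0 _ hrt x).sub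
      (continuousOn_laplaceIntegrand m 0 _ hpt x)).aestronglyMeasurable measurableSet_Ioi)
    (ae_of_all _ fun τ => ((differentiable_laplaceIntegrand m 0 _ hrt τ).sub
      (differentiable_laplaceIntegrand m 0 _ hpt τ)).differentiableOn) ?_
    ((integrableOn_rpow_mul_exp_neg_mul hb (half_pos hd0)).const_mul
      (2 ^ (Finset.univ : Finset (Fin n)).card * ∏ j, (C' j + C j))) _ hyU
  filter_upwards [ae_restrict_mem measurableSet_Ioi] with τ hτ x hx
  have hτ' : (0 : ℝ) < τ := hτ
  have key := norm_prod_sub_prod_le Finset.univ (ε := Real.exp (-(d * τ)))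
    (f := fun j => ((τ ^ (1 / (m j : ℝ)) : ℝ) : ℂ) *
      mittagRoot (m j) (((τ ^ (1 / (m j : ℝ)) : ℝ) : ℂ) * x j))
    (g := fun j => ((τ ^ (1 / (m j : ℝ)) : ℝ) : ℂ) *
      mittagPartial m P j (((τ ^ (1 / (m j : ℝ)) : ℝ) : ℂ) * x j))
    (A := fun j => τ ^ (1 / (m j : ℝ)) * ((C' j + C j) * Real.exp ((1 + η) * (τ * ‖x j‖ ^ m j))))
    (Real.exp_pos _).le (Real.exp_le_one_iff.2 (by nlinarith)) (fun j => ?_) (fun j => ?_)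
  · change ‖laplaceIntegrand m 0 Finset.univ (fun j => mittagRoot (m j)) x τ
      - laplaceIntegrand m 0 Finset.univ (mittagPartial m P) x τ‖ ≤ _
    unfold laplaceIntegrand
    rw [← mul_sub, norm_mul, Complex.norm_real, Real.norm_of_nonneg (by positivity), Real.rpow_zero,
      mul_one]
    refine (mul_le_mul_of_nonneg_left key (Real.exp_pos _).le).trans ?_
    rw [Finset.prod_mul_distrib, Finset.prod_mul_distrib, ← Real.exp_sum, Real.rpow_sum_of_pos hτ']
    have hexp : Real.exp (-τ) * Real.exp (-(d * τ))
        * Real.exp (∑ j, (1 + η) * (τ * ‖x j‖ ^ m j)) ≤ Real.exp (-(d / 2 * τ)) := by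
      rw [← Real.exp_add, ← Real.exp_add, ← Finset.mul_sum, ← Finset.mul_sum]
      gcongr
      nlinarith [hx.2]
    have hCC : 0 ≤ ∏ j, (C' j + C j) := Finset.prod_nonneg fun j _ => (add_pos (hC'0 j) (hC0 j)).le
    calc _ = (2 ^ (Finset.univ : Finset (Fin n)).card * ∏ j, (C' j + C j)) *
          ((∏ j, τ ^ (1 / (m j : ℝ))) * (Real.exp (-τ) * Real.exp (-(d * τ))
          * Real.exp (∑ j, (1 + η) * (τ * ‖x j‖ ^ m j)))) := by ring
      _ ≤ _ := by gcongr
  · have h2 := hC' j (((τ ^ (1 / (m j : ℝ)) : ℝ) : ℂ) * x j)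
    rw [norm_rpow_smul_pow (hm j) hτ'] at h2
    rw [norm_mul, Complex.norm_real, Real.norm_of_nonneg (by positivity)]
    have := (hC0 j).le
    have := (hC'0 j).le
    gcongr
    refine h2.trans ?_
    gcongr
    linarith
  · have h2 := hC j τ (x j) hτ' (hx.1 j).le
    rw [← mul_sub, norm_mul, Complex.norm_real, Real.norm_of_nonneg (by positivity)]
    have h3 := (hC0 j).le
    have h4 := (hC'0 j).le
    have h5 : Real.exp (-(d' j * τ)) ≤ Real.exp (-(d * τ)) := by
      gcongr
      exact hd j
    calc _ ≤ τ ^ (1 / (m j : ℝ)) *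
          (C j * (Real.exp ((1 + η) * (τ * ‖x j‖ ^ m j)) * Real.exp (-(d' j * τ)))) := by gcongr
      _ ≤ τ ^ (1 / (m j : ℝ)) * ((C' j + C j) *
          (Real.exp ((1 + η) * (τ * ‖x j‖ ^ m j)) * Real.exp (-(d * τ)))) := by
        gcongr
        linarith
      _ = _ := by ring

theorem rpow_mul_mittagMain {m : ℕ} (hm : 1 ≤ m) {τ : ℝ} (hτ : 0 < τ) (x : ℝ) :
    ((τ ^ (1 / (m : ℝ)) : ℝ) : ℂ) * mittagMain m (((τ ^ (1 / (m : ℝ)) : ℝ) : ℂ) * x)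
      = ((m * x ^ (m - 1) * (τ * Real.exp (τ * x ^ m)) : ℝ) : ℂ) := by
  have h1 : (τ ^ (1 / (m : ℝ))) ^ m = τ := by
    rw [← Real.rpow_natCast, ← Real.rpow_mul hτ.le, one_div, inv_mul_cancel₀ (by positivity),
      Real.rpow_one]
  rw [mittagMain, ← Complex.ofReal_mul, ← Complex.ofReal_pow, ← Complex.ofReal_pow,
    ← Complex.ofReal_exp, ← Complex.ofReal_natCast, ← Complex.ofReal_mul, ← Complex.ofReal_mul,
    ← Complex.ofReal_mul]
  congr 1
  rw [mul_pow, mul_pow, h1]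
  calc _ = m * x ^ (m - 1) * ((τ ^ (1 / (m : ℝ))) ^ (m - 1 + 1) * Real.exp (τ * x ^ m)) := by ring
    _ = _ := by rw [Nat.sub_add_cancel hm, h1]

/-- Each factor outside `P` contributes $\tau e^{\tau x_j^{m_j}}$, so the exponentials combine to
$e^{-A\tau}$ and the powers to $\tau^{|P^c|}$. The substitution $\tau\mapsto\tau/A$ then moves `A`
into the arguments as $x_j/A^{1/m_j}$; the `+ 1` in the exponent comes from $d\tau$. -/
theorem integral_mittagPartial {m : Fin n → ℕ} (hm : ∀ j, 1 ≤ m j) (P : Finset (Fin n))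
    {x y : Fin n → ℝ} {A : ℝ} (hA : 0 < A) (hAx : A = 1 - ∑ j ∈ Pᶜ, x j ^ m j)
    (hy : ∀ j ∈ P, y j = x j / A ^ (1 / (m j : ℝ))) :
    ∫ τ in Set.Ioi 0, laplaceIntegrand m 0 Finset.univ (mittagPartial m P) (fun j => (x j : ℂ)) τ
      = (((∏ j ∈ Pᶜ, (m j * x j ^ (m j - 1))) *
        (A ^ (-(Pᶜ.card + ∑ j ∈ P, 1 / (m j : ℝ) + 1)) *
          ∫ τ in Set.Ioi 0, mittagIntegrand m Pᶜ.card P y τ) : ℝ) : ℂ) := by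
  have hpt : ∀ τ ∈ Set.Ioi (0 : ℝ),
      laplaceIntegrand m 0 Finset.univ (mittagPartial m P) (fun j => (x j : ℂ)) τ
        = (((∏ j ∈ Pᶜ, (m j * x j ^ (m j - 1))) *
          (A ^ (-(Pᶜ.card + ∑ j ∈ P, 1 / (m j : ℝ))) * mittagIntegrand m Pᶜ.card P y (A * τ)) : ℝ) : ℂ) := by
    intro τ hτ
    have hτ' : (0 : ℝ) < τ := hτ
    rw [laplaceIntegrand, Real.rpow_zero, mul_one, ← Finset.prod_mul_prod_compl P]
    have h1 : ∏ j ∈ P, (((τ ^ (1 / (m j : ℝ)) : ℝ) : ℂ) *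
        mittagPartial m P j (((τ ^ (1 / (m j : ℝ)) : ℝ) : ℂ) * (x j : ℂ)))
        = ((∏ j ∈ P, (τ ^ (1 / (m j : ℝ)) * mittagRootReal (m j) (τ ^ (1 / (m j : ℝ)) * x j)) : ℝ) : ℂ) := by
      rw [Complex.ofReal_prod]
      refine Finset.prod_congr rfl fun j hj => ?_
      rw [mittagPartial, if_pos hj, ← Complex.ofReal_mul, mittagRoot_ofReal, ← Complex.ofReal_mul]
    have h2 : ∏ j ∈ Pᶜ, (((τ ^ (1 / (m j : ℝ)) : ℝ) : ℂ) *
        mittagPartial m P j (((τ ^ (1 / (m j : ℝ)) : ℝ) : ℂ) * (x j : ℂ)))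
        = ((∏ j ∈ Pᶜ, (m j * x j ^ (m j - 1) * (τ * Real.exp (τ * x j ^ m j))) : ℝ) : ℂ) := by
      rw [Complex.ofReal_prod]
      refine Finset.prod_congr rfl fun j hj => ?_
      rw [mittagPartial, if_neg (Finset.mem_compl.1 hj), rpow_mul_mittagMain (hm j) hτ']
    have h3 : ∏ j ∈ P, ((A * τ) ^ (1 / (m j : ℝ)) * mittagRootReal (m j) ((A * τ) ^ (1 / (m j : ℝ)) * y j))
        = A ^ (∑ j ∈ P, 1 / (m j : ℝ)) *
          ∏ j ∈ P, (τ ^ (1 / (m j : ℝ)) * mittagRootReal (m j) (τ ^ (1 / (m j : ℝ)) * x j)) := by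
      rw [Real.rpow_sum_of_pos hA, ← Finset.prod_mul_distrib]
      refine Finset.prod_congr rfl fun j hj => ?_
      have hA' : A ^ (1 / (m j : ℝ)) ≠ 0 := (Real.rpow_pos_of_pos hA _).ne'
      rw [hy j hj, Real.mul_rpow hA.le hτ'.le, mul_assoc]
      congr 3
      field_simp
    rw [h1, h2, ← Complex.ofReal_mul, ← Complex.ofReal_mul]
    congr 1
    rw [mittagIntegrand, h3, Finset.prod_mul_distrib (s := Pᶜ), Finset.prod_mul_distrib (s := Pᶜ),
      Finset.prod_mul_distrib (s := Pᶜ), Finset.prod_const,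
      ← Real.exp_sum, ← Finset.mul_sum, Real.rpow_natCast, mul_pow, Real.rpow_neg hA.le,
      Real.rpow_add hA, Real.rpow_natCast]
    have h4 : Real.exp (-(A * τ)) = Real.exp (-τ) * Real.exp (τ * ∑ j ∈ Pᶜ, x j ^ m j) := by
      rw [← Real.exp_add, hAx]; ring_nf
    have h5 : A ^ (∑ j ∈ P, 1 / (m j : ℝ)) ≠ 0 := (Real.rpow_pos_of_pos hA _).ne'
    rw [h4]
    field_simp
  rw [setIntegral_congr_fun measurableSet_Ioi hpt, integral_complex_ofReal, integral_const_mul,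
    integral_const_mul, integral_comp_mul_left_Ioi (fun τ => mittagIntegrand m Pᶜ.card P y τ) 0 hA,
    mul_zero, smul_eq_mul]
  have h6 : A ^ (-(Pᶜ.card + ∑ j ∈ P, 1 / (m j : ℝ) + 1))
      = A ^ (-(Pᶜ.card + ∑ j ∈ P, 1 / (m j : ℝ))) * A⁻¹ := by
    rw [neg_add (_ + _) (1 : ℝ), Real.rpow_add hA, Real.rpow_neg_one]
  rw [h6]
  congr 1
  ring

end Laplace

/-! ### The angular factor and the decomposition of the kernel. -/

namespace Ellipsoid

variable {n : ℕ} {m : Fin n → ℕ}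

theorem Q_eq_compl_P (m : Fin n → ℕ) (z₀ : Fin n → ℂ) : Q m z₀ = (P m z₀)ᶜ := by
  ext j
  simp only [Q, P, Finset.mem_filter, Finset.mem_univ, true_and, Finset.mem_compl]
  tauto

theorem sum_eq_one_of_mem_frontier {z₀ : Fin n → ℂ} (hz₀ : z₀ ∈ frontier (E m)) :
    ∑ j, ‖z₀ j‖ ^ (2 * m j) = 1 := by
  rw [(isOpen_E m).frontier_eq] at hz₀
  refine le_antisymm ?_ (not_lt.1 hz₀.2)
  have hcl : IsClosed {z : Fin n → ℂ | ∑ j, ‖z j‖ ^ (2 * m j) ≤ 1} :=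
    isClosed_le (by fun_prop) continuous_const
  have hsub : E m ⊆ {z : Fin n → ℂ | ∑ j, ‖z j‖ ^ (2 * m j) ≤ 1} := by
    intro z hz
    have hz' : ∑ j, ‖z j‖ ^ (2 * m j) < 1 := hz
    exact hz'.le
  exact closure_minimal hsub hcl hz₀.1

/-- Extension by zero of a vector indexed by a finite set. -/
def extendZero (P : Finset (Fin n)) (t : P → ℝ) (j : Fin n) : ℝ :=
  if h : j ∈ P then t ⟨j, h⟩ else 0

theorem extendZero_coe (P : Finset (Fin n)) (t : P → ℝ) (j : P) : extendZero P t j = t j := by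
  simp [extendZero]

theorem sum_extendZero_sq_pow (P : Finset (Fin n)) (t : P → ℝ) :
    ∑ j ∈ P, (extendZero P t j ^ 2) ^ m j = ∑ j, t j ^ (2 * m j) := by
  rw [← Finset.sum_coe_sort]
  simp [extendZero_coe, pow_mul]

/-- The angular factor of the leading term of the Bergman kernel. -/
noncomputable def angularFactor (m : Fin n → ℕ) (P : Finset (Fin n)) (t : P → ℝ) : ℝ :=
  (∏ j ∈ P, (m j : ℝ)) / n.factorial *
    ((1 - ∑ j, t j ^ (2 * m j)) ^ (Pᶜ.card + ∑ j ∈ P, 1 / (m j : ℝ) + 1) *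
      ∫ τ in Set.Ioi 0, mittagIntegrand m Pᶜ.card P (fun j => extendZero P t j ^ 2) τ)

/-- An exact identity on all of `E m`: inside the domain both integrals converge separately, so the
partial integral is added and subtracted. -/
theorem kernel_eq_angularFactor_add (hm : ∀ j, 1 ≤ m j) {K : (Fin n → ℂ) → ℝ}
    (hK : IsBergmanKernel (E m) K) (z₀ : Fin n → ℂ) {z : Fin n → ℂ} (hz : z ∈ E m) :
    K z = (n.factorial : ℝ) / Real.pi ^ n
        * (∏ j ∈ Q m z₀, (m j : ℝ) ^ 2 * ‖z j‖ ^ (2 * m j - 2))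
        * (angularFactor m (P m z₀) (t m z₀ z) / r m z ^ exponent m z₀)
      + (∏ j, (m j : ℝ)) / Real.pi ^ n * (∫ τ in Set.Ioi 0,
        (laplaceIntegrand m 0 Finset.univ (fun j => mittagRoot (m j)) (fun j => ((‖z j‖ ^ 2 : ℝ) : ℂ)) τ
          - laplaceIntegrand m 0 Finset.univ (mittagPartial m (P m z₀))
            (fun j => ((‖z j‖ ^ 2 : ℝ) : ℂ)) τ)).re := by
  have hz' : ∑ j, ‖z j‖ ^ (2 * m j) < 1 := hz
  have hzr : 0 < r m z := by unfold r; linarith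
  have hexp : exponent m z₀ = (P m z₀)ᶜ.card + ∑ j ∈ P m z₀, 1 / (m j : ℝ) + 1 := by
    rw [exponent, Q_eq_compl_P]
  have ht : t m z₀ z = fun j : P m z₀ => (‖z j‖ ^ (2 * m j) /
      (1 - ∑ i ∈ (P m z₀)ᶜ, (‖z i‖ ^ 2) ^ m i)) ^ (1 / (2 * (m j : ℝ))) := by
    unfold t
    simp only [Q_eq_compl_P, pow_mul]
  rw [hexp, ht, Q_eq_compl_P]
  generalize P m z₀ = P
  set A := 1 - ∑ i ∈ Pᶜ, (‖z i‖ ^ 2) ^ m i with hA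
  have hsplit : r m z = A - ∑ j ∈ P, ‖z j‖ ^ (2 * m j) := by
    rw [r, hA, ← Finset.sum_add_sum_compl P]
    simp only [pow_mul]
    ring
  have hA0 : 0 < A := by
    have : 0 ≤ ∑ j ∈ P, ‖z j‖ ^ (2 * m j) := Finset.sum_nonneg fun j _ => by positivity
    linarith
  set s : P → ℝ := fun j => (‖z j‖ ^ (2 * m j) / A) ^ (1 / (2 * (m j : ℝ))) with hs
  have hs0 : ∀ j, 0 ≤ s j := fun j => Real.rpow_nonneg (by positivity) _
  have hspow : ∀ j : P, s j ^ (2 * m j) = ‖z j‖ ^ (2 * m j) / A := fun j => by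
    have hmj := hm j
    rw [hs, ← Real.rpow_natCast, ← Real.rpow_mul (by positivity)]
    push_cast
    rw [one_div, inv_mul_cancel₀ (by positivity), Real.rpow_one]
  -- This relation exchanges the power of `A` for a power of `r`, the quotient being the prefactor
  -- in `angularFactor`.
  have hsum : 1 - ∑ j, s j ^ (2 * m j) = r m z / A := by
    simp only [hspow]
    rw [Finset.sum_coe_sort P (fun j => ‖z j‖ ^ (2 * m j) / A), ← Finset.sum_div, hsplit]
    field_simp
  have hsq : ∀ j ∈ P, extendZero P s j ^ 2 = ‖z j‖ ^ 2 / A ^ (1 / (m j : ℝ)) := fun j hj => by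
    have hmj := hm j
    have hA1 : (A ^ (1 / (m j : ℝ))) ^ m j = A := by
      rw [← Real.rpow_natCast, ← Real.rpow_mul hA0.le, one_div, inv_mul_cancel₀ (by positivity),
        Real.rpow_one]
    refine (pow_left_inj₀ (sq_nonneg _) (by positivity) (show m j ≠ 0 by omega)).1 ?_
    rw [div_pow, hA1, ← pow_mul, ← pow_mul]
    exact (congrArg (· ^ (2 * m j)) (extendZero_coe P s ⟨j, hj⟩)).trans (hspow ⟨j, hj⟩)
  have hint := integral_mittagPartial hm P (x := fun j => ‖z j‖ ^ 2)
    (y := fun j => extendZero P s j ^ 2) hA0 hA hsq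
  have hbd : ∑ j ∈ Finset.univ, ‖((‖z j‖ ^ 2 : ℝ) : ℂ)‖ ^ m j < 1 := by
    simpa [abs_of_nonneg, pow_mul] using hz'
  rw [integral_sub (integrableOn_laplaceIntegrand hm le_rfl _
      (fun j => hasUnitType_mittagRoot (hm j)) hbd)
    (integrableOn_laplaceIntegrand hm le_rfl _ (hasUnitType_mittagPartial hm P) hbd), hint,
    integral_laplaceIntegrand_mittagRoot, ← Complex.ofReal_sub, Complex.ofReal_re,
    kernel_eq_integral hm hK hz, angularFactor, hsum, Real.div_rpow hzr.le hA0.le,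
    Real.rpow_neg hA0.le]
  have hprod : ∏ j ∈ Pᶜ, (m j : ℝ) ^ 2 * ‖z j‖ ^ (2 * m j - 2)
      = (∏ j ∈ Pᶜ, (m j : ℝ)) * ∏ j ∈ Pᶜ, (m j * (‖z j‖ ^ 2) ^ (m j - 1)) := by
    rw [← Finset.prod_mul_distrib]
    refine Finset.prod_congr rfl fun j _ => ?_
    rw [← pow_mul, Nat.mul_sub, mul_one]
    ring
  rw [hprod, ← Finset.prod_mul_prod_compl P (fun j => (m j : ℝ))]
  have h1 := (Real.rpow_pos_of_pos hzr (Pᶜ.card + ∑ j ∈ P, 1 / (m j : ℝ) + 1)).ne'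
  have h2 := (Real.rpow_pos_of_pos hA0 (Pᶜ.card + ∑ j ∈ P, 1 / (m j : ℝ) + 1)).ne'
  have h3 := Real.pi_pos.ne'
  have h4 : (n.factorial : ℝ) ≠ 0 := by positivity
  field_simp
  ring

theorem analyticAt_ofReal_norm_sq {n : ℕ} (z₀ : Fin n → ℂ) :
    AnalyticAt ℝ (fun (z : Fin n → ℂ) (j : Fin n) => ((‖z j‖ ^ 2 : ℝ) : ℂ)) z₀ := by
  refine analyticAt_pi_iff.2 fun j => ?_
  have h1 : (fun z : Fin n → ℂ => ((‖z j‖ ^ 2 : ℝ) : ℂ))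
      = fun z => Complex.ofRealCLM (Complex.reCLM (z j) ^ 2 + Complex.imCLM (z j) ^ 2) := by
    ext z
    rw [← Complex.normSq_eq_norm_sq, Complex.normSq_apply, ← sq, ← sq]
    rfl
  rw [h1]
  have hp : AnalyticAt ℝ (fun z : Fin n → ℂ => z j) z₀ :=
    (ContinuousLinearMap.proj (R := ℝ) (φ := fun _ : Fin n => ℂ) j).analyticAt z₀
  have hre : AnalyticAt ℝ (fun z : Fin n → ℂ => Complex.reCLM (z j)) z₀ :=
    (Complex.reCLM.analyticAt _).comp_of_eq hp rfl
  have him : AnalyticAt ℝ (fun z : Fin n → ℂ => Complex.imCLM (z j)) z₀ :=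
    (Complex.imCLM.analyticAt _).comp_of_eq hp rfl
  exact (Complex.ofRealCLM.analyticAt _).comp ((hre.pow 2).add (him.pow 2))

/-- The remainder is holomorphic in the variables $|z_j|^2$, which are real polynomials in the
coordinates. Being outside `P` is exactly the alternative required by
`analyticAt_integral_mittag_sub`. -/
theorem analyticAt_kernel_remainder (hm : ∀ j, 1 ≤ m j) {z₀ : Fin n → ℂ}
    (hz₀ : z₀ ∈ frontier (E m)) :
    AnalyticAt ℝ (fun z : Fin n → ℂ => (∏ j, (m j : ℝ)) / Real.pi ^ n * (∫ τ in Set.Ioi 0,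
        (laplaceIntegrand m 0 Finset.univ (fun j => mittagRoot (m j)) (fun j => ((‖z j‖ ^ 2 : ℝ) : ℂ)) τ
          - laplaceIntegrand m 0 Finset.univ (mittagPartial m (P m z₀))
            (fun j => ((‖z j‖ ^ 2 : ℝ) : ℂ)) τ)).re) z₀ := by
  have h := analyticAt_integral_mittag_sub hm (P m z₀) (y := fun j => ‖z₀ j‖ ^ 2)
    (fun j => by positivity) (by simpa [pow_mul] using sum_eq_one_of_mem_frontier hz₀) (fun j hj => by
      simp only [P, Finset.mem_filter, Finset.mem_univ, true_and, not_and_or, not_not] at hj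
      refine hj.imp_left fun h => by have := norm_pos_iff.2 h; positivity)
  have h2 := (h.restrictScalars (𝕜 := ℝ)).comp_of_eq (analyticAt_ofReal_norm_sq z₀) rfl
  exact analyticAt_const.mul ((Complex.reCLM.analyticAt _).comp h2)

/-- The integral depends on `t` only through the squares $t_j^2$, so negative coordinates do no harm
and the domain is an open neighbourhood of `Δ`. -/
theorem analyticOnNhd_angularFactor (hm : ∀ j, 1 ≤ m j) (P : Finset (Fin n)) :
    AnalyticOnNhd ℝ (angularFactor m P) {t | ∑ j, t j ^ (2 * m j) < 1} := by
  intro t ht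
  have ht' : ∑ j, t j ^ (2 * m j) < 1 := ht
  have hp : ∀ j : P, AnalyticAt ℝ (fun t : P → ℝ => t j) t := fun j =>
    (ContinuousLinearMap.proj (R := ℝ) (φ := fun _ : P => ℝ) j).analyticAt t
  have h1 : AnalyticAt ℝ (fun t : P → ℝ => 1 - ∑ j, t j ^ (2 * m j)) t :=
    analyticAt_const.sub (Finset.analyticAt_fun_sum _ fun j _ => (hp j).pow _)
  have h2 : AnalyticAt ℝ (fun (t : P → ℝ) (j : Fin n) => ((extendZero P t j ^ 2 : ℝ) : ℂ)) t := by
    refine analyticAt_pi_iff.2 fun j => ?_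
    have h3 : AnalyticAt ℝ (fun t : P → ℝ => extendZero P t j) t := by
      by_cases hj : j ∈ P
      · simpa only [extendZero, hj, dif_pos] using hp ⟨j, hj⟩
      · simpa only [extendZero, hj, dif_neg, not_false_eq_true] using analyticAt_const
    exact (Complex.ofRealCLM.analyticAt _).comp (h3.pow 2)
  have h4 := analyticOnNhd_integral_laplaceIntegrand hm (Nat.cast_nonneg (Pᶜ.card)) P
    (fun j => hasUnitType_mittagRoot (hm j)) (fun j => ((extendZero P t j ^ 2 : ℝ) : ℂ)) (by
      have := sum_extendZero_sq_pow (m := m) P t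
      simpa [this] using ht')
  have h6 : AnalyticAt ℝ (fun t : P → ℝ =>
      (1 - ∑ j, t j ^ (2 * m j)) ^ (Pᶜ.card + ∑ j ∈ P, 1 / (m j : ℝ) + 1)) t := by
    have hpos : 0 < 1 - ∑ j, t j ^ (2 * m j) := by linarith
    have hlog : AnalyticAt ℝ (fun t : P → ℝ => Real.log (1 - ∑ j, t j ^ (2 * m j))) t :=
      (analyticAt_log hpos).comp_of_eq h1 rfl
    refine (analyticAt_rexp.comp_of_eq (hlog.mul
      (analyticAt_const (v := Pᶜ.card + ∑ j ∈ P, 1 / (m j : ℝ) + 1))) rfl).congr ?_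
    filter_upwards [h1.continuousAt.eventually_const_lt hpos] with s hs
    exact (Real.rpow_def_of_pos hs _).symm
  have h5 := (Complex.reCLM.analyticAt _).comp ((h4.restrictScalars (𝕜 := ℝ)).comp_of_eq h2 rfl)
  refine analyticAt_const.mul (h6.mul (h5.congr ?_))
  filter_upwards with t
  simp only [Function.comp_def, integral_laplaceIntegrand_mittagRoot, Complex.reCLM_apply,
    Complex.ofReal_re]

end Ellipsoid

/-! ### Normalisation, positivity and blow-up of the angular factor. -/

/-- The factor `i` gets the sharp bound with $x_i^{m_i-1}$, the others the bound by $c\,e^{x^m}$.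
Thus `i` contributes a full power of `τ` instead of $\tau^{1/m_i}$, and this surplus causes the
blow-up. -/
theorem exists_le_mittagIntegrand {n : ℕ} {m : Fin n → ℕ} (hm : ∀ j, 1 ≤ m j) (a : ℝ)
    {P : Finset (Fin n)} {i : Fin n} (hi : i ∈ P) :
    ∃ c : ℝ, 0 < c ∧ ∀ x : Fin n → ℝ, (∀ j, 0 ≤ x j) → ∀ τ : ℝ, 0 < τ →
      c * x i ^ (m i - 1) * (τ ^ (a + ∑ j ∈ P, 1 / (m j : ℝ) + 1 - 1 / m i)
        * Real.exp (-((1 - ∑ j ∈ P, x j ^ m j) * τ))) ≤ mittagIntegrand m a P x τ := by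
  choose c hc0 hc using fun j => exists_exp_le_mittagRootReal (hm j)
  refine ⟨∏ j ∈ P.erase i, c j, Finset.prod_pos fun j _ => hc0 j, fun x hx τ hτ => ?_⟩
  have hpow : ∀ j, (τ ^ (1 / (m j : ℝ)) * x j) ^ m j = τ * x j ^ m j := fun j => by
    have hmj := hm j
    rw [mul_pow, ← Real.rpow_natCast (τ ^ _), ← Real.rpow_mul hτ.le, one_div,
      inv_mul_cancel₀ (by positivity), Real.rpow_one]
  have h1 : ∏ j ∈ P.erase i, (τ ^ (1 / (m j : ℝ)) * (c j * Real.exp (τ * x j ^ m j)))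
      ≤ ∏ j ∈ P.erase i, (τ ^ (1 / (m j : ℝ)) * mittagRootReal (m j) (τ ^ (1 / (m j : ℝ)) * x j)) := by
    refine Finset.prod_le_prod (fun j _ => ?_) fun j _ => ?_
    · have := hc0 j
      positivity
    · have := hc j (τ ^ (1 / (m j : ℝ)) * x j) (mul_nonneg (by positivity) (hx j))
      rw [hpow] at this
      gcongr
  have h2 : τ * x i ^ (m i - 1) * Real.exp (τ * x i ^ m i)
      ≤ τ ^ (1 / (m i : ℝ)) * mittagRootReal (m i) (τ ^ (1 / (m i : ℝ)) * x i) := by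
    have := pow_mul_exp_le_mittagRootReal (hm i) (x := τ ^ (1 / (m i : ℝ)) * x i)
      (mul_nonneg (by positivity) (hx i))
    rw [hpow] at this
    refine le_trans (le_of_eq ?_) (mul_le_mul_of_nonneg_left this (by positivity))
    have h3 : (τ ^ (1 / (m i : ℝ))) ^ (m i - 1 + 1) = τ := by
      have hmi := hm i
      rw [Nat.sub_add_cancel hmi, ← Real.rpow_natCast, ← Real.rpow_mul hτ.le, one_div,
        inv_mul_cancel₀ (by positivity), Real.rpow_one]
    rw [mul_pow]
    calc _ = (τ ^ (1 / (m i : ℝ))) ^ (m i - 1 + 1) * x i ^ (m i - 1) * Real.exp (τ * x i ^ m i) := by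
          rw [h3]
      _ = _ := by ring
  rw [mittagIntegrand, ← Finset.mul_prod_erase P _ hi]
  have hprod0 : 0 ≤ ∏ j ∈ P.erase i, (τ ^ (1 / (m j : ℝ)) * (c j * Real.exp (τ * x j ^ m j))) :=
    Finset.prod_nonneg fun j _ => by have := hc0 j; positivity
  have hx_i := hx i
  refine le_trans (le_of_eq ?_) (mul_le_mul_of_nonneg_left
    (mul_le_mul h2 h1 hprod0 (le_trans (by positivity) h2)) (by positivity))
  rw [Finset.prod_mul_distrib, Finset.prod_mul_distrib, ← Real.exp_sum, ← Real.rpow_sum_of_pos hτ,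
    ← Finset.mul_sum]
  have h4 : τ ^ (a + ∑ j ∈ P, 1 / (m j : ℝ) + 1 - 1 / m i)
      = τ ^ a * τ ^ (∑ j ∈ P.erase i, 1 / (m j : ℝ)) * τ := by
    rw [← Finset.add_sum_erase P _ hi, ← Real.rpow_add hτ, ← Real.rpow_add_one hτ.ne']
    congr 1
    ring
  have h5 : Real.exp (-((1 - ∑ j ∈ P, x j ^ m j) * τ))
      = Real.exp (-τ) * Real.exp (τ * x i ^ m i) * Real.exp (τ * ∑ j ∈ P.erase i, x j ^ m j) := by
    rw [← Finset.add_sum_erase P _ hi, ← Real.exp_add, ← Real.exp_add]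
    ring_nf
  rw [h4, h5]
  ring

namespace Ellipsoid

variable {n : ℕ} {m : Fin n → ℕ}

/-- The remaining integral is $\int e^{-\tau}\tau^n d\tau=n!$, which explains the factor `1 / n!` in
`angularFactor`. -/
theorem angularFactor_of_eq_empty {P : Finset (Fin n)} (hP : P = ∅) (t : P → ℝ) :
    angularFactor m P t = 1 := by
  subst hP
  have h : ∫ τ in Set.Ioi (0 : ℝ), Real.exp (-τ) * τ ^ n = n.factorial := by
    rw [← Real.Gamma_nat_eq_factorial, Real.Gamma_eq_integral (by positivity)]
    simp
  have h' : (n.factorial : ℝ) ≠ 0 := by positivity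
  simp [angularFactor, mittagIntegrand, h, h']

theorem integrableOn_mittagIntegrand_extendZero (hm : ∀ j, 1 ≤ m j) {P : Finset (Fin n)} {t : P → ℝ}
    (ht : ∑ j, t j ^ (2 * m j) < 1) :
    IntegrableOn (mittagIntegrand m Pᶜ.card P (fun j => extendZero P t j ^ 2)) (Set.Ioi 0) :=
  integrableOn_mittagIntegrand hm (Nat.cast_nonneg _) P (fun _ => sq_nonneg _)
    ((sum_extendZero_sq_pow P t).trans_lt ht)

theorem angularFactor_pos (hm : ∀ j, 1 ≤ m j) {P : Finset (Fin n)} {t : P → ℝ}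
    (ht : ∑ j, t j ^ (2 * m j) < 1) : 0 < angularFactor m P t := by
  have h0 : 0 < ∏ j ∈ P, (m j : ℝ) :=
    Finset.prod_pos fun j _ => Nat.cast_pos.2 (hm j)
  have h1 : 0 < 1 - ∑ j, t j ^ (2 * m j) := by linarith
  have hpos : ∀ τ ∈ Set.Ioi (0 : ℝ),
      0 < mittagIntegrand m Pᶜ.card P (fun j => extendZero P t j ^ 2) τ := fun τ hτ =>
    mittagIntegrand_pos hm _ P (fun _ => sq_nonneg _) hτ
  have hsupp : Set.Ioi 0 ⊆
      Function.support (mittagIntegrand m Pᶜ.card P fun j => extendZero P t j ^ 2) :=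
    fun τ hτ => (hpos τ hτ).ne'
  have h2 : 0 < ∫ τ in Set.Ioi 0, mittagIntegrand m Pᶜ.card P (fun j => extendZero P t j ^ 2) τ := by
    rw [setIntegral_pos_iff_support_of_nonneg_ae
      ((ae_restrict_mem measurableSet_Ioi).mono fun τ hτ => (hpos τ hτ).le)
      (integrableOn_mittagIntegrand_extendZero hm ht),
      Set.inter_eq_right.2 hsupp]
    simp
  unfold angularFactor
  positivity

/-- With $s=1-\sum t_j^{2m_j}$ the lower bound for the integrand integrates to a multiple of
$s^{-(b+1)}$, where $b=N-1/m_i$, against the prefactor $s^N$; the net exponent is $-(1-1/m_i)$. -/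
theorem exists_le_angularFactor (hm : ∀ j, 1 ≤ m j) {P : Finset (Fin n)} (i : P) :
    ∃ c : ℝ, 0 < c ∧ ∀ t : P → ℝ, ∑ j, t j ^ (2 * m j) < 1 →
      c * (t i ^ 2) ^ (m i - 1) * (1 - ∑ j, t j ^ (2 * m j)) ^ (-(1 - 1 / (m i : ℝ)))
        ≤ angularFactor m P t := by
  obtain ⟨c, hc0, hc⟩ := exists_le_mittagIntegrand hm (Pᶜ.card : ℝ) i.2
  have h0 : 0 < ∏ j ∈ P, (m j : ℝ) := Finset.prod_pos fun j _ => Nat.cast_pos.2 (hm j)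
  set N : ℝ := Pᶜ.card + ∑ j ∈ P, 1 / (m j : ℝ) + 1 with hN
  have hmi : 1 / (m i : ℝ) ≤ 1 := by
    rw [div_le_one (by have := hm i; positivity)]
    exact_mod_cast hm i
  have hsum : 0 ≤ ∑ j ∈ P, 1 / (m j : ℝ) := Finset.sum_nonneg fun j _ => by positivity
  have hcard : (0 : ℝ) ≤ Pᶜ.card := Nat.cast_nonneg _
  set b : ℝ := N - 1 / m i with hb
  have hb0 : 0 ≤ b := by linarith
  have hΓ : 0 < Real.Gamma (b + 1) := Real.Gamma_pos_of_pos (by linarith)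
  refine ⟨(∏ j ∈ P, (m j : ℝ)) / n.factorial * (c * Real.Gamma (b + 1)), by positivity,
    fun t ht => ?_⟩
  set s := 1 - ∑ j, t j ^ (2 * m j) with hs
  have hs0 : 0 < s := by linarith
  have hint : c * (t i ^ 2) ^ (m i - 1) * ((1 / s) ^ (b + 1) * Real.Gamma (b + 1))
      ≤ ∫ τ in Set.Ioi 0, mittagIntegrand m Pᶜ.card P (fun j => extendZero P t j ^ 2) τ := by
    rw [← Real.integral_rpow_mul_exp_neg_mul_Ioi (by linarith) hs0, ← integral_const_mul,
      add_sub_cancel_right]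
    refine setIntegral_mono_on ((integrableOn_rpow_mul_exp_neg_mul hb0 hs0).const_mul _)
      (integrableOn_mittagIntegrand_extendZero hm ht) measurableSet_Ioi fun τ hτ => ?_
    have := hc (fun j => extendZero P t j ^ 2) (fun _ => sq_nonneg _) τ hτ
    rwa [sum_extendZero_sq_pow, extendZero_coe] at this
  have hpow : s ^ N * (1 / s) ^ (b + 1) = s ^ (-(1 - 1 / (m i : ℝ))) := by
    rw [one_div, Real.inv_rpow hs0.le, ← Real.rpow_neg hs0.le, ← Real.rpow_add hs0]
    congr 1
    ring
  unfold angularFactor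
  rw [← hN, ← hs, ← hpow]
  have hsN : 0 < s ^ N := Real.rpow_pos_of_pos hs0 N
  calc _ = (∏ j ∈ P, (m j : ℝ)) / n.factorial * (s ^ N *
        (c * (t i ^ 2) ^ (m i - 1) * ((1 / s) ^ (b + 1) * Real.Gamma (b + 1)))) := by ring
    _ ≤ _ := by gcongr

/-- Some coordinate of `t₀` is nonzero because the sum is `1`. For that index $m_i\ge2$, so the
exponent of the lower bound is strictly negative and its coefficient stays away from zero. -/
theorem tendsto_angularFactor_atTop (hm : ∀ j, 1 ≤ m j) {P : Finset (Fin n)}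
    (hP : ∀ j ∈ P, m j ≠ 1) {t₀ : P → ℝ} (ht₀ : ∑ j, t₀ j ^ (2 * m j) = 1) :
    Tendsto (angularFactor m P) (𝓝[{t | ∑ j, t j ^ (2 * m j) < 1}] t₀) atTop := by
  obtain ⟨i, hi⟩ : ∃ i, t₀ i ≠ 0 := by
    by_contra! h
    have : ∑ j : P, t₀ j ^ (2 * m j) = 0 := Finset.sum_eq_zero fun j _ => by
      have := hm j
      rw [h j, zero_pow (by omega)]
    linarith
  obtain ⟨c, hc0, hc⟩ := exists_le_angularFactor hm i
  have hmi : (1 : ℝ) < m i := by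
    have h1 := hm i
    have h2 := hP i i.2
    exact_mod_cast (show 1 < m i by omega)
  have hβ : 0 < 1 - 1 / (m i : ℝ) := by
    rw [sub_pos, div_lt_one (by linarith)]
    exact hmi
  refine tendsto_atTop_mono' _ (eventually_mem_nhdsWithin.mono fun t ht => hc t ht) ?_
  have hcont : Continuous fun t : P → ℝ => 1 - ∑ j, t j ^ (2 * m j) := by fun_prop
  have h1 : Tendsto (fun t : P → ℝ => 1 - ∑ j, t j ^ (2 * m j))
      (𝓝[{t | ∑ j, t j ^ (2 * m j) < 1}] t₀) (𝓝[>] 0) := by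
    refine tendsto_nhdsWithin_iff.2 ⟨?_, eventually_mem_nhdsWithin.mono fun t ht => ?_⟩
    · have := hcont.tendsto t₀
      rw [ht₀, sub_self] at this
      exact this.mono_left nhdsWithin_le_nhds
    · have ht' : ∑ j, t j ^ (2 * m j) < 1 := ht
      exact sub_pos.2 ht'
  have h2 : Tendsto (fun t : P → ℝ => (1 - ∑ j, t j ^ (2 * m j)) ^ (-(1 - 1 / (m i : ℝ))))
      (𝓝[{t | ∑ j, t j ^ (2 * m j) < 1}] t₀) atTop := by
    have h3 := (tendsto_rpow_atTop hβ).comp (tendsto_inv_nhdsGT_zero.comp h1)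
    refine h3.congr' (eventually_mem_nhdsWithin.mono fun t ht => ?_)
    have ht' : ∑ j, t j ^ (2 * m j) < 1 := ht
    simp only [Function.comp_def]
    rw [Real.inv_rpow (by linarith), Real.rpow_neg (by linarith)]
  have h4 : Tendsto (fun t : P → ℝ => c * (t i ^ 2) ^ (m i - 1))
      (𝓝[{t | ∑ j, t j ^ (2 * m j) < 1}] t₀) (𝓝 (c * (t₀ i ^ 2) ^ (m i - 1))) :=
    ((by fun_prop : Continuous fun t : P → ℝ => c * (t i ^ 2) ^ (m i - 1)).tendsto t₀).mono_left
      nhdsWithin_le_nhds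
  exact h4.pos_mul_atTop (by positivity) h2

theorem nonneg_and_sum_le_one_of_mem_closure_Δ {z₀ : Fin n → ℂ} {t : P m z₀ → ℝ}
    (ht : t ∈ closure (Δ m z₀)) : (∀ j, 0 ≤ t j) ∧ ∑ j, t j ^ (2 * m j) ≤ 1 := by
  have h1 : IsClosed {t : P m z₀ → ℝ | ∀ j, 0 ≤ t j} := by
    simp only [Set.ofPred_forall]
    exact isClosed_iInter fun j => isClosed_le continuous_const (by fun_prop)
  have h2 : IsClosed {t : P m z₀ → ℝ | ∑ j, t j ^ (2 * m j) ≤ 1} :=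
    isClosed_le (by fun_prop) continuous_const
  have hsub : Δ m z₀ ⊆ {t | ∀ j, 0 ≤ t j} ∩ {t | ∑ j, t j ^ (2 * m j) ≤ 1} :=
    fun t ht => ⟨ht.1, ht.2.le⟩
  exact closure_minimal hsub (h1.inter h2) ht

end Ellipsoid

/-! ### The Levi form of the defining function. -/

namespace Ellipsoid

variable {n : ℕ} {m : Fin n → ℕ}

/-- The real part of the `j`-th coordinate. -/
noncomputable def reCoord (j : Fin n) : (Fin n → ℂ) →L[ℝ] ℝ :=
  Complex.reCLM.comp (ContinuousLinearMap.proj j)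

/-- The imaginary part of the `j`-th coordinate. -/
noncomputable def imCoord (j : Fin n) : (Fin n → ℂ) →L[ℝ] ℝ :=
  Complex.imCLM.comp (ContinuousLinearMap.proj j)

@[simp] theorem reCoord_apply (j : Fin n) (z : Fin n → ℂ) : reCoord j z = (z j).re := rfl

@[simp] theorem imCoord_apply (j : Fin n) (z : Fin n → ℂ) : imCoord j z = (z j).im := rfl

theorem norm_pow_two_mul_eq (z : Fin n → ℂ) (j : Fin n) (k : ℕ) :
    ‖z j‖ ^ (2 * k) = (reCoord j z ^ 2 + imCoord j z ^ 2) ^ k := by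
  rw [pow_mul, ← Complex.normSq_eq_norm_sq, Complex.normSq_apply, ← sq, ← sq]
  rfl

theorem hasFDerivAt_coord_pow (j : Fin n) (k : ℕ) (z : Fin n → ℂ) :
    HasFDerivAt (fun z : Fin n → ℂ => (reCoord j z ^ 2 + imCoord j z ^ 2) ^ k)
      ((2 * k * (reCoord j z ^ 2 + imCoord j z ^ 2) ^ (k - 1)) •
        (reCoord j z • reCoord j + imCoord j z • imCoord j)) z := by
  have h := (((reCoord j).hasFDerivAt (x := z)).pow 2).add (((imCoord j).hasFDerivAt (x := z)).pow 2)
  refine (h.pow k).congr_fderiv ?_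
  ext v
  simp
  ring

theorem fderiv_r (m : Fin n → ℕ) :
    fderiv ℝ (r m) = fun z => -∑ j, (((2 * m j * (reCoord j z ^ 2 + imCoord j z ^ 2) ^ (m j - 1))
      * reCoord j z) • reCoord j + ((2 * m j * (reCoord j z ^ 2 + imCoord j z ^ 2) ^ (m j - 1))
      * imCoord j z) • imCoord j) := by
  have hr : r m = fun z => 1 - ∑ j, (reCoord j z ^ 2 + imCoord j z ^ 2) ^ m j := by
    ext z
    simp only [r, norm_pow_two_mul_eq]
  ext1 z
  rw [hr]
  have h := (HasFDerivAt.fun_sum fun j (_ : j ∈ Finset.univ) =>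
    hasFDerivAt_coord_pow j (m j) z).const_sub 1
  rw [h.fderiv]
  simp only [smul_add, smul_smul]

/-- The combinations of Hessian values at `v`, `I • v`, `w`, `I • w` keep only the mixed
derivatives, and $\partial\bar\partial|z|^{2m}=m^2|z|^{2m-2}$ in one variable. -/
theorem leviForm_r (hm : ∀ j, 1 ≤ m j) (z v w : Fin n → ℂ) :
    leviForm (r m) z v w
      = -∑ j, (m j : ℂ) ^ 2 * (‖z j‖ : ℂ) ^ (2 * (m j - 1)) * (v j * (starRingEnd ℂ) (w j)) := by
  have hH : HasFDerivAt (fderiv ℝ (r m)) (-∑ j,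
      (((2 * m j * (reCoord j z ^ 2 + imCoord j z ^ 2) ^ (m j - 1)) • reCoord j
        + reCoord j z • ((2 * m j : ℝ) • ((2 * (m j - 1 : ℕ) *
          (reCoord j z ^ 2 + imCoord j z ^ 2) ^ (m j - 1 - 1)) •
        (reCoord j z • reCoord j + imCoord j z • imCoord j)))).smulRight (reCoord j)
      + ((2 * m j * (reCoord j z ^ 2 + imCoord j z ^ 2) ^ (m j - 1)) • imCoord j
        + imCoord j z • ((2 * m j : ℝ) • ((2 * (m j - 1 : ℕ) *
          (reCoord j z ^ 2 + imCoord j z ^ 2) ^ (m j - 1 - 1)) •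
        (reCoord j z • reCoord j + imCoord j z • imCoord j)))).smulRight (imCoord j))) z := by
    rw [fderiv_r]
    refine (HasFDerivAt.fun_sum fun j _ => ?_).neg
    have h := (hasFDerivAt_coord_pow j (m j - 1) z).const_mul (2 * m j : ℝ)
    exact ((h.mul (reCoord j).hasFDerivAt).smul_const (reCoord j)).add
      ((h.mul (imCoord j).hasFDerivAt).smul_const (imCoord j))
  have hval : ∀ v w : Fin n → ℂ, fderiv ℝ (fderiv ℝ (r m)) z v w = -∑ j,
      (2 * m j * ‖z j‖ ^ (2 * (m j - 1)) * ((v j).re * (w j).re + (v j).im * (w j).im)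
        + 4 * m j * ((m j - 1 : ℕ) * ‖z j‖ ^ (2 * (m j - 1 - 1))) *
          (((z j).re * (v j).re + (z j).im * (v j).im)
            * ((z j).re * (w j).re + (z j).im * (w j).im))) := fun v w => by
    rw [hH.fderiv, neg_apply, neg_apply, sum_apply, sum_apply]
    congr 1
    refine Finset.sum_congr rfl fun j _ => ?_
    rw [norm_pow_two_mul_eq, norm_pow_two_mul_eq]
    simp
    ring
  -- The second derivative brings in $(m-1)|z|^{2m-4}$; multiplied by $|z|^2$ it recombines. For `m
  -- j = 1` the truncated exponent is harmless, since the coefficient is zero.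
  have hq : ∀ j, ((m j - 1 : ℕ) * ‖z j‖ ^ (2 * (m j - 1 - 1))) * ((z j).re ^ 2 + (z j).im ^ 2)
      = (m j - 1) * ‖z j‖ ^ (2 * (m j - 1)) := fun j => by
    obtain ⟨k, hk⟩ := Nat.exists_eq_add_of_le' (hm j)
    rw [hk, norm_pow_two_mul_eq, norm_pow_two_mul_eq]
    rcases k with _ | k
    · simp
    · simp
      ring
  have key1 : fderiv ℝ (fderiv ℝ (r m)) z v w
      + fderiv ℝ (fderiv ℝ (r m)) z (Complex.I • v) (Complex.I • w)
      = -∑ j, 4 * (m j : ℝ) ^ 2 * ‖z j‖ ^ (2 * (m j - 1)) *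
        ((v j).re * (w j).re + (v j).im * (w j).im) := by
    rw [hval, hval, ← neg_add, ← Finset.sum_add_distrib]
    congr 1
    refine Finset.sum_congr rfl fun j _ => ?_
    simp
    linear_combination 4 * m j * ((v j).re * (w j).re + (v j).im * (w j).im) * hq j
  have key2 : fderiv ℝ (fderiv ℝ (r m)) z v (Complex.I • w)
      - fderiv ℝ (fderiv ℝ (r m)) z (Complex.I • v) w
      = -∑ j, 4 * (m j : ℝ) ^ 2 * ‖z j‖ ^ (2 * (m j - 1)) *
        ((v j).im * (w j).re - (v j).re * (w j).im) := by
    rw [hval, hval, neg_sub_neg, ← neg_sub, ← Finset.sum_sub_distrib]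
    congr 1
    refine Finset.sum_congr rfl fun j _ => ?_
    simp
    linear_combination 4 * m j * ((v j).im * (w j).re - (v j).re * (w j).im) * hq j
  simp only [leviForm]
  rw [key1, key2]
  push_cast
  rw [mul_neg, ← sub_eq_add_neg, ← neg_add', Finset.mul_sum, ← Finset.sum_add_distrib, mul_neg,
    Finset.mul_sum]
  congr 1
  refine Finset.sum_congr rfl fun j _ => ?_
  have hv := Complex.re_add_im (v j)
  have hw : (starRingEnd ℂ) (w j) = (w j).re - (w j).im * Complex.I := by
    apply Complex.ext <;> simp
  rw [hw]
  conv_rhs => rw [← hv]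
  linear_combination
    ((m j : ℂ) ^ 2 * (‖z j‖ : ℂ) ^ (2 * (m j - 1)) * (v j).im * (w j).im) * Complex.I_sq

/-- For `j ∈ P` the `j`-th unit vector is tangential, since $z^0_j=0$ kills its derivative, and its
diagonal entry vanishes because $m_j\ge2$. If `P` is empty all entries are nonzero of one sign, so
pairing `v` with itself forces `v = 0`. -/
theorem leviDegenerateRank_eq_zero_iff (hm : ∀ j, 1 ≤ m j) (z₀ : Fin n → ℂ) :
    leviDegenerateRank (r m) z₀ = 0 ↔ P m z₀ = ∅ := by
  rw [leviDegenerateRank, Submodule.finrank_eq_zero, Submodule.eq_bot_iff]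
  constructor
  · intro h
    by_contra hP
    obtain ⟨j, hj⟩ := Finset.nonempty_iff_ne_empty.2 hP
    simp only [P, Finset.mem_filter, Finset.mem_univ, true_and] at hj
    have hT : ∀ c : ℂ, fderiv ℝ (r m) z₀ (Pi.single j c) = 0 := fun c => by
      rw [fderiv_r, neg_apply, sum_apply, Finset.sum_eq_zero, neg_zero]
      intro i _
      by_cases hij : i = j
      · subst hij
        simp [hj.1]
      · simp [hij]
    have hmem : (Pi.single j 1 : Fin n → ℂ) ∈ leviKernel (r m) z₀ := by
      refine ⟨⟨hT 1, ?_⟩, fun w _ => ?_⟩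
      · rw [← Pi.single_smul]
        exact hT _
      · rw [leviForm_r hm, Finset.sum_eq_zero, neg_zero]
        intro i _
        by_cases hij : i = j
        · subst hij
          have := hm i
          rw [hj.1, norm_zero, Complex.ofReal_zero, zero_pow (by omega)]
          simp
        · simp [hij]
    have := congrFun (h _ hmem) j
    simp at this
  · intro hP v hv
    have h := hv.2 v hv.1
    rw [leviForm_r hm, neg_eq_zero] at h
    have h' : ∑ j, (m j : ℝ) ^ 2 * ‖z₀ j‖ ^ (2 * (m j - 1)) * ‖v j‖ ^ 2 = 0 := by
      have h2 : ((∑ j, (m j : ℝ) ^ 2 * ‖z₀ j‖ ^ (2 * (m j - 1)) * ‖v j‖ ^ 2 : ℝ) : ℂ) = 0 := by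
        rw [← h]
        push_cast
        refine Finset.sum_congr rfl fun j _ => ?_
        rw [Complex.mul_conj, Complex.normSq_eq_norm_sq]
        push_cast
        ring
      exact_mod_cast h2
    rw [Finset.sum_eq_zero_iff_of_nonneg fun j _ => by positivity] at h'
    ext j
    have hj : j ∉ P m z₀ := by simp [hP]
    simp only [P, Finset.mem_filter, Finset.mem_univ, true_and, not_and_or, not_not] at hj
    have hpos : 0 < (m j : ℝ) ^ 2 * ‖z₀ j‖ ^ (2 * (m j - 1)) := by
      have := hm j
      refine mul_pos (by positivity) ?_
      rcases hj with hj | hj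
      · have := norm_pos_iff.2 hj
        positivity
      · simp [hj]
    have := (mul_eq_zero.1 (h' j (Finset.mem_univ j))).resolve_left hpos.ne'
    simpa using this

end Ellipsoid

theorem theorem1 {n : ℕ} (m : Fin n → ℕ) (hm : ∀ j, 1 ≤ m j) :
    ∃ K : (Fin n → ℂ) → ℝ, IsBergmanKernel (Ellipsoid.E m) K ∧
      ∀ z₀ ∈ frontier (Ellipsoid.E m),
        (leviDegenerateRank (Ellipsoid.r m) z₀ = 0 ↔ Ellipsoid.P m z₀ = ∅) ∧
        ∃ Φ : (Ellipsoid.P m z₀ → ℝ) → ℝ,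
          AnalyticOnNhd ℝ Φ (Ellipsoid.Δ m z₀) ∧
          (∃ g : (Fin n → ℂ) → ℝ, AnalyticAt ℝ g z₀ ∧
            ∀ᶠ z in 𝓝[Ellipsoid.E m] z₀,
              K z = (n.factorial : ℝ) / Real.pi ^ n
                  * (∏ j ∈ Ellipsoid.Q m z₀, (m j : ℝ) ^ 2 * ‖z j‖ ^ (2 * m j - 2))
                  * (Φ (Ellipsoid.t m z₀ z) / Ellipsoid.r m z ^ Ellipsoid.exponent m z₀)
                + g z) ∧
          (leviDegenerateRank (Ellipsoid.r m) z₀ = 0 → ∀ t ∈ Ellipsoid.Δ m z₀, Φ t = 1) ∧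
          (0 < leviDegenerateRank (Ellipsoid.r m) z₀ →
            (∀ t ∈ Ellipsoid.Δ m z₀, 0 < Φ t) ∧
            ∀ t₀ ∈ closure (Ellipsoid.Δ m z₀) \ Ellipsoid.Δ m z₀,
              Tendsto Φ (𝓝[Ellipsoid.Δ m z₀] t₀) atTop) := by
  obtain ⟨K, hK⟩ := exists_isBergmanKernel (Ellipsoid.isOpen_E m)
  refine ⟨K, hK, fun z₀ hz₀ => ⟨Ellipsoid.leviDegenerateRank_eq_zero_iff hm z₀,
    Ellipsoid.angularFactor m (Ellipsoid.P m z₀),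
    (Ellipsoid.analyticOnNhd_angularFactor hm _).mono fun t ht => ht.2,
    ⟨_, Ellipsoid.analyticAt_kernel_remainder hm hz₀, eventually_mem_nhdsWithin.mono fun z hz =>
      Ellipsoid.kernel_eq_angularFactor_add hm hK z₀ hz⟩,
    fun h t _ => Ellipsoid.angularFactor_of_eq_empty
      ((Ellipsoid.leviDegenerateRank_eq_zero_iff hm z₀).1 h) t,
    fun _ => ⟨fun t ht => Ellipsoid.angularFactor_pos hm ht.2, fun t₀ ht₀ => ?_⟩⟩⟩
  obtain ⟨h0, h1⟩ := Ellipsoid.nonneg_and_sum_le_one_of_mem_closure_Δ ht₀.1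
  -- The coordinates stay nonnegative in the closure, so a limit point outside `Δ` can only violate
  -- the strict inequality.
  have hsum : ∑ j, t₀ j ^ (2 * m j) = 1 :=
    le_antisymm h1 (not_lt.1 fun h => ht₀.2 ⟨h0, h⟩)
  refine (Ellipsoid.tendsto_angularFactor_atTop hm (fun j hj => ?_) hsum).mono_left
    (nhdsWithin_mono _ fun t ht => ht.2)
  simp only [Ellipsoid.P, Finset.mem_filter] at hj
  exact hj.2.2
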